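/- Conventions. A point-line geometry is a set of points together with a family of sets of points, called lines. It is a *semilinear space* if every line has at least two points, the lines cover the point set, and two distinct lines share at most one point. Points $X,Y$ are *collinear*, $X\sim Y$, if some line contains both. The *join* $M_1\vee M_2$ of two sets of points is the union of $M_1$, $M_2$ and all lines joining distinct collinear points $X_1\in M_1$, $X_2\in M_2$. A *linear mapping* $\chi:\Sigma\to\mathbb P'$ from a semilinear space $\Sigma$ to a projective space $\mathbb P'$ is a map from a subset $\mathbf D(\chi)$ of the points of $\Sigma$ to the points of $\mathbb P'$ such that, writing $X\chi=\emptyset$ if $X\notin\mathbf D(\chi)$ (and otherwise identifying a point with the set it forms), (L1) $(X\vee Y)\chi=X\chi\vee Y\chi$ whenever $X\sim Y$; (L2) if $X\chi=Y\chi$, $X\ne Y$ and $X\sim Y$, then some point $Z$ of the line $XY$ satisfies $Z\chi=\emptyset$. It is *global* if it is defined at every point, and an *embedding* if it is global and injective. A *collineation* of a semilinear space is a permutation $\alpha$ of its points such that $\alpha$ and $\alpha^{-1}$ map lines onto lines (so every permutation of the points of a projective line is one). The product of two semilinear spaces $(\mathcal P_1,\mathcal G_1)$, $(\mathcal P_2,\mathcal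 G_2)$ has point set $\mathcal P_1\times\mathcal P_2$, and its lines are the sets $\{X_1\}\times g_2$ and $g_1\times\{X_2\}$ with $X_i\in\mathcal P_i$, $g_i\in\mathcal G_i$. The closure of a set of points of a projective space is the smallest subspace containing it, and $\dim$ denotes the projective dimension of the closure. Maps are written on the right and composed from left to right. **Theorem.** Let $F$ be a commutative field, $n\ge 2$ and $m\ge 1$ integers, $\mathbb P_1=PG(n,F)$ and $\mathbb P_2=PG(m,F)$ with point sets $\mathcal P_1,\mathcal P_2$, let $\overline{\mathbb P}=PG(nm+n+m,F)$, and let $\mathbb P'$ be a projective space (of arbitrary, possibly infinite, dimension, every line having at least three points). Let $\chi:\mathbb P_1\times\mathbb P_2\to\mathbb P'$ be a linear mapping, and let $\gamma:\mathbb P_1\times\mathbb P_2\to\overline{\mathbb P}$ be a regular embedding, i.e. an embedding with $\dim\big((\mathcal P_1\times\mathcal P_2)\gamma\big)=nm+n+m$. Assume: (i) there are a basis $\{A_0,A_1,\dots,A_m\}$ of $\mathbb P_2$ and a plane $\mathcal E\subseteq\mathcal P_1$ such that, for every $i=1,\dots,m$, $\mathcal E\times\{A_0,A_i\}\subseteq\mathbf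 D(\chi)$ and $\dim\big((\mathcal E\times\{A_0,A_i\})\chi\big)>2$; (ii) there is a point $A\in\mathcal P_1$ with $\dim\big((\{A\}\times\mathcal P_2)\chi\big)=m$. Then there are a collineation $\alpha'$ of $\mathbb P_2$ and a linear mapping $\varphi:\overline{\mathbb P}\to\mathbb P'$ such that, with $\alpha:=(\mathrm{id}_{\mathcal P_1},\alpha')$, one has $\gamma\varphi=\alpha\chi$ as partial maps on $\mathcal P_1\times\mathcal P_2$ (in particular both sides have the same domain). -/

import Mathlib

/-- A point-line geometry on a type `P` of points: a family of sets of points, called lines. -/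
structure PointLineGeometry (P : Type*) where
  /-- The lines of the geometry. -/
  lines : Set (Set P)

namespace PointLineGeometry

variable {P P₁ P₂ P' : Type*}

/-- Semilinear space: every line has at least two points, the lines cover the point set,
and distinct lines share at most one point. -/
structure IsSemilinear (G : PointLineGeometry P) : Prop where
  nontrivial : ∀ g ∈ G.lines, g.Nontrivial
  cover : ⋃₀ G.lines = Set.univ
  inter : ∀ g ∈ G.lines, ∀ h ∈ G.lines, g ≠ h → (g ∩ h).Subsingleton

/-- Projective space (Veblen–Young), of arbitrary finite or infinite dimension: a semilinear
space in which any two distinct points are joined by a line, every line has at least three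
points, and a line that meets two sides of a triangle off their common vertex meets every
other such line. -/
structure IsProjective (G : PointLineGeometry P) : Prop extends G.IsSemilinear where
  exists_line : ∀ x y : P, x ≠ y → ∃ g ∈ G.lines, x ∈ g ∧ y ∈ g
  three_points : ∀ g ∈ G.lines, 3 ≤ g.encard
  veblen : ∀ g₁ ∈ G.lines, ∀ g₂ ∈ G.lines, g₁ ≠ g₂ → ∀ a ∈ g₁ ∩ g₂,
    ∀ h₁ ∈ G.lines, ∀ h₂ ∈ G.lines, a ∉ h₁ → a ∉ h₂ →
      (h₁ ∩ g₁).Nonempty → (h₁ ∩ g₂).Nonempty → (h₂ ∩ g₁).Nonempty → (h₂ ∩ g₂).Nonempty →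
        (h₁ ∩ h₂).Nonempty

/-- Two points are collinear if some line contains both. -/
def Collinear (G : PointLineGeometry P) (x y : P) : Prop :=
  ∃ g ∈ G.lines, x ∈ g ∧ y ∈ g

/-- The join of two sets of points: their union together with all lines that join two distinct
collinear points, one from each set. -/
def join (G : PointLineGeometry P) (s t : Set P) : Set P :=
  s ∪ t ∪ {z | ∃ x ∈ s, ∃ y ∈ t, x ≠ y ∧ ∃ g ∈ G.lines, x ∈ g ∧ y ∈ g ∧ z ∈ g}

/-- A set of points is a subspace if it contains every line joining two of its points. -/
def IsSubspace (G : PointLineGeometry P) (s : Set P) : Prop :=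
  ∀ g ∈ G.lines, ∀ x ∈ s ∩ g, ∀ y ∈ s ∩ g, x ≠ y → g ⊆ s

/-- The (projective) closure of a set of points: the smallest subspace containing it. -/
def closure (G : PointLineGeometry P) (s : Set P) : Set P :=
  ⋂₀ {t | G.IsSubspace t ∧ s ⊆ t}

/-- One more than the projective dimension of the closure of `s`: the least number of points
that generate this closure. The empty set has value `0` (dimension `-1`), a point has value `1`,
a line has value `2`, and so on. -/
noncomputable def dimSucc (G : PointLineGeometry P) (s : Set P) : ℕ∞ :=
  ⨅ (t : Set P) (_ : G.closure t = G.closure s), t.encard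

/-- The product of two point-line geometries: the lines are the sets `{x₁} × g₂` and
`g₁ × {x₂}` with `xᵢ` a point and `gᵢ` a line of the `i`-th factor. -/
def prod (G₁ : PointLineGeometry P₁) (G₂ : PointLineGeometry P₂) :
    PointLineGeometry (P₁ × P₂) where
  lines := {l | (∃ x₁ : P₁, ∃ g₂ ∈ G₂.lines, l = {x₁} ×ˢ g₂) ∨
    (∃ g₁ ∈ G₁.lines, ∃ x₂ : P₂, l = g₁ ×ˢ {x₂})}

/-- Linear mappings: partial maps satisfying (L1) and (L2). The image under `χ` of a point
outside the domain `χ.Dom` is the empty set. -/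
structure IsLinearMapping (G : PointLineGeometry P) (G' : PointLineGeometry P')
    (χ : P →. P') : Prop where
  image_join : ∀ x y : P, G.Collinear x y →
    χ.image (G.join {x} {y}) = G'.join (χ.image {x}) (χ.image {y})
  exists_exceptional : ∀ x y : P, χ.image {x} = χ.image {y} → x ≠ y → G.Collinear x y →
    ∃ a ∈ G.join {x} {y}, χ.image {a} = ∅

/-- Embeddings: linear mappings that are global (defined at every point) and injective. -/
structure IsEmbedding (G : PointLineGeometry P) (G' : PointLineGeometry P')
    (χ : P →. P') : Prop extends G.IsLinearMapping G' χ where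
  global : χ.Dom = Set.univ
  injective : ∀ x y : P, χ.image {x} = χ.image {y} → x = y

/-- Collineations (automorphisms): permutations `α` of the point set such that both `α` and its
inverse map lines onto lines. -/
def IsCollineation (G : PointLineGeometry P) (α : Equiv.Perm P) : Prop :=
  ∀ g : Set P, g ∈ G.lines ↔ α '' g ∈ G.lines

end PointLineGeometry

/-- The set of points of the projective space over `V` that lie in the linear subspace `W`;
it has projective dimension `finrank W - 1`. -/
def pgPoints {F V : Type*} [Field F] [AddCommGroup V] [Module F V] (W : Submodule F V) :
    Set (Projectivization F V) :=
  {p | p.submodule ≤ W}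

/-- The point set of `PG(d, F)`. -/
abbrev PGPoint (d : ℕ) (F : Type*) [Field F] : Type _ :=
  Projectivization F (Fin (d + 1) → F)

/-- The projective space `PG(d, F)`; its lines come from the two-dimensional linear subspaces
of `F ^ (d + 1)`. -/
def PG (d : ℕ) (F : Type*) [Field F] : PointLineGeometry (PGPoint d F) where
  lines := {g | ∃ W : Submodule F (Fin (d + 1) → F), Module.finrank F W = 2 ∧ g = pgPoints W}

-- Points are replaced by representing vectors. A linear mapping becomes a partial map of vectors
-- (`IsVecLinear`) and, once the target has coordinates, a map of vectors that matters only up to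
-- non-zero factors (`IsProjMap`). The goal is to show that `χ` and `γ` are both induced by bilinear
-- maps, each after a collineation of the second factor. For `γ`, regularity turns the induced map
-- of `V₁ ⊗ V₂` into a bijection of points, by a count of dimensions. Its inverse followed by the
-- map of tensors that belongs to `χ` is `φ`, and `α'` is built from the two collineations.
--
-- Coordinates. `P'` need not come from a vector space. By (i), however, `χ` is defined, and so
-- injective, on the plane `E × {A₀}`, which gives a plane of `P'` with coordinates in `F`. A
-- subspace with coordinates, of dimension at least two, and a point off it generate a subspace that
-- again has coordinates (`exists_extend_coordinates`): the translates of the point are constructed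
-- from the Veblen axiom. Finitely many such steps cover the image of `χ`.
--
-- Pencils. In suitable coordinates the slice of `χ` at `A₀` is a linear map `f₀`. By the
-- fundamental theorem the slice at `Aᵢ` is semilinear (`exists_semilinear_lift_of_indep`). As the
-- two images of `E` span more than a plane, either some line of `E` has skew images or the two maps
-- are proportional along a line, and in both cases the companion map is the identity
-- (`exists_skew_or_axis`, `companion_eq_of_skew`). Each slice at a point of the line `A₀Aᵢ` is then
-- induced by a single combination of `f₀` and `fᵢ` (`exists_pencilMap`).
--
-- Gluing. Which combination belongs to which point is still open; this is the source of the
-- collineation. Let `B(x, bᵢ) = fᵢ x`. By (ii) the slice at `A` and `B(A, ·)` are two coordinate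
-- systems of the same subspace, hence differ by a collineation. After it is applied, comparison at
-- `A` identifies the combinations on all lines `A₀Aᵢ`. Agreement on these lines propagates to all
-- of `V₂` when `f₀ x ≠ 0` (`IsProjMap.proportional_of_basis`). The other `x` follow because linear
-- mappings that agree off a proper subspace are equal (`IsProjMap.proportional_of_off_subspace`).
-- The result is `exists_bilinear_coordinates`, which serves both `χ` and `γ`.

universe u

open scoped LinearAlgebra.Projectivization TensorProduct

/-! ### Linear mappings in terms of vectors -/

section VectorMaps

variable {F V W U Q : Type*} [Field F] [AddCommGroup V] [Module F V] [AddCommGroup W] [Module F W]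
  [AddCommGroup U] [Module F U]

/-- Two vectors are proportional if they differ by a non-zero scalar factor. -/
def Proportional (F : Type*) {V : Type*} [Field F] [AddCommGroup V] [Module F V] (v w : V) : Prop :=
  ∃ c : F, c ≠ 0 ∧ v = c • w

namespace Proportional

theorem refl (v : V) : Proportional F v v := ⟨1, one_ne_zero, (one_smul _ _).symm⟩

theorem symm {v w : V} (h : Proportional F v w) : Proportional F w v := by
  obtain ⟨c, hc, rfl⟩ := h
  exact ⟨c⁻¹, inv_ne_zero hc, by rw [smul_smul, inv_mul_cancel₀ hc, one_smul]⟩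

theorem trans {v w u : V} (h : Proportional F v w) (h' : Proportional F w u) :
    Proportional F v u := by
  obtain ⟨c, hc, rfl⟩ := h
  obtain ⟨d, hd, rfl⟩ := h'
  exact ⟨c * d, mul_ne_zero hc hd, by rw [smul_smul]⟩

theorem smul_left {c : F} (hc : c ≠ 0) (v : V) : Proportional F (c • v) v := ⟨c, hc, rfl⟩

theorem eq_zero {v : V} (h : Proportional F v 0) : v = 0 := by
  obtain ⟨c, _, rfl⟩ := h
  simp

theorem eq_zero_iff {v w : V} (h : Proportional F v w) : v = 0 ↔ w = 0 :=
  ⟨fun h' => (h' ▸ h.symm : Proportional F w 0).eq_zero, fun h' => (h' ▸ h).eq_zero⟩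

theorem map {v w : V} (h : Proportional F v w) (f : V →ₗ[F] W) : Proportional F (f v) (f w) := by
  obtain ⟨c, hc, rfl⟩ := h
  exact ⟨c, hc, map_smul f c w⟩

end Proportional

/-- Linear independence of two vectors, in coefficients. -/
def Indep₂ (F : Type*) {V : Type*} [Field F] [AddCommGroup V] [Module F V] (v w : V) : Prop :=
  ∀ s t : F, s • v + t • w = 0 → s = 0 ∧ t = 0

/-- Linear independence of three vectors, in coefficients. -/
def Indep₃ (F : Type*) {V : Type*} [Field F] [AddCommGroup V] [Module F V] (v w u : V) : Prop :=
  ∀ r s t : F, r • v + s • w + t • u = 0 → r = 0 ∧ s = 0 ∧ t = 0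

/-- Linear independence of four vectors, in coefficients. -/
def Indep₄ (F : Type*) {V : Type*} [Field F] [AddCommGroup V] [Module F V] (v w u x : V) : Prop :=
  ∀ q r s t : F, q • v + r • w + s • u + t • x = 0 → q = 0 ∧ r = 0 ∧ s = 0 ∧ t = 0

theorem Indep₂.ne_zero_left {v w : V} (h : Indep₂ F v w) : v ≠ 0 := by
  rintro rfl
  exact one_ne_zero (h 1 0 (by simp)).1

theorem Indep₂.symm {v w : V} (h : Indep₂ F v w) : Indep₂ F w v := fun s t e =>
  (h t s (by rw [← e]; module)).symm

theorem Indep₂.ne_zero_right {v w : V} (h : Indep₂ F v w) : w ≠ 0 := h.symm.ne_zero_left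

theorem Indep₂.not_proportional {v w : V} (h : Indep₂ F v w) : ¬ Proportional F v w := by
  rintro ⟨c, -, rfl⟩
  exact one_ne_zero (h 1 (-c) (by module)).1

theorem indep₂_of_not_mem {v w : V} (hv : v ≠ 0) (h : ∀ c : F, w ≠ c • v) : Indep₂ F v w := by
  intro s t e
  have ht : t = 0 := by
    by_contra ht
    refine h (-(t⁻¹ * s)) ?_
    have : t⁻¹ • (s • v + t • w) = 0 := by rw [e, smul_zero]
    rw [smul_add, smul_smul, smul_smul, inv_mul_cancel₀ ht, one_smul] at this
    rw [neg_smul]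
    exact eq_neg_of_add_eq_zero_right this
  subst ht
  simpa [hv] using e

theorem indep₂_of_not_proportional {v w : V} (hv : v ≠ 0) (hw : w ≠ 0)
    (h : ¬ Proportional F v w) : Indep₂ F v w := by
  refine indep₂_of_not_mem hv ?_
  rintro c rfl
  refine h ⟨c⁻¹, inv_ne_zero ?_, ?_⟩
  · rintro rfl
    simp at hw
  · rw [smul_smul, inv_mul_cancel₀, one_smul]
    rintro rfl
    simp at hw

/-- A map between vector spaces that induces a linear mapping of projective spaces; vectors
sent to zero represent the points without image. -/
structure IsProjMap (F : Type*) {V W : Type*} [Field F] [AddCommGroup V] [Module F V]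
    [AddCommGroup W] [Module F W] (g : V → W) : Prop where
  map_zero : g 0 = 0
  map_smul : ∀ (c : F) (v : V), c ≠ 0 → Proportional F (g (c • v)) (g v)
  map_add : ∀ v w : V, ∃ a b : F, g (v + w) = a • g v + b • g w
  exists_kernel : ∀ v w : V, Proportional F (g v) (g w) → ∃ c : F, c ≠ 0 ∧ g (v + c • w) = 0
  exists_preimage : ∀ (v w : V) (a b : F), ∃ s t : F,
    Proportional F (g (s • v + t • w)) (a • g v + b • g w)

theorem IsProjMap.comp_linear {g : V → W} (hg : IsProjMap F g) (f : U →ₗ[F] V) :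
    IsProjMap F (fun u => g (f u)) where
  map_zero := by rw [f.map_zero, hg.map_zero]
  map_smul c v hc := by rw [f.map_smul]; exact hg.map_smul c _ hc
  map_add v w := by rw [f.map_add]; exact hg.map_add _ _
  exists_kernel v w h := by
    simpa only [f.map_add, f.map_smul] using hg.exists_kernel _ _ h
  exists_preimage v w a b := by
    simpa only [f.map_add, f.map_smul] using hg.exists_preimage (f v) (f w) a b

/-- The vectors without image form a subspace. -/
def IsProjMap.kernel {g : V → W} (hg : IsProjMap F g) : Submodule F V where
  carrier := {v | g v = 0}
  zero_mem' := hg.map_zero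
  add_mem' {v w} hv hw := by
    obtain ⟨a, b, h⟩ := hg.map_add v w
    simp only [Set.mem_ofPred_eq] at hv hw ⊢
    rw [h, hv, hw, smul_zero, smul_zero, add_zero]
  smul_mem' c v hv := by
    by_cases hc : c = 0
    · simpa [hc] using hg.map_zero
    · exact (hg.map_smul c v hc).eq_zero_iff.2 hv

theorem IsProjMap.mem_kernel {g : V → W} (hg : IsProjMap F g) {v : V} :
    v ∈ hg.kernel ↔ g v = 0 := Iff.rfl

/-- The additivity in `IsProjMap` allows zero coefficients. If that of `w` vanishes, then `v + w` is
in the kernel, hence so is `w`, and both sides are zero. Kernel vectors may therefore be dropped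
from any sum. -/
theorem IsProjMap.proportional_of_add_kernel {g : V → W} (hg : IsProjMap F g) {v w : V}
    (hv : g v = 0) : Proportional F (g (v + w)) (g w) := by
  obtain ⟨a, b, h⟩ := hg.map_add v w
  rw [hv, smul_zero, zero_add] at h
  by_cases hb : b = 0
  · rw [hb, zero_smul] at h
    have : w ∈ hg.kernel := by
      have := hg.kernel.sub_mem (show v + w ∈ hg.kernel from h) (show v ∈ hg.kernel from hv)
      simpa using this
    rw [h, hg.mem_kernel.1 this]
    exact .refl 0
  · exact ⟨b, hb, h⟩

theorem IsProjMap.congr {g g' : V → W} (hg : IsProjMap F g)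
    (h : ∀ v, Proportional F (g' v) (g v)) : IsProjMap F g' where
  map_zero := by simpa [hg.map_zero] using (h 0).eq_zero_iff
  map_smul c v hc := (h _).trans ((hg.map_smul c v hc).trans (h v).symm)
  map_add v w := by
    obtain ⟨a, b, e⟩ := hg.map_add v w
    obtain ⟨c, hc, e₀⟩ := h (v + w)
    obtain ⟨d, hd, e₁⟩ := (h v).symm
    obtain ⟨d', hd', e₂⟩ := (h w).symm
    exact ⟨c * a * d, c * b * d', by rw [e₀, e, e₁, e₂]; module⟩
  exists_kernel v w hvw := by
    obtain ⟨c, hc, e⟩ := hg.exists_kernel v w ((h v).symm.trans (hvw.trans (h w)))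
    exact ⟨c, hc, (h _).eq_zero_iff.2 e⟩
  exists_preimage v w a b := by
    obtain ⟨d, hd, e₁⟩ := h v
    obtain ⟨d', hd', e₂⟩ := h w
    obtain ⟨s, t, e⟩ := hg.exists_preimage v w (a * d) (b * d')
    refine ⟨s, t, (h _).trans ?_⟩
    rwa [e₁, e₂, smul_smul, smul_smul]

theorem LinearMap.isProjMap (f : V →ₗ[F] W) : IsProjMap F f where
  map_zero := f.map_zero
  map_smul c v hc := ⟨c, hc, f.map_smul c v⟩
  map_add v w := ⟨1, 1, by simp⟩
  exists_kernel v w h := by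
    obtain ⟨c, hc, e⟩ := h
    exact ⟨-c, neg_ne_zero.2 hc, by simp [e]⟩
  exists_preimage v w a b := ⟨a, b, by simpa using .refl _⟩

/-- A partial map from a vector space to the points of a geometry that comes from a linear mapping
of the projective space over the vector space. -/
structure IsVecLinear (F : Type*) {V Q : Type*} [Field F] [AddCommGroup V] [Module F V]
    (G : PointLineGeometry Q) (q : V → Option Q) : Prop where
  map_zero : q 0 = none
  map_smul : ∀ (c : F) (v : V), c ≠ 0 → q (c • v) = q v
  map_add_of_none : ∀ v w : V, q v = none → q (v + w) = q w
  exists_none : ∀ v w : V, q v = q w → ∃ c : F, c ≠ 0 ∧ q (v + c • w) = none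
  mem_line : ∀ (v w : V) (a b : Q), q v = some a → q w = some b → a ≠ b → ∀ g ∈ G.lines,
    a ∈ g → b ∈ g → ∀ p, p ∈ g ↔ ∃ s t : F, q (s • v + t • w) = some p

namespace IsVecLinear

variable {G : PointLineGeometry Q}

theorem comp_linear {q : V → Option Q} (hq : IsVecLinear F G q) (f : U →ₗ[F] V) :
    IsVecLinear F G (fun u => q (f u)) where
  map_zero := by rw [f.map_zero, hq.map_zero]
  map_smul c v hc := by rw [f.map_smul]; exact hq.map_smul c _ hc
  map_add_of_none v w h := by rw [f.map_add]; exact hq.map_add_of_none _ _ h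
  exists_none v w h := by
    simpa only [f.map_add, f.map_smul] using hq.exists_none _ _ h
  mem_line v w a b := by
    simpa only [f.map_add, f.map_smul] using hq.mem_line (f v) (f w) a b

theorem eq_of_proportional {q : V → Option Q} (hq : IsVecLinear F G q) {v w : V}
    (h : Proportional F v w) : q v = q w := by
  obtain ⟨c, hc, rfl⟩ := h
  exact hq.map_smul c w hc

theorem proportional_of_eq {q : V → Option Q} (hq : IsVecLinear F G q)
    (hk : ∀ v, q v = none → v = 0) {v w : V} (h : q v = q w) : Proportional F v w := by
  obtain ⟨c, hc, e⟩ := hq.exists_none v w h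
  refine ⟨-c, neg_ne_zero.2 hc, ?_⟩
  rw [neg_smul]
  exact eq_neg_of_add_eq_zero_left (hk _ e)

theorem ne_none_of_ne {q : V → Option Q} (hq : IsVecLinear F G q) {v w : V} (h : q v ≠ q w) :
    q (v + w) ≠ none := by
  intro e
  apply h
  have h1 := hq.map_add_of_none (v + w) ((-1 : F) • w) e
  rw [hq.map_smul _ _ (by simp)] at h1
  rw [← h1]
  congr 1
  module

/-- Lifting a linear mapping through coordinates of the target. -/
theorem isProjMap_of_comp (hG : G.IsProjective) {ψ : W → Option Q} (hψ : IsVecLinear F G ψ)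
    (hk : ∀ v, ψ v = none → v = 0) {g : V → W} (hq : IsVecLinear F G (fun v => ψ (g v))) :
    IsProjMap F g := by
  have key : ∀ v w, ψ v = ψ w → Proportional F v w := fun v w h => hψ.proportional_of_eq hk h
  have line : ∀ v w : V, g v ≠ 0 → g w ≠ 0 → ¬ Proportional F (g v) (g w) →
      ∃ a b l, ψ (g v) = some a ∧ ψ (g w) = some b ∧ a ≠ b ∧ l ∈ G.lines ∧ a ∈ l ∧ b ∈ l := by
    intro v w hv hw h
    obtain ⟨a, ha⟩ := Option.ne_none_iff_exists'.1 (fun e => hv (hk _ e))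
    obtain ⟨b, hb⟩ := Option.ne_none_iff_exists'.1 (fun e => hw (hk _ e))
    have hab : a ≠ b := by
      rintro rfl
      exact h (key _ _ (ha.trans hb.symm))
    obtain ⟨l, hl, h1, h2⟩ := hG.exists_line a b hab
    exact ⟨a, b, l, ha, hb, hab, hl, h1, h2⟩
  refine ⟨hk _ hq.map_zero, fun c v hc => key _ _ (hq.map_smul c v hc), fun v w => ?_,
    fun v w h => ?_, fun v w a b => ?_⟩
  · by_cases hv : g v = 0
    · obtain ⟨c, -, e⟩ := key _ _ (hq.map_add_of_none v w (by simp [hv, hψ.map_zero]))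
      exact ⟨0, c, by simp [e]⟩
    by_cases hw : g w = 0
    · obtain ⟨c, -, e⟩ := key _ _ (hq.map_add_of_none w v (by simp [hw, hψ.map_zero]))
      exact ⟨c, 0, by rw [add_comm, e]; simp⟩
    by_cases h : Proportional F (g v) (g w)
    -- As `v + c • w` has no image, it can be dropped from `v + w = (v + c • w) + (1 - c) • w`.
    · obtain ⟨c, hc, e⟩ := hq.exists_none v w (hψ.eq_of_proportional h)
      have e1 := key _ _ (hq.map_add_of_none _ ((1 - c) • w) e)
      have e2 : v + c • w + (1 - c) • w = v + w := by module
      rw [e2] at e1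
      obtain ⟨d, hd, e1⟩ := e1
      by_cases hc1 : 1 - c = 0
      · rw [hc1, zero_smul, hk _ hq.map_zero, smul_zero] at e1
        exact ⟨0, 0, by simp [e1]⟩
      · obtain ⟨d', -, e3⟩ := key _ _ (hq.map_smul _ w hc1)
        exact ⟨0, d * d', by rw [e1, e3]; module⟩
    · obtain ⟨a, b, l, ha, hb, hab, hl, h1, h2⟩ := line v w hv hw h
      have := hq.ne_none_of_ne (v := v) (w := w) (by rw [ha, hb]; simpa using hab)
      obtain ⟨p, hp⟩ := Option.ne_none_iff_exists'.1 this
      have hp' : p ∈ l := (hq.mem_line v w a b ha hb hab l hl h1 h2 p).2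
        ⟨1, 1, by simpa using hp⟩
      obtain ⟨s, t, e⟩ := (hψ.mem_line _ _ a b ha hb hab l hl h1 h2 p).1 hp'
      obtain ⟨c, -, e⟩ := key _ _ (hp.trans e.symm)
      exact ⟨c * s, c * t, by rw [e]; module⟩
  · obtain ⟨c, hc, e⟩ := hq.exists_none v w (hψ.eq_of_proportional h)
    exact ⟨c, hc, hk _ e⟩
  · by_cases hu : a • g v + b • g w = 0
    · exact ⟨0, 0, by rw [hu]; simpa [hk _ hq.map_zero] using .refl 0⟩
    by_cases hv : g v = 0
    · refine ⟨0, 1, ?_⟩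
      rw [hv, smul_zero, zero_add] at hu ⊢
      simp only [zero_smul, zero_add, one_smul]
      exact (Proportional.smul_left (by rintro rfl; simp at hu) _).symm
    by_cases hw : g w = 0
    · refine ⟨1, 0, ?_⟩
      rw [hw, smul_zero, add_zero] at hu ⊢
      simp only [zero_smul, add_zero, one_smul]
      exact (Proportional.smul_left (by rintro rfl; simp at hu) _).symm
    by_cases h : Proportional F (g v) (g w)
    · obtain ⟨c, hc, e⟩ := h
      refine ⟨0, 1, ?_⟩
      have : a • g v + b • g w = (a * c + b) • g w := by rw [e]; module
      rw [this] at hu ⊢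
      simp only [zero_smul, zero_add, one_smul]
      exact (Proportional.smul_left (by intro h0; simp [h0] at hu) _).symm
    · obtain ⟨x, y, l, hx, hy, hxy, hl, h1, h2⟩ := line v w hv hw h
      obtain ⟨p, hp⟩ := Option.ne_none_iff_exists'.1 (fun e => hu (hk _ e))
      have hp' := (hψ.mem_line _ _ x y hx hy hxy l hl h1 h2 p).2 ⟨a, b, hp⟩
      obtain ⟨s, t, e⟩ := (hq.mem_line v w x y hx hy hxy l hl h1 h2 p).1 hp'
      exact ⟨s, t, key _ _ (e.trans hp.symm)⟩

/-- This is where `exists_preimage` is needed: an exceptional vector of `q`, or a point on a line of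
the target, is found among the combinations of values of `g` and has to be pulled back to a
combination of arguments. -/
theorem comp_projMap {q : W → Option Q} (hq : IsVecLinear F G q) {g : V → W}
    (hg : IsProjMap F g) : IsVecLinear F G (fun v => q (g v)) := by
  have none_comb : ∀ v w (a b : F), q v = none → q w = none → q (a • v + b • w) = none := by
    have hs : ∀ v (a : F), q v = none → q (a • v) = none := by
      intro v a hv
      by_cases ha : a = 0
      · rw [ha, zero_smul, hq.map_zero]
      · rw [hq.map_smul a v ha, hv]
    intro v w a b hv hw
    rw [hq.map_add_of_none _ _ (hs v a hv), hs w b hw]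
  refine ⟨by rw [hg.map_zero, hq.map_zero],
    fun c v hc => hq.eq_of_proportional (hg.map_smul c v hc), fun v w h => ?_, fun v w h => ?_,
    fun v w a b ha hb hab l hl hal hbl p => ?_⟩
  · obtain ⟨a, b, e⟩ := hg.map_add v w
    by_cases hb : b = 0
    · have h1 : q (g (v + w)) = none := by
        rw [e, hb]; simpa using none_comb _ _ a 0 h h
      rw [h1]
      obtain ⟨a', b', e'⟩ := hg.map_add (v + w) ((-1 : F) • v)
      rw [show v + w + (-1 : F) • v = w by module] at e'
      rw [e', none_comb _ _ _ _ h1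
        ((hq.eq_of_proportional (hg.map_smul (-1) v (by simp))).trans h)]
    · have h1 : q (a • g v) = none := by simpa using none_comb _ _ a 0 h h
      rw [e, hq.map_add_of_none _ _ h1, hq.map_smul b _ hb]
  · by_cases hn : q (g v) = none
    · refine ⟨1, one_ne_zero, ?_⟩
      obtain ⟨a, b, e⟩ := hg.map_add v w
      rw [one_smul, e]
      exact none_comb _ _ _ _ hn (h ▸ hn)
    obtain ⟨c, hc, e⟩ := hq.exists_none _ _ h
    obtain ⟨s, t, hst⟩ := hg.exists_preimage v w 1 c
    rw [one_smul] at hst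
    have hu : q (g (s • v + t • w)) = none := (hq.eq_of_proportional hst).trans e
    -- In this case the preimage `s • v + t • w` may be zero and carry no information, so the kernel
    -- of `g` is used instead.
    by_cases h0 : g v + c • g w = 0
    · exact (hg.exists_kernel v w ⟨-c, neg_ne_zero.2 hc, by
        rw [neg_smul]; exact eq_neg_of_add_eq_zero_left h0⟩).imp
        fun d hd => ⟨hd.1, by rw [hd.2, hq.map_zero]⟩
    by_cases hs : s = 0
    · exfalso
      by_cases ht : t = 0
      · rw [hs, ht, zero_smul, zero_smul, add_zero, hg.map_zero] at hst
        exact h0 hst.symm.eq_zero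
      · rw [hs, zero_smul, zero_add, hq.eq_of_proportional (hg.map_smul t w ht)] at hu
        exact hn (h.trans hu)
    by_cases ht : t = 0
    · rw [ht, zero_smul, add_zero, hq.eq_of_proportional (hg.map_smul s v hs)] at hu
      exact absurd hu hn
    refine ⟨s⁻¹ * t, mul_ne_zero (inv_ne_zero hs) ht, ?_⟩
    rw [← hu, ← hq.eq_of_proportional (hg.map_smul s (v + (s⁻¹ * t) • w) hs), smul_add, smul_smul,
      ← mul_assoc, mul_inv_cancel₀ hs, one_mul]
  · rw [hq.mem_line _ _ a b ha hb hab l hl hal hbl p]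
    constructor
    · rintro ⟨s, t, e⟩
      obtain ⟨s', t', h⟩ := hg.exists_preimage v w s t
      exact ⟨s', t', (hq.eq_of_proportional h).trans e⟩
    · rintro ⟨s, t, e⟩
      obtain ⟨x, y, h⟩ := hg.map_add (s • v) (t • w)
      have h1 : ∀ (s : F) (v : V), ∃ c : F, g (s • v) = c • g v := by
        intro s v
        by_cases hs : s = 0
        · exact ⟨0, by rw [hs, zero_smul, zero_smul, hg.map_zero]⟩
        · exact (hg.map_smul s v hs).imp fun c hc => hc.2
      obtain ⟨c, hc⟩ := h1 s v
      obtain ⟨d, hd⟩ := h1 t w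
      refine ⟨x * c, y * d, ?_⟩
      rw [← e, h, hc, hd, smul_smul, smul_smul]

end IsVecLinear

end VectorMaps

/-! ### Points off a subspace with coordinates, and directions between them -/

section Extension

variable {F V Q : Type*} {G : PointLineGeometry Q} {ψ : V → Option Q}

theorem PointLineGeometry.IsProjective.line_eq (hG : G.IsProjective) {g h : Set Q} {a b : Q}
    (hg : g ∈ G.lines) (hh : h ∈ G.lines) (hab : a ≠ b) (hag : a ∈ g) (hbg : b ∈ g) (hah : a ∈ h)
    (hbh : b ∈ h) : g = h := by
  by_contra hne
  exact hab (hG.inter g hg h hh hne ⟨hag, hah⟩ ⟨hbg, hbh⟩)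

/-- Two points off the image of `ψ` whose joining line meets this image in the point `ψ d`. -/
def HasDirection (G : PointLineGeometry Q) (ψ : V → Option Q) (a b : Q) (d : V) : Prop :=
  a ≠ b ∧ (∀ v, ψ v ≠ some a) ∧ (∀ v, ψ v ≠ some b) ∧
    ∃ g ∈ G.lines, a ∈ g ∧ b ∈ g ∧ ∃ s ∈ g, ψ d = some s

theorem HasDirection.symm {a b : Q} {d : V} (h : HasDirection G ψ a b d) :
    HasDirection G ψ b a d := by
  obtain ⟨h1, h2, h3, g, hg, h4, h5, h6⟩ := h
  exact ⟨h1.symm, h3, h2, g, hg, h5, h4, h6⟩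

variable [Field F] [AddCommGroup V] [Module F V]

theorem HasDirection.congr (hψ : IsVecLinear F G ψ) {a b : Q} {d d' : V}
    (h : HasDirection G ψ a b d) (hd : Proportional F d' d) : HasDirection G ψ a b d' := by
  obtain ⟨h1, h2, h3, g, hg, h4, h5, s, hs, h6⟩ := h
  exact ⟨h1, h2, h3, g, hg, h4, h5, s, hs, (hψ.eq_of_proportional hd).trans h6⟩

theorem HasDirection.rev (hψ : IsVecLinear F G ψ) {a b : Q} {v w : V}
    (h : HasDirection G ψ a b (v - w)) : HasDirection G ψ b a (w - v) :=
  h.symm.congr hψ ⟨-1, by simp, by module⟩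

variable (hG : G.IsProjective) (hψ : IsVecLinear F G ψ) (hk : ∀ v, ψ v = none → v = 0)
include hψ

/-- Otherwise the line would be contained in the image of `ψ`, which is a subspace, and with it the
point `a`. -/
theorem trace_unique {g : Set Q} (hg : g ∈ G.lines) {a s t : Q} (ha : a ∈ g)
    (hoff : ∀ v, ψ v ≠ some a) (hs : s ∈ g) (ht : t ∈ g) {v w : V} (hv : ψ v = some s)
    (hw : ψ w = some t) : s = t := by
  by_contra hne
  obtain ⟨x, y, h⟩ := (hψ.mem_line v w s t hv hw hne g hg hs ht a).1 ha
  exact hoff _ h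

include hG hk

theorem exists_line_of_indep {v w : V} (h : Indep₂ F v w) :
    ∃ g ∈ G.lines, ∀ p, p ∈ g ↔ ∃ s t : F, ψ (s • v + t • w) = some p := by
  obtain ⟨a, ha⟩ := Option.ne_none_iff_exists'.1 (fun e => h.ne_zero_left (hk _ e))
  obtain ⟨b, hb⟩ := Option.ne_none_iff_exists'.1 (fun e => h.ne_zero_right (hk _ e))
  have hab : a ≠ b := by
    rintro rfl
    exact h.not_proportional (hψ.proportional_of_eq hk (ha.trans hb.symm))
  obtain ⟨g, hg, h1, h2⟩ := hG.exists_line a b hab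
  exact ⟨g, hg, hψ.mem_line v w a b ha hb hab g hg h1 h2⟩

/-- Such a point is on the line joining `a` to `ψ v` and on the line joining `b` to `ψ w`. Two
common points would make these lines equal, and the line would meet the image of `ψ` twice. -/
theorem HasDirection.unique {a b c c' : Q} {v w : V} (hvw : Indep₂ F v w)
    (h1 : HasDirection G ψ c a v) (h2 : HasDirection G ψ c b w)
    (h1' : HasDirection G ψ c' a v) (h2' : HasDirection G ψ c' b w) : c = c' := by
  obtain ⟨hca, hc, ha, g, hg, hcg, hag, s, hsg, hs⟩ := h1
  obtain ⟨hcb, -, hb, h, hh, hch, hbh, t, hth, ht⟩ := h2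
  obtain ⟨hca', hc', -, g', hg', hcg', hag', s', hsg', hs'⟩ := h1'
  obtain ⟨hcb', -, -, h', hh', hch', hbh', t', hth', ht'⟩ := h2'
  have e1 : s' = s := Option.some.inj (hs'.symm.trans hs)
  have e2 : t' = t := Option.some.inj (ht'.symm.trans ht)
  subst e1 e2
  have e3 : g = g' := hG.line_eq hg hg' (fun e : a = s' => ha v (e ▸ hs)) hag hsg hag' hsg'
  have e4 : h = h' := hG.line_eq hh hh' (fun e : b = t' => hb w (e ▸ ht)) hbh hth hbh' hth'
  subst e3 e4
  by_contra hne
  have e5 := hG.line_eq hg hh hne hcg hcg' hch hch'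
  subst e5
  have := trace_unique hψ hg hcg hc hsg hth hs ht
  subst this
  exact hvw.not_proportional (hψ.proportional_of_eq hk (hs.trans ht.symm))

/-- The apex is the intersection of the line from `a` to `ψ v` with the line from `b` to `ψ w`. The
Veblen axiom provides it: both lines meet the line `ab` and the line joining `ψ v` to `ψ w`, and
these two share the point `ψ (w - v)`. -/
theorem exists_apex {a b : Q} {v w : V} (hvw : Indep₂ F v w)
    (hab : HasDirection G ψ a b (w - v)) :
    ∃ c, HasDirection G ψ c a v ∧ HasDirection G ψ c b w := by
  obtain ⟨hne, ha, hb, g₁, hg₁, hag, hbg, o, hog, ho⟩ := hab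
  obtain ⟨g₂, hg₂, H⟩ := exists_line_of_indep hG hψ hk hvw
  obtain ⟨s, hs⟩ := Option.ne_none_iff_exists'.1 (fun e => hvw.ne_zero_left (hk _ e))
  obtain ⟨t, ht⟩ := Option.ne_none_iff_exists'.1 (fun e => hvw.ne_zero_right (hk _ e))
  have hsg₂ : s ∈ g₂ := (H s).2 ⟨1, 0, by simpa using hs⟩
  have htg₂ : t ∈ g₂ := (H t).2 ⟨0, 1, by simpa using ht⟩
  have hog₂ : o ∈ g₂ := (H o).2 ⟨-1, 1, by rw [← ho]; congr 1; module⟩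
  have has : a ≠ s := fun e => ha v (e ▸ hs)
  have hbt : b ≠ t := fun e => hb w (e ▸ ht)
  obtain ⟨h₁, hh₁, hah, hsh⟩ := hG.exists_line a s has
  obtain ⟨h₂, hh₂, hbh, hth⟩ := hG.exists_line b t hbt
  have hso : s ≠ o := by
    rintro rfl
    obtain ⟨c, hc, e⟩ := hψ.proportional_of_eq hk (hs.trans ho.symm)
    have := hvw (1 + c) (-c) (by linear_combination (norm := module) e)
    exact hc (neg_eq_zero.1 this.2)
  have hto : t ≠ o := by
    rintro rfl
    obtain ⟨c, hc, e⟩ := hψ.proportional_of_eq hk (ht.trans ho.symm)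
    have := hvw c (1 - c) (by linear_combination (norm := module) e)
    exact hc this.1
  have hoh₁ : o ∉ h₁ := fun h => hso (trace_unique hψ hh₁ hah ha hsh h hs ho)
  have hoh₂ : o ∉ h₂ := fun h => hto (trace_unique hψ hh₂ hbh hb hth h ht ho)
  have hg₁₂ : g₁ ≠ g₂ := by
    rintro rfl
    obtain ⟨x, y, e⟩ := (H a).1 hag
    exact ha _ e
  obtain ⟨c, hc₁, hc₂⟩ := hG.veblen g₁ hg₁ g₂ hg₂ hg₁₂ o ⟨hog, hog₂⟩ h₁ hh₁ h₂ hh₂ hoh₁ hoh₂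
    ⟨a, hah, hag⟩ ⟨s, hsh, hsg₂⟩ ⟨b, hbh, hbg⟩ ⟨t, hth, htg₂⟩
  have hst : s ≠ t := by
    rintro rfl
    exact hvw.not_proportional (hψ.proportional_of_eq hk (hs.trans ht.symm))
  have hc : ∀ v, ψ v ≠ some c := by
    intro u hu
    have e1 := trace_unique hψ hh₁ hah ha hc₁ hsh hu hs
    have e2 := trace_unique hψ hh₂ hbh hb hc₂ hth hu ht
    exact hst (e1.symm.trans e2)
  have hah₂ : a ∉ h₂ := fun h =>
    hoh₂ (hG.line_eq hg₁ hh₂ hne hag hbg h hbh ▸ hog)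
  have hbh₁ : b ∉ h₁ := fun h =>
    hoh₁ (hG.line_eq hg₁ hh₁ hne hag hbg hah h ▸ hog)
  exact ⟨c, ⟨fun e => hah₂ (e ▸ hc₂), hc, ha, h₁, hh₁, hc₁, hah, s, hsh, hs⟩,
    ⟨fun e => hbh₁ (e ▸ hc₁), hc, hb, h₂, hh₂, hc₂, hbh, t, hth, ht⟩⟩

/-- Two points joined to a common third point in independent directions are distinct, and their
joining line meets the image of `ψ`. -/
theorem exists_direction {a b c : Q} {v w : V} (hvw : Indep₂ F v w)
    (h1 : HasDirection G ψ a c v) (h2 : HasDirection G ψ b c w) :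
    a ≠ b ∧ ∀ l ∈ G.lines, a ∈ l → b ∈ l → ∃ s t : F, ∃ p ∈ l, ψ (s • v + t • w) = some p := by
  obtain ⟨hac, ha, hc, g₁, hg₁, hag, hcg, s, hsg, hs⟩ := h1
  obtain ⟨hbc, hb, -, g₂, hg₂, hbg, hcg₂, t, htg, ht⟩ := h2
  have hst : s ≠ t := by
    rintro rfl
    exact hvw.not_proportional (hψ.proportional_of_eq hk (hs.trans ht.symm))
  have hg₁₂ : g₁ ≠ g₂ := by
    rintro rfl
    exact hst (trace_unique hψ hg₁ hcg hc hsg htg hs ht)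
  refine ⟨?_, fun l hl hal hbl => ?_⟩
  · rintro rfl
    exact hg₁₂ (hG.line_eq hg₁ hg₂ hac hag hcg hbg hcg₂)
  · obtain ⟨h, hh, H⟩ := exists_line_of_indep hG hψ hk hvw
    have hsh : s ∈ h := (H s).2 ⟨1, 0, by simpa using hs⟩
    have hth : t ∈ h := (H t).2 ⟨0, 1, by simpa using ht⟩
    have hch : c ∉ h := by
      intro h'
      obtain ⟨x, y, e⟩ := (H c).1 h'
      exact hc _ e
    have hcl : c ∉ l := by
      intro h'
      exact hg₁₂ ((hG.line_eq hg₁ hl hac hag hcg hal h').trans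
        (hG.line_eq hg₂ hl hbc hbg hcg₂ hbl h').symm)
    -- Veblen axiom for the lines `ca` and `cb` with vertex `c`: each is met by the line `ab` and by
    -- the line joining `ψ v` to `ψ w`.
    obtain ⟨p, hpl, hph⟩ := hG.veblen g₁ hg₁ g₂ hg₂ hg₁₂ c ⟨hcg, hcg₂⟩ l hl h hh hcl hch
      ⟨a, hal, hag⟩ ⟨b, hbl, hbg⟩ ⟨s, hsh, hsg⟩ ⟨t, hth, htg⟩
    obtain ⟨x, y, e⟩ := (H p).1 hph
    exact ⟨x, y, p, hpl, e⟩

/-- Four edges of a tetrahedron with the right directions force the fifth one. -/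
theorem HasDirection.tetrahedron {a b c d : Q} {v w x y : V}
    (hi : Indep₃ F (v - x) (w - x) (y - x))
    (hac : HasDirection G ψ a c (v - x)) (hbc : HasDirection G ψ b c (w - x))
    (had : HasDirection G ψ a d (v - y)) (hbd : HasDirection G ψ b d (w - y)) :
    HasDirection G ψ a b (v - w) := by
  have i1 : Indep₂ F (v - x) (w - x) := fun s t e =>
    ⟨(hi s t 0 (by simpa using e)).1, (hi s t 0 (by simpa using e)).2.1⟩
  have i2 : Indep₂ F (v - y) (w - y) := fun s t e => by
    have := hi s t (-s - t) (by rw [← e]; module)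
    exact ⟨this.1, this.2.1⟩
  obtain ⟨hab, h1⟩ := exists_direction hG hψ hk i1 hac hbc
  obtain ⟨-, h2⟩ := exists_direction hG hψ hk i2 had hbd
  obtain ⟨l, hl, hal, hbl⟩ := hG.exists_line a b hab
  obtain ⟨s, t, p, hpl, hp⟩ := h1 l hl hal hbl
  obtain ⟨s', t', p', hpl', hp'⟩ := h2 l hl hal hbl
  -- The line `ab` has only one trace. It comes from the span of `v - x`, `w - x` and also from that
  -- of `v - y`, `w - y`; by independence these two spans share only the multiples of `v - w`.
  have e := trace_unique hψ hl hal hac.2.1 hpl hpl' hp hp'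
  subst e
  obtain ⟨k, hk0, e⟩ := hψ.proportional_of_eq hk (hp.trans hp'.symm)
  have h0 := hi (s - k * s') (t - k * t') (k * s' + k * t') (by
    have : s • (v - x) + t • (w - x) - k • (s' • (v - y) + t' • (w - y)) = 0 := by rw [e, sub_self]
    rw [← this]; module)
  have hst : t = -s := by linear_combination h0.1 + h0.2.1 + h0.2.2
  refine ⟨hab, hac.2.1, hbc.2.1, l, hl, hal, hbl, p, hpl, ?_⟩
  rw [← hp]
  have hs0 : s ≠ 0 := by
    rintro rfl
    rw [hst] at hp
    simp [hψ.map_zero] at hp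
  rw [hst, show s • (v - x) + -s • (w - x) = s • (v - w) by module, hψ.map_smul _ _ hs0]

end Extension

/-! ### Construction of the translates of a point -/

section Translates

variable {F V Q : Type*} [Field F] [AddCommGroup V] [Module F V] {G : PointLineGeometry Q}
  {ψ : V → Option Q}

theorem Indep₂.indep₃ {a b z : V} (h : Indep₂ F a b) (hz : ∀ s t : F, z ≠ s • a + t • b) :
    Indep₃ F a b z := by
  intro r s t e
  have ht : t = 0 := by
    by_contra ht
    refine hz (-(t⁻¹ * r)) (-(t⁻¹ * s)) ?_
    have h1 : t⁻¹ • (r • a + s • b + t • z) = 0 := by rw [e, smul_zero]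
    rw [smul_add, smul_smul t⁻¹ t, inv_mul_cancel₀ ht, one_smul] at h1
    linear_combination (norm := module) h1
  subst ht
  have := h r s (by simpa using e)
  exact ⟨this.1, this.2, rfl⟩

/-- Given coordinates `ψ` for a subspace of dimension at least two and a point `p` off it, the
points of the affine space with hyperplane at infinity `ψ` and origin `p` are parametrized by
vectors. -/
theorem exists_translates (hG : G.IsProjective) (hψ : IsVecLinear F G ψ)
    (hk : ∀ v, ψ v = none → v = 0) (hdim : ∀ a b : V, ∃ z, ∀ s t : F, z ≠ s • a + t • b) {p : Q}
    (hp : ∀ v, ψ v ≠ some p) :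
    ∃ pt : V → Q, pt 0 = p ∧ ∀ v w, v ≠ w → HasDirection G ψ (pt v) (pt w) (v - w) := by
  obtain ⟨e, he⟩ := hdim 0 0
  replace he : e ≠ 0 := by simpa using he 0 0
  obtain ⟨w₀, hw₀⟩ := hdim e 0
  replace hw₀ : ∀ t : F, w₀ ≠ t • e := fun t => by simpa using hw₀ t 0
  have ind : ∀ {v : V}, (∀ t : F, v ≠ t • e) → Indep₂ F e v := fun h => indep₂_of_not_mem he h
  obtain ⟨e', he'⟩ := Option.ne_none_iff_exists'.1 (fun h => he (hk _ h))
  have hpe : p ≠ e' := fun h => hp e (h ▸ he')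
  obtain ⟨g, hg, hpg, heg⟩ := hG.exists_line p e' hpe
  -- The third point `u` on the line from `p` to `ψ e` is going to be the translate of `p` by `e`.
  -- After this choice every other translate is forced as an apex.
  obtain ⟨u, hug, hup, hue⟩ : ∃ u ∈ g, u ≠ p ∧ u ≠ e' := by
    by_contra! hcon
    have : g ⊆ {p, e'} := fun x hx => by
      by_cases h : x = p
      · exact Or.inl h
      · exact Or.inr (hcon x hx h)
    have h1 := (hG.three_points g hg).trans (Set.encard_le_encard this)
    rw [Set.encard_pair hpe] at h1
    exact absurd h1 (by decide)
  have hu : ∀ v, ψ v ≠ some u := fun v hv => hue (trace_unique hψ hg hpg hp hug heg hv he')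
  have dup : HasDirection G ψ u p e := ⟨hup, hu, hp, g, hg, hug, hpg, e', heg, he'⟩
  have apex : ∀ v : V, (∀ t : F, v ≠ t • e) →
      ∃ c, HasDirection G ψ c p v ∧ HasDirection G ψ c u (v - e) := by
    intro v hv
    refine exists_apex hG hψ hk (fun s t h => ?_) (dup.symm.congr hψ ⟨-1, by simp, by module⟩)
    have := ind hv (-t) (s + t) (by rw [← h]; module)
    exact ⟨by linear_combination this.1 + this.2, by linear_combination -this.1⟩
  obtain ⟨q₀, hq₀p, hq₀u⟩ := apex w₀ hw₀
  -- Off the line `F e` the translate is the apex over `p` and `u`. On this line that construction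
  -- degenerates, so `u` is replaced there by the translate `q₀` by `w₀`.
  have spec : ∀ v : V, ∃ c, (v = 0 → c = p) ∧ (v = e → c = u) ∧ (v = w₀ → c = q₀) ∧
      ((∀ t : F, v ≠ t • e) → HasDirection G ψ c p v ∧ HasDirection G ψ c u (v - e)) ∧
      (∀ t : F, t ≠ 0 → v = t • e → HasDirection G ψ c p v ∧ HasDirection G ψ c q₀ (v - w₀)) := by
    intro v
    have h₀ : w₀ ≠ 0 := fun h => hw₀ 0 (by simpa using h)
    have h₁ : w₀ ≠ e := fun h => hw₀ 1 (by simpa using h)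
    by_cases h0 : v = 0
    · refine ⟨p, fun _ => rfl, fun h => absurd (h.symm.trans h0) he,
        fun h => absurd (h.symm.trans h0) h₀, fun h => absurd h0 (by simpa using h 0), ?_⟩
      rintro t ht rfl
      exact absurd h0 (smul_ne_zero ht he)
    by_cases h1 : v = e
    · subst h1
      refine ⟨u, fun h => absurd h h0, fun _ => rfl, fun h => absurd h.symm h₁,
        fun h => absurd (one_smul F v).symm (h 1), fun t ht _ => ⟨dup, hq₀u.rev hψ⟩⟩
    by_cases hv : ∀ t : F, v ≠ t • e
    · by_cases h2 : v = w₀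
      · exact ⟨q₀, fun h => absurd h h0, fun h => absurd h h1, fun _ => rfl,
          fun _ => by rw [h2]; exact ⟨hq₀p, hq₀u⟩, fun t _ h => absurd h (hv t)⟩
      · obtain ⟨c, hc⟩ := apex v hv
        exact ⟨c, fun h => absurd h h0, fun h => absurd h h1, fun h => absurd h h2,
          fun _ => hc, fun t _ h => absurd h (hv t)⟩
    · push Not at hv
      obtain ⟨t, rfl⟩ := hv
      have ht : t ≠ 0 := by rintro rfl; simp at h0
      have h := exists_apex hG hψ hk (a := p) (b := q₀) (v := t • e) (w := t • e - w₀)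
        (fun s r h => by
          have := ind hw₀ ((s + r) * t) (-r) (by rw [← h]; module)
          have hr := neg_eq_zero.1 this.2
          rw [hr, add_zero] at this
          exact ⟨(mul_eq_zero.1 this.1).resolve_right ht, hr⟩)
        (hq₀p.symm.congr hψ ⟨-1, by simp, by module⟩)
      obtain ⟨c, hc⟩ := h
      exact ⟨c, fun h => absurd h h0, fun h => absurd h h1, fun h => absurd h.symm (hw₀ t),
        fun h => absurd rfl (h t), fun _ _ _ => hc⟩
  choose pt pt0 pte ptw pt1 pt2 using spec
  refine ⟨pt, pt0 0 rfl, ?_⟩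
  have rev : ∀ {v w}, (v ≠ w → HasDirection G ψ (pt v) (pt w) (v - w)) →
      (w ≠ v → HasDirection G ψ (pt w) (pt v) (w - v)) := fun h hne => (h hne.symm).rev hψ
  have tet : ∀ {v w x y : V}, Indep₃ F (v - x) (w - x) (y - x) →
      (v ≠ x → HasDirection G ψ (pt v) (pt x) (v - x)) →
      (w ≠ x → HasDirection G ψ (pt w) (pt x) (w - x)) →
      (v ≠ y → HasDirection G ψ (pt v) (pt y) (v - y)) →
      (w ≠ y → HasDirection G ψ (pt w) (pt y) (w - y)) →
      HasDirection G ψ (pt v) (pt w) (v - w) := by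
    intro v w x y hi h1 h2 h3 h4
    refine HasDirection.tetrahedron hG hψ hk hi (h1 ?_) (h2 ?_) (h3 ?_) (h4 ?_)
    · rintro rfl
      exact one_ne_zero (hi 1 0 0 (by simp)).1
    · rintro rfl
      exact one_ne_zero (hi 0 1 0 (by simp)).2.1
    · rintro rfl
      exact one_ne_zero (hi 1 0 (-1) (by module)).1
    · rintro rfl
      exact one_ne_zero (hi 0 1 (-1) (by module)).2.1
  have E0 : ∀ v, v ≠ 0 → HasDirection G ψ (pt v) (pt 0) (v - 0) := by
    intro v hv
    rw [pt0 0 rfl, sub_zero]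
    by_cases h : ∀ t : F, v ≠ t • e
    · exact (pt1 v h).1
    · push Not at h
      obtain ⟨t, rfl⟩ := h
      exact (pt2 _ t (by rintro rfl; simp at hv) rfl).1
  have Ee : ∀ v, (∀ t : F, v ≠ t • e) → HasDirection G ψ (pt v) (pt e) (v - e) := by
    intro v hv
    rw [pte e rfl]
    exact (pt1 v hv).2
  have Ew : ∀ t : F, HasDirection G ψ (pt (t • e)) (pt w₀) (t • e - w₀) := by
    intro t
    by_cases ht : t = 0
    · rw [ht, zero_smul]
      exact (E0 w₀ fun h => hw₀ 0 (by simpa using h)).rev hψ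
    · rw [ptw w₀ rfl]
      exact (pt2 _ t ht rfl).2
  -- So far only directions towards the base points `0`, `e`, `w₀` are known. All other pairs are
  -- reached by completing tetrahedra whose other two vertices are known or already treated. A pair
  -- in a degenerate position borrows an auxiliary vertex from outside the plane in question.
  have T1 : ∀ v w, Indep₃ F e v w → HasDirection G ψ (pt v) (pt w) (v - w) := by
    intro v w hi
    refine tet (x := 0) (y := e) (fun r s t h => ?_) (E0 v) (E0 w) (fun _ => Ee v fun t h => ?_)
      (fun _ => Ee w fun t h => ?_)
    · have := hi t r s (by simp only [sub_zero] at h; rw [← h]; abel)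
      exact ⟨this.2.1, this.2.2, this.1⟩
    · exact one_ne_zero (neg_eq_zero.1 (hi t (-1) 0 (by rw [h]; module)).2.1)
    · exact one_ne_zero (neg_eq_zero.1 (hi t 0 (-1) (by rw [h]; module)).2.2)
  have T2 : ∀ t : F, t ≠ 0 → ∀ v, Indep₃ F e w₀ v →
      HasDirection G ψ (pt (t • e)) (pt v) (t • e - v) := by
    intro t ht v hi
    refine tet (x := 0) (y := w₀) (fun r s q h => ?_) (E0 _) (E0 v) (fun _ => Ew t)
      (fun _ => T1 v w₀ fun r s q h => ?_)
    · have := hi (r * t) q s (by rw [← h]; module)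
      exact ⟨(mul_eq_zero.1 this.1).resolve_right ht, this.2.2, this.2.1⟩
    · have := hi r q s (by rw [← h]; module)
      exact ⟨this.1, this.2.2, this.2.1⟩
  have T3 : ∀ t : F, ∀ v, (∀ r : F, v ≠ r • e) →
      HasDirection G ψ (pt (t • e)) (pt v) (t • e - v) := by
    intro t v hv
    by_cases ht : t = 0
    · rw [ht, zero_smul]
      exact (E0 v fun h => hv 0 (by simpa using h)).rev hψ
    by_cases h : ∀ s r : F, v ≠ s • e + r • w₀
    · exact T2 t ht v ((ind hw₀).indep₃ h)
    push Not at h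
    obtain ⟨a, b, hab⟩ := h
    obtain ⟨v', hv'⟩ := hdim e w₀
    have hi : Indep₃ F e v v' := (ind hv).indep₃ fun s r h =>
      hv' (s + r * a) (r * b) (by rw [h, hab]; module)
    refine tet (x := 0) (y := v') (fun r s q h => ?_) (E0 _) (E0 v)
      (fun _ => T2 t ht v' ((ind hw₀).indep₃ hv')) (fun _ => T1 v v' hi)
    have := hi (r * t) s q (by rw [← h]; module)
    exact ⟨(mul_eq_zero.1 this.1).resolve_right ht, this.2⟩
  have T4 : ∀ v w, (∀ r : F, v ≠ r • e) → (∀ r : F, w ≠ r • e) → v ≠ w →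
      HasDirection G ψ (pt v) (pt w) (v - w) := by
    intro v w hv hw hvw
    by_cases h : ∀ s r : F, w ≠ s • e + r • v
    · exact T1 v w ((ind hv).indep₃ h)
    push Not at h
    obtain ⟨a, b, hab⟩ := h
    have hb : b ≠ 0 := by
      rintro rfl
      exact hw a (by simpa using hab)
    obtain ⟨z, hz⟩ := hdim e v
    have hi : Indep₃ F e v z := (ind hv).indep₃ hz
    -- The condition says that `c • e` is off the affine line through `v` and `w = a • e + b • v`.
    -- If `a ≠ 0` then `c = 0` will do, otherwise `c = 1`, since `b = 1` would give `v = w`.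
    obtain ⟨c, hc⟩ : ∃ c : F, a + (b - 1) * c ≠ 0 := by
      by_cases ha : a = 0
      · refine ⟨1, fun h => hvw ?_⟩
        have : b = 1 := by linear_combination h - ha
        rw [hab, ha, this]
        module
      · exact ⟨0, by simpa using ha⟩
    refine tet (x := c • e) (y := z) (fun r s q h => ?_) (rev fun _ => T3 c v hv)
      (rev fun _ => T3 c w hw) (fun _ => T1 v z hi) (fun _ => T1 w z fun r s q h => ?_)
    · have := hi (-(r * c) + s * a - s * c - q * c) (r + s * b) q (by rw [← h, hab]; module)
      have hs : s * (a + (b - 1) * c) = 0 := by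
        linear_combination this.1 + c * this.2.1 + c * this.2.2
      have hs := (mul_eq_zero.1 hs).resolve_right hc
      exact ⟨by linear_combination this.2.1 - b * hs, hs, this.2.2⟩
    · have := hi (r + s * a) (s * b) q (by rw [← h, hab]; module)
      have hs := (mul_eq_zero.1 this.2.1).resolve_right hb
      exact ⟨by linear_combination this.1 - a * hs, hs, this.2.2⟩
  have T5 : ∀ t t' : F, t ≠ t' →
      HasDirection G ψ (pt (t • e)) (pt (t' • e)) (t • e - t' • e) := by
    intro t t' htt
    obtain ⟨z, hz⟩ := hdim e w₀
    have hz' : ∀ r : F, z ≠ r • e := fun r h => hz r 0 (by simpa using h)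
    refine tet (x := w₀) (y := z) (fun r s q h => ?_) (fun _ => Ew t) (fun _ => Ew t')
      (fun _ => T3 t z hz') (fun _ => T3 t' z hz')
    have := (ind hw₀).indep₃ hz (r * t + s * t') (-r - s - q) q (by rw [← h]; module)
    have hr : r * (t - t') = 0 := by
      linear_combination this.1 + t' * this.2.1 + t' * this.2.2
    have hr := (mul_eq_zero.1 hr).resolve_right (sub_ne_zero.2 htt)
    exact ⟨hr, by linear_combination -this.2.1 - hr - this.2.2, this.2.2⟩
  intro v w hvw
  by_cases hv : ∀ r : F, v ≠ r • e <;> by_cases hw : ∀ r : F, w ≠ r • e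
  · exact T4 v w hv hw hvw
  · push Not at hw
    obtain ⟨r, rfl⟩ := hw
    exact (T3 r v hv).rev hψ
  · push Not at hv
    obtain ⟨r, rfl⟩ := hv
    exact T3 r w hw
  · push Not at hv hw
    obtain ⟨r, rfl⟩ := hv
    obtain ⟨r', rfl⟩ := hw
    exact T5 r r' fun h => hvw (by rw [h])

end Translates

/-! ### Homogeneous coordinates for the enlarged subspace -/

section ExtendCoordinates

variable {F V Q : Type*} [Field F] [AddCommGroup V] [Module F V] {G : PointLineGeometry Q}
  {ψ : V → Option Q}

theorem HasDirection.proportional (hG : G.IsProjective) (hψ : IsVecLinear F G ψ)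
    (hk : ∀ v, ψ v = none → v = 0) {a b c : Q} {v w : V} (h1 : HasDirection G ψ a b v)
    (h2 : HasDirection G ψ c b v) (h3 : HasDirection G ψ a c w) : Proportional F w v := by
  obtain ⟨hab, ha, hb, g, hg, hag, hbg, s, hsg, hs⟩ := h1
  obtain ⟨hcb, hc, -, g', hg', hcg', hbg', s', hsg', hs'⟩ := h2
  obtain ⟨hac, -, -, h, hh, hah, hch, t, hth, ht⟩ := h3
  have e := Option.some.inj (hs.symm.trans hs')
  subst e
  have e := hG.line_eq hg hg' (fun e : b = s => hb v (e ▸ hs)) hbg hsg hbg' hsg'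
  subst e
  have e := hG.line_eq hg hh hac hag hcg' hah hch
  subst e
  have e := trace_unique hψ hg hag ha hsg hth hs ht
  subst e
  exact hψ.proportional_of_eq hk (ht.trans hs.symm)

/-- A point `q` of the line, other than `δ` and `pt x`, is viewed from `pt (x + w)` with `w`
independent of `d`. If the direction is `s • d + t • w`, then `pt (x - (s / t) • d)` has the same
directions towards `pt x` and `pt (x + w)` as `q`, so it equals `q` by `HasDirection.unique`. -/
theorem mem_affine_line (hG : G.IsProjective) (hψ : IsVecLinear F G ψ)
    (hk : ∀ v, ψ v = none → v = 0) (hdim : ∀ a b : V, ∃ z, ∀ s t : F, z ≠ s • a + t • b)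
    {pt : V → Q} (hpt : ∀ v w, v ≠ w → HasDirection G ψ (pt v) (pt w) (v - w))
    (hoff : ∀ v w, ψ v ≠ some (pt w)) {g : Set Q} (hg : g ∈ G.lines) {x d : V} {δ : Q}
    (hδ : ψ d = some δ) (hx : pt x ∈ g) (hδg : δ ∈ g) (q : Q) :
    q ∈ g ↔ q = δ ∨ ∃ c : F, q = pt (x + c • d) := by
  have hd : d ≠ 0 := by
    rintro rfl
    rw [hψ.map_zero] at hδ
    exact absurd hδ (by simp)
  constructor
  · intro hq
    by_cases hqδ : q = δ
    · exact Or.inl hqδ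
    by_cases hqx : q = pt x
    · exact Or.inr ⟨0, by rw [hqx, zero_smul, add_zero]⟩
    have hqoff : ∀ v, ψ v ≠ some q := fun v hv =>
      hqδ (trace_unique hψ hg hx (fun v => hoff v x) hq hδg hv hδ)
    obtain ⟨w, hw⟩ := hdim d 0
    have hdw : Indep₂ F d w := indep₂_of_not_mem hd fun c h => hw c 0 (by simpa using h)
    have h1 : HasDirection G ψ q (pt x) d := ⟨hqx, hqoff, fun v => hoff v x, g, hg, hq, hx, δ, hδg, hδ⟩
    have h2 : HasDirection G ψ (pt (x + w)) (pt x) w := by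
      have := hpt (x + w) x (by simpa using hdw.ne_zero_right)
      rwa [add_sub_cancel_left] at this
    obtain ⟨hne, hl⟩ := exists_direction hG hψ hk hdw h1 h2
    obtain ⟨l, hl', hql, hyl⟩ := hG.exists_line _ _ hne
    obtain ⟨s, t, p, hp, hpe⟩ := hl l hl' hql hyl
    have h3 : HasDirection G ψ q (pt (x + w)) (s • d + t • w) :=
      ⟨hne, hqoff, fun v => hoff v _, l, hl', hql, hyl, p, hp, hpe⟩
    have hne0 : s • d + t • w ≠ 0 := fun e => by
      rw [e, hψ.map_zero] at hpe
      exact absurd hpe (by simp)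
    have ht : t ≠ 0 := by
      rintro rfl
      rw [zero_smul, add_zero] at h3 hne0
      have hs : s ≠ 0 := by rintro rfl; simp at hne0
      exact hdw.not_proportional (HasDirection.proportional hG hψ hk h1.symm
        (h3.congr hψ (.symm (.smul_left hs d))).symm h2.symm).symm
    have hs : s ≠ 0 := by
      rintro rfl
      rw [zero_smul, zero_add] at h3
      exact hdw.not_proportional (HasDirection.proportional hG hψ hk
        (h3.congr hψ (.symm (.smul_left ht w))) h2.symm h1)
    refine Or.inr ⟨-(t⁻¹ * s), ?_⟩
    have hc : -(t⁻¹ * s) ≠ 0 := neg_ne_zero.2 (mul_ne_zero (inv_ne_zero ht) hs)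
    have h4 := hpt (x + -(t⁻¹ * s) • d) x (by simpa using ⟨⟨ht, hs⟩, hd⟩)
    rw [add_sub_cancel_left] at h4
    have h5 := hpt (x + -(t⁻¹ * s) • d) (x + w) fun h => hw (-(t⁻¹ * s)) 0
      (by simpa using (add_left_cancel h).symm)
    refine HasDirection.unique hG hψ hk (v := d) (w := s • d + t • w) (fun a b e => ?_) h1 h3
      (h4.congr hψ (.symm (.smul_left hc d))) (h5.congr hψ ⟨-t, neg_ne_zero.2 ht, ?_⟩)
    · have := hdw (a + b * s) (b * t) (by rw [← e]; module)
      have hb := (mul_eq_zero.1 this.2).resolve_right ht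
      exact ⟨by linear_combination this.1 - s * hb, hb⟩
    · have h6 : s = t * (t⁻¹ * s) := by rw [← mul_assoc, mul_inv_cancel₀ ht, one_mul]
      nth_rw 1 [h6]
      module
  · rintro (rfl | ⟨c, rfl⟩)
    · exact hδg
    · by_cases hc : c = 0
      · rwa [hc, zero_smul, add_zero]
      have h1 := hpt (x + c • d) x (by simpa using ⟨hc, hd⟩)
      rw [add_sub_cancel_left] at h1
      obtain ⟨-, -, -, h, hh, h3, h4, s, h5, h6⟩ := h1.congr hψ (.symm (.smul_left hc d))
      have e := Option.some.inj (h6.symm.trans hδ)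
      subst e
      rwa [hG.line_eq hg hh (fun e : pt x = s => hoff d x (e ▸ hδ)) hx hδg h4 h5]

/-- Coordinates of a subspace extend to the subspace generated by one more point. -/
theorem exists_extend_coordinates (hG : G.IsProjective) (hψ : IsVecLinear F G ψ)
    (hk : ∀ v, ψ v = none → v = 0) (hdim : ∀ a b : V, ∃ z, ∀ s t : F, z ≠ s • a + t • b) {p : Q}
    (hp : ∀ v, ψ v ≠ some p) :
    ∃ ψ' : V × F → Option Q, IsVecLinear F G ψ' ∧ (∀ x, ψ' x = none → x = 0) ∧
      (∀ v, ψ' (v, 0) = ψ v) ∧ ψ' (0, 1) = some p := by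
  classical
  obtain ⟨pt, hpt0, hpt⟩ := exists_translates hG hψ hk hdim hp
  have hoff : ∀ v w, ψ v ≠ some (pt w) := by
    intro v w
    obtain ⟨e, he⟩ := hdim w 0
    exact (hpt w e fun h => he 1 0 (by simpa using h.symm)).2.1 v
  have hinj : ∀ v w, pt v = pt w → v = w := fun v w h => by
    by_contra hne
    exact (hpt v w hne).1 h
  -- Vectors with last coordinate zero are the points at infinity; the others are normalized to last
  -- coordinate one and read as affine points.
  let ψ' : V × F → Option Q := fun x => if x.2 = 0 then ψ x.1 else some (pt (x.2⁻¹ • x.1))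
  have h0 : ∀ v, ψ' (v, 0) = ψ v := fun v => by simp [ψ']
  have h1 : ∀ (v : V) (t : F), t ≠ 0 → ψ' (v, t) = some (pt (t⁻¹ • v)) := fun v t ht => by
    simp [ψ', ht]
  have hk' : ∀ x, ψ' x = none → x = 0 := by
    rintro ⟨v, t⟩ h
    by_cases ht : t = 0
    · subst ht
      rw [h0] at h
      rw [hk v h]
      rfl
    · rw [h1 v t ht] at h
      exact absurd h (by simp)
  have hz : ψ' 0 = none := (h0 0).trans hψ.map_zero
  -- Lines through an affine point and a point at infinity. A line through two affine points reduces
  -- to this case, because it contains their direction.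
  have L : ∀ (v : V) (s : F), s ≠ 0 → ∀ (d : V) (δ : Q), ψ d = some δ → ∀ g ∈ G.lines,
      pt (s⁻¹ • v) ∈ g → δ ∈ g → ∀ q, q ∈ g ↔ ∃ α β : F, ψ' (α • (v, s) + β • (d, 0)) = some q := by
    intro v s hs d δ hδ g hg hv hd q
    rw [mem_affine_line hG hψ hk hdim hpt hoff hg hδ hv hd q]
    have e : ∀ α β : F, α • (v, s) + β • (d, (0 : F)) = (α • v + β • d, α * s) := by
      intro α β
      ext <;> simp
    simp only [e]
    constructor
    · rintro (rfl | ⟨c, rfl⟩)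
      · exact ⟨0, 1, by simpa [h0] using hδ⟩
      · refine ⟨s⁻¹, c, ?_⟩
        rw [h1 _ _ (by simp [hs])]
        simp [hs]
    · rintro ⟨α, β, h⟩
      by_cases hα : α = 0
      · subst hα
        rw [zero_mul, h0, zero_smul, zero_add] at h
        by_cases hβ : β = 0
        · rw [hβ, zero_smul, hψ.map_zero] at h
          exact absurd h (by simp)
        · rw [hψ.map_smul β d hβ, hδ] at h
          exact Or.inl (Option.some.inj h).symm
      · rw [h1 _ _ (mul_ne_zero hα hs)] at h
        refine Or.inr ⟨(α * s)⁻¹ * β, ?_⟩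
        rw [← Option.some.inj h, smul_add, smul_smul, smul_smul]
        congr 3
        field_simp
  refine ⟨ψ', ⟨hz, ?_, fun v w hv => by rw [hk' v hv, zero_add], ?_, ?_⟩, hk', h0, ?_⟩
  · rintro c ⟨v, t⟩ hc
    by_cases ht : t = 0
    · subst ht
      rw [Prod.smul_mk, smul_zero, h0, h0, hψ.map_smul c v hc]
    · rw [Prod.smul_mk, smul_eq_mul, h1 _ _ (mul_ne_zero hc ht), h1 _ _ ht, smul_smul]
      congr 3
      field_simp
  · rintro ⟨v, s⟩ ⟨w, t⟩ h
    by_cases hs : s = 0 <;> by_cases ht : t = 0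
    · subst hs ht
      rw [h0, h0] at h
      obtain ⟨c, hc, e⟩ := hψ.exists_none v w h
      refine ⟨c, hc, ?_⟩
      rw [Prod.smul_mk, Prod.mk_add_mk, smul_zero, add_zero, h0, e]
    · subst hs
      rw [h0, h1 _ _ ht] at h
      exact absurd h (hoff _ _)
    · subst ht
      rw [h0, h1 _ _ hs] at h
      exact absurd h.symm (hoff _ _)
    · rw [h1 _ _ hs, h1 _ _ ht] at h
      have := hinj _ _ (Option.some.inj h)
      refine ⟨-(s * t⁻¹), by simp [hs, ht], ?_⟩
      have e : (v, s) + -(s * t⁻¹) • (w, t) = 0 := by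
        ext
        · have h2 : v = s • t⁻¹ • w := by rw [← this, smul_smul, mul_inv_cancel₀ hs, one_smul]
          simp [h2, mul_smul]
        · simp [ht]
      rw [e, hz]
  · rintro ⟨v, s⟩ ⟨w, t⟩ a b ha hb hab g hg hag hbg q
    by_cases hs : s = 0 <;> by_cases ht : t = 0
    · subst hs ht
      rw [h0] at ha hb
      rw [hψ.mem_line v w a b ha hb hab g hg hag hbg q]
      simp [h0]
    · subst hs
      rw [h0] at ha
      rw [h1 _ _ ht] at hb
      have e := Option.some.inj hb
      subst e
      rw [L w t ht v a ha g hg hbg hag q, exists_comm]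
      simp only [add_comm]
    · subst ht
      rw [h0] at hb
      rw [h1 _ _ hs] at ha
      have e := Option.some.inj ha
      subst e
      exact L v s hs w b hb g hg hag hbg q
    · rw [h1 _ _ hs] at ha
      rw [h1 _ _ ht] at hb
      have e := Option.some.inj ha
      have e' := Option.some.inj hb
      subst e e'
      have hne : t⁻¹ • w ≠ s⁻¹ • v := fun e => hab (by rw [e])
      obtain ⟨-, -, -, h, hh, h3, h4, δ, h5, h6⟩ := hpt _ _ hne
      have e := hG.line_eq hh hg hab h4 h3 hag hbg
      subst e
      rw [L v s hs _ δ h6 h hh hag h5 q]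
      constructor
      · rintro ⟨α, β, e⟩
        refine ⟨α - β * s⁻¹, β * t⁻¹, ?_⟩
        rw [← e]
        congr 1
        ext
        · simp only [Prod.smul_mk, Prod.mk_add_mk]; module
        · simp [hs, ht, sub_mul]
      · rintro ⟨α, β, e⟩
        refine ⟨α + β * t * s⁻¹, β * t, ?_⟩
        rw [← e]
        congr 1
        ext
        · simp only [Prod.smul_mk, Prod.mk_add_mk]
          have : β • w = (β * t) • t⁻¹ • w := by rw [smul_smul, mul_assoc, mul_inv_cancel₀ ht, mul_one]
          rw [this]
          module
        · simp [hs, add_mul]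
  · rw [h1 _ _ one_ne_zero, smul_zero, hpt0]

end ExtendCoordinates

/-! ### Independence of few vectors -/

section Independence

variable {F V : Type*} [Field F] [AddCommGroup V] [Module F V]

theorem indep₂_iff {a b : V} : Indep₂ F a b ↔ LinearIndependent F ![a, b] :=
  LinearIndependent.pair_iff.symm

theorem indep₃_iff {a b c : V} : Indep₃ F a b c ↔ LinearIndependent F ![a, b, c] := by
  rw [Fintype.linearIndependent_iff]
  constructor
  · intro h g e
    simp only [Fin.sum_univ_three, Matrix.cons_val] at e
    have := h _ _ _ e
    intro i
    fin_cases i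
    exacts [this.1, this.2.1, this.2.2]
  · intro h r s t e
    have := h ![r, s, t] (by simpa [Fin.sum_univ_three] using e)
    exact ⟨this 0, this 1, this 2⟩

theorem indep₄_iff {a b c d : V} : Indep₄ F a b c d ↔ LinearIndependent F ![a, b, c, d] := by
  rw [Fintype.linearIndependent_iff]
  constructor
  · intro h g e
    simp only [Fin.sum_univ_four, Matrix.cons_val] at e
    have := h _ _ _ _ e
    intro i
    fin_cases i
    exacts [this.1, this.2.1, this.2.2.1, this.2.2.2]
  · intro h q r s t e
    have := h ![q, r, s, t] (by simpa [Fin.sum_univ_four] using e)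
    exact ⟨this 0, this 1, this 2, this 3⟩

/-- Supplies the dimension hypothesis of `exists_translates` and `exists_extend_coordinates` from
three independent vectors, a condition that persists when coordinates are extended. -/
theorem Indep₃.exists_not_mem {x y z : V} (h : Indep₃ F x y z) (a b : V) :
    ∃ w, ∀ s t : F, w ≠ s • a + t • b := by
  classical
  by_contra! hcon
  have hmem : ∀ w, w ∈ Submodule.span F (({a, b} : Finset V) : Set V) := by
    intro w
    obtain ⟨s, t, rfl⟩ := hcon w
    rw [Finset.coe_pair]
    exact Submodule.mem_span_pair.2 ⟨s, t, rfl⟩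
  have h1 := finrank_span_eq_card (indep₃_iff.1 h)
  have h2 : Submodule.span F (Set.range ![x, y, z]) ≤
      Submodule.span F (({a, b} : Finset V) : Set V) := fun w _ => hmem w
  have h3 := Submodule.finrank_mono h2
  have h4 := finrank_span_finset_le_card (R := F) ({a, b} : Finset V)
  have h5 := Finset.card_le_two (a := a) (b := b)
  simp only [Set.finrank, Fintype.card_fin] at h1 h3 h4
  omega

end Independence

/-! ### Coordinates that cover finitely many points -/

section Coordinates

variable {F : Type u} {Q : Type*} [Field F] {G : PointLineGeometry Q}

/-- Coordinates of a subspace extend to a larger subspace that contains finitely many given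
points. -/
theorem exists_coordinates (hG : G.IsProjective) {V : Type u} [AddCommGroup V] [Module F V]
    [FiniteDimensional F V] {ψ : V → Option Q} (hψ : IsVecLinear F G ψ)
    (hk : ∀ v, ψ v = none → v = 0) {x y z : V} (hi : Indep₃ F x y z) (T : Finset Q) :
    ∃ (V' : Type u) (_ : AddCommGroup V') (_ : Module F V') (_ : FiniteDimensional F V')
      (ι : V →ₗ[F] V') (ψ' : V' → Option Q), IsVecLinear F G ψ' ∧ (∀ v, ψ' v = none → v = 0) ∧
      Function.Injective ι ∧ (∀ v, ψ' (ι v) = ψ v) ∧ ∀ p ∈ T, ∃ v, ψ' v = some p := by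
  classical
  induction T using Finset.induction_on with
  | empty =>
    exact ⟨V, _, _, inferInstance, LinearMap.id, ψ, hψ, hk, fun _ _ h => h, fun _ => rfl, by simp⟩
  | insert p T _ ih =>
    obtain ⟨V', _, _, _, ι, ψ', hψ', hk', hι, hc, hT⟩ := ih
    by_cases hp : ∃ v, ψ' v = some p
    · refine ⟨V', _, _, inferInstance, ι, ψ', hψ', hk', hι, hc, fun q hq => ?_⟩
      rcases Finset.mem_insert.1 hq with rfl | hq
      exacts [hp, hT q hq]
    · push Not at hp
      have hi' : Indep₃ F (ι x) (ι y) (ι z) := fun r s t e =>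
        hi r s t (hι (by simpa using e))
      obtain ⟨χ, h1, h2, h3, h4⟩ :=
        exists_extend_coordinates hG hψ' hk' hi'.exists_not_mem hp
      refine ⟨V' × F, _, _, inferInstance, (LinearMap.inl F V' F).comp ι, χ, h1, h2,
        LinearMap.inl_injective.comp hι, fun v => ?_, fun q hq => ?_⟩
      · rw [LinearMap.comp_apply, LinearMap.inl_apply, h3, hc]
      · rcases Finset.mem_insert.1 hq with rfl | hq
        · exact ⟨_, h4⟩
        · obtain ⟨v, hv⟩ := hT q hq
          exact ⟨(v, 0), (h3 v).trans hv⟩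

end Coordinates

/-! ### The projective space over a vector space -/

section ProjectiveGeometry

variable {F V : Type*} [Field F] [AddCommGroup V] [Module F V]

/-- The projective geometry of a vector space. -/
def projectiveGeometry (F V : Type*) [Field F] [AddCommGroup V] [Module F V] :
    PointLineGeometry (ℙ F V) where
  lines := {g | ∃ W : Submodule F V, Module.finrank F W = 2 ∧ g = pgPoints W}

/-- The point of the projective space that is given by a vector, if it is not zero. -/
noncomputable def toPoint (F : Type*) {V : Type*} [Field F] [AddCommGroup V] [Module F V] (v : V) :
    Option (ℙ F V) :=
  open Classical in if h : v = 0 then none else some (Projectivization.mk F v h)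

theorem toPoint_of_ne {v : V} (h : v ≠ 0) : toPoint F v = some (Projectivization.mk F v h) :=
  dif_neg h

theorem toPoint_eq_none {v : V} : toPoint F v = none ↔ v = 0 := by
  unfold toPoint
  split_ifs with h <;> simp [h]

theorem toPoint_rep (p : ℙ F V) : toPoint F p.rep = some p := by
  rw [toPoint_of_ne p.rep_nonzero, Projectivization.mk_rep]

theorem toPoint_eq_toPoint {v w : V} (hv : v ≠ 0) :
    toPoint F v = toPoint F w ↔ Proportional F v w := by
  by_cases hw : w = 0
  · rw [hw, toPoint_eq_none.2 rfl, toPoint_eq_none]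
    exact ⟨fun h => absurd h hv, fun h => h.eq_zero⟩
  rw [toPoint_of_ne hv, toPoint_of_ne hw, Option.some_inj, Projectivization.mk_eq_mk_iff]
  constructor
  · rintro ⟨a, h⟩
    exact ⟨a, a.ne_zero, h.symm⟩
  · rintro ⟨c, hc, h⟩
    exact ⟨Units.mk0 c hc, h.symm⟩

theorem mem_pgPoints_of_toPoint {v : V} {p : ℙ F V} (h : toPoint F v = some p)
    (W : Submodule F V) : p ∈ pgPoints W ↔ v ∈ W := by
  have hv : v ≠ 0 := by
    rintro rfl
    rw [toPoint_eq_none.2 rfl] at h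
    exact absurd h (by simp)
  rw [toPoint_of_ne hv, Option.some_inj] at h
  subst h
  change (Projectivization.mk F v hv).submodule ≤ W ↔ v ∈ W
  rw [Projectivization.submodule_mk, Submodule.span_singleton_le_iff_mem]

theorem finrank_span_pair {v w : V} (h : Indep₂ F v w) :
    Module.finrank F (Submodule.span F {v, w}) = 2 := by
  have := finrank_span_eq_card (indep₂_iff.1 h)
  rwa [Matrix.range_cons_cons_empty, Fintype.card_fin] at this

theorem eq_span_pair {W : Submodule F V} (hW : Module.finrank F W = 2) {v w : V}
    (h : Indep₂ F v w) (hv : v ∈ W) (hw : w ∈ W) : W = Submodule.span F {v, w} := by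
  have : FiniteDimensional F W := Module.finite_of_finrank_pos (by omega)
  refine (Submodule.eq_of_le_of_finrank_eq ?_ ?_).symm
  · rw [Submodule.span_le]
    rintro x (rfl | rfl)
    exacts [hv, hw]
  · rw [finrank_span_pair h, hW]

theorem exists_basis_of_finrank_two {W : Submodule F V} (hW : Module.finrank F W = 2) :
    ∃ v w, Indep₂ F v w ∧ W = Submodule.span F {v, w} := by
  have : FiniteDimensional F W := Module.finite_of_finrank_pos (by omega)
  let b := Module.finBasisOfFinrankEq F W hW
  have h : Indep₂ F (b 0 : V) (b 1 : V) := by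
    intro s t e
    have h1 := Fintype.linearIndependent_iff.1 b.linearIndependent ![s, t] (by
      ext
      simpa [Fin.sum_univ_two] using e)
    exact ⟨h1 0, h1 1⟩
  exact ⟨_, _, h, eq_span_pair hW h (b 0).2 (b 1).2⟩

theorem isVecLinear_toPoint : IsVecLinear F (projectiveGeometry F V) (toPoint F) where
  map_zero := toPoint_eq_none.2 rfl
  map_smul c v hc := by
    by_cases hv : v = 0
    · rw [hv, smul_zero]
    · rw [toPoint_eq_toPoint (smul_ne_zero hc hv)]
      exact .smul_left hc v
  map_add_of_none v w h := by rw [toPoint_eq_none.1 h, zero_add]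
  exists_none v w h := by
    by_cases hv : v = 0
    · rw [hv, eq_comm, toPoint_eq_none.2 rfl, toPoint_eq_none] at h
      exact ⟨1, one_ne_zero, by rw [hv, h, smul_zero, add_zero, toPoint_eq_none]⟩
    · obtain ⟨c, hc, e⟩ := (toPoint_eq_toPoint hv).1 h
      exact ⟨-c, neg_ne_zero.2 hc, by rw [toPoint_eq_none, e]; module⟩
  mem_line v w a b ha hb hab g hg hag hbg p := by
    obtain ⟨W, hW, rfl⟩ := hg
    have hv : v ≠ 0 := fun h => by simp [toPoint_eq_none.2 h] at ha
    have hw : w ≠ 0 := fun h => by simp [toPoint_eq_none.2 h] at hb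
    have hvw : Indep₂ F v w := indep₂_of_not_proportional hv hw fun h => by
      rw [← toPoint_eq_toPoint hv, ha, hb, Option.some_inj] at h
      exact hab h
    rw [mem_pgPoints_of_toPoint ha] at hag
    rw [mem_pgPoints_of_toPoint hb] at hbg
    rw [eq_span_pair hW hvw hag hbg]
    constructor
    · intro h
      rw [mem_pgPoints_of_toPoint (toPoint_rep p), Submodule.mem_span_pair] at h
      obtain ⟨s, t, e⟩ := h
      exact ⟨s, t, by rw [e, toPoint_rep]⟩
    · rintro ⟨s, t, e⟩
      rw [mem_pgPoints_of_toPoint e]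
      exact Submodule.mem_span_pair.2 ⟨s, t, rfl⟩

theorem indep₂_rep {p q : ℙ F V} (h : p ≠ q) : Indep₂ F p.rep q.rep :=
  indep₂_of_not_proportional p.rep_nonzero q.rep_nonzero fun h' => by
    rw [← toPoint_eq_toPoint p.rep_nonzero, toPoint_rep, toPoint_rep, Option.some_inj] at h'
    exact h h'

theorem rep_mem {p : ℙ F V} {W : Submodule F V} : p.rep ∈ W ↔ p ∈ pgPoints W :=
  (mem_pgPoints_of_toPoint (toPoint_rep p) W).symm

theorem isProjective_projectiveGeometry {a b : V} (hab : Indep₂ F a b) :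
    (projectiveGeometry F V).IsProjective := by
  have hline : ∀ x y : ℙ F V, x ≠ y → ∃ g ∈ (projectiveGeometry F V).lines, x ∈ g ∧ y ∈ g := by
    intro x y h
    refine ⟨_, ⟨Submodule.span F {x.rep, y.rep}, finrank_span_pair (indep₂_rep h), rfl⟩,
      rep_mem.1 (Submodule.subset_span (by simp)), rep_mem.1 (Submodule.subset_span (by simp))⟩
  have three : ∀ g ∈ (projectiveGeometry F V).lines, 3 ≤ g.encard := by
    rintro g ⟨W, hW, rfl⟩
    obtain ⟨v, w, hvw, rfl⟩ := exists_basis_of_finrank_two hW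
    have hs : v + w ≠ 0 := fun h => one_ne_zero (hvw 1 1 (by simpa using h)).1
    have hv := toPoint_of_ne hvw.ne_zero_left (F := F)
    have hw := toPoint_of_ne hvw.ne_zero_right (F := F)
    have hvs := toPoint_of_ne hs (F := F)
    rw [← (Set.encard_eq_three (s := {Projectivization.mk F v hvw.ne_zero_left,
      Projectivization.mk F w hvw.ne_zero_right, Projectivization.mk F (v + w) hs})).2
        ⟨_, _, _, fun h => ?_, fun h => ?_, fun h => ?_, rfl⟩]
    · refine Set.encard_le_encard ?_
      rintro p (rfl | rfl | rfl)
      · exact (mem_pgPoints_of_toPoint hv _).2 (Submodule.subset_span (by simp))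
      · exact (mem_pgPoints_of_toPoint hw _).2 (Submodule.subset_span (by simp))
      · exact (mem_pgPoints_of_toPoint hvs _).2 (Submodule.add_mem _
          (Submodule.subset_span (by simp)) (Submodule.subset_span (by simp)))
    · rw [← Option.some_inj, ← hv, ← hw, toPoint_eq_toPoint hvw.ne_zero_left] at h
      exact hvw.not_proportional h
    · rw [← Option.some_inj, ← hv, ← hvs, toPoint_eq_toPoint hvw.ne_zero_left] at h
      obtain ⟨c, hc, e⟩ := h
      exact hc (neg_eq_zero.1 (hvw (1 - c) (-c)
        (by linear_combination (norm := module) e)).2)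
    · rw [← Option.some_inj, ← hw, ← hvs, toPoint_eq_toPoint hvw.ne_zero_right] at h
      obtain ⟨c, hc, e⟩ := h
      exact hc (neg_eq_zero.1 (hvw (-c) (1 - c)
        (by linear_combination (norm := module) e)).1)
  have inter : ∀ W₁ W₂ : Submodule F V, Module.finrank F W₁ = 2 → Module.finrank F W₂ = 2 →
      ∀ v w, Indep₂ F v w → v ∈ W₁ → w ∈ W₁ → v ∈ W₂ → w ∈ W₂ → W₁ = W₂ := by
    intro W₁ W₂ h₁ h₂ v w h hv hw hv' hw'
    rw [eq_span_pair h₁ h hv hw, eq_span_pair h₂ h hv' hw']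
  refine ⟨⟨fun g hg => ?_, ?_, ?_⟩, hline, three, ?_⟩
  · rw [← Set.one_lt_encard_iff_nontrivial]
    exact lt_of_lt_of_le (by decide) (three g hg)
  · rw [Set.eq_univ_iff_forall]
    intro x
    obtain ⟨y, hy⟩ : ∃ y, x ≠ y := by
      by_contra! h
      have e : Projectivization.mk F a hab.ne_zero_left = Projectivization.mk F b hab.ne_zero_right :=
        (h _).symm.trans (h _)
      rw [← Option.some_inj, ← toPoint_of_ne, ← toPoint_of_ne,
        toPoint_eq_toPoint hab.ne_zero_left] at e
      exact hab.not_proportional e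
    obtain ⟨g, hg, hx, -⟩ := hline x y hy
    exact ⟨g, hg, hx⟩
  · rintro g ⟨W₁, h₁, rfl⟩ h ⟨W₂, h₂, rfl⟩ hne x hx y hy
    by_contra hxy
    exact hne (congrArg _ (inter W₁ W₂ h₁ h₂ _ _ (indep₂_rep hxy) (rep_mem.2 hx.1) (rep_mem.2 hy.1)
      (rep_mem.2 hx.2) (rep_mem.2 hy.2)))
  · rintro g₁ ⟨W₁, h₁, rfl⟩ g₂ ⟨W₂, h₂, rfl⟩ hne o ⟨ho₁, ho₂⟩ k₁ ⟨U₁, -, rfl⟩ k₂ ⟨U₂, -, rfl⟩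
      hok₁ hok₂ ⟨p₁, hp₁, hp₁'⟩ ⟨p₂, hp₂, hp₂'⟩ ⟨q₁, hq₁, hq₁'⟩ ⟨q₂, hq₂, hq₂'⟩
    have hp₁o : o ≠ p₁ := by rintro rfl; exact hok₁ hp₁
    have hp₂o : o ≠ p₂ := by rintro rfl; exact hok₁ hp₂
    have hq₁o : o ≠ q₁ := by rintro rfl; exact hok₂ hq₁
    have hp : p₁ ≠ p₂ := by
      rintro rfl
      exact hne (congrArg _ (inter W₁ W₂ h₁ h₂ _ _ (indep₂_rep hp₁o) (rep_mem.2 ho₁)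
        (rep_mem.2 hp₁') (rep_mem.2 ho₂) (rep_mem.2 hp₂')))
    rw [eq_span_pair h₁ (indep₂_rep hp₁o) (rep_mem.2 ho₁) (rep_mem.2 hp₁'), ← rep_mem,
      Submodule.mem_span_pair] at hq₁'
    rw [eq_span_pair h₂ (indep₂_rep hp₂o) (rep_mem.2 ho₂) (rep_mem.2 hp₂'), ← rep_mem,
      Submodule.mem_span_pair] at hq₂'
    obtain ⟨α, β, e₁⟩ := hq₁'
    obtain ⟨γ, δ, e₂⟩ := hq₂'
    rw [← rep_mem] at hp₁ hp₂ hq₁ hq₂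
    by_cases hα : α = 0
    · have hβ : β ≠ 0 := by
        rintro rfl
        exact q₁.rep_nonzero (by rw [← e₁, hα]; simp)
      refine ⟨p₁, rep_mem.1 hp₁, rep_mem.1 ?_⟩
      rw [hα, zero_smul, zero_add] at e₁
      rwa [← e₁, Submodule.smul_mem_iff _ hβ] at hq₁
    · have hδ : δ ≠ 0 := by
        rintro rfl
        have hγ : γ ≠ 0 := by
          rintro rfl
          exact q₂.rep_nonzero (by rw [← e₂]; simp)
        rw [zero_smul, add_zero] at e₂
        rw [← e₂, Submodule.smul_mem_iff _ hγ] at hq₂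
        exact hok₂ (rep_mem.1 hq₂)
      -- Elimination of the representative of `o`. The resulting vector is a combination of `p₁`,
      -- `p₂` and also of `q₁`, `q₂`, so it represents the common point.
      have e : γ • q₁.rep - α • q₂.rep = (γ * β) • p₁.rep - (α * δ) • p₂.rep := by
        rw [← e₁, ← e₂]
        module
      have hx : (γ * β) • p₁.rep - (α * δ) • p₂.rep ≠ 0 := fun h =>
        mul_ne_zero hα hδ (neg_eq_zero.1 (indep₂_rep hp (γ * β) (-(α * δ)) (by rw [← h]; module)).2)
      refine ⟨_, (mem_pgPoints_of_toPoint (toPoint_of_ne hx) _).2 ?_,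
        (mem_pgPoints_of_toPoint (toPoint_of_ne hx) _).2 ?_⟩
      · exact U₁.sub_mem (U₁.smul_mem _ hp₁) (U₁.smul_mem _ hp₂)
      · rw [← e]
        exact U₂.sub_mem (U₂.smul_mem _ hq₁) (U₂.smul_mem _ hq₂)

end ProjectiveGeometry

/-! ### The fundamental theorem of projective geometry -/

section FundamentalTheorem

variable {F V W : Type*} [Field F] [AddCommGroup V] [Module F V] [AddCommGroup W] [Module F W]

theorem Indep₂.map_projMap {g : V → W} (hg : IsProjMap F g) (hk : ∀ v, g v = 0 → v = 0) {v w : V}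
    (h : Indep₂ F v w) : Indep₂ F (g v) (g w) := by
  refine indep₂_of_not_proportional (fun e => h.ne_zero_left (hk _ e))
    (fun e => h.ne_zero_right (hk _ e)) fun h' => ?_
  obtain ⟨c, hc, e⟩ := hg.exists_kernel v w h'
  exact hc (h 1 c (by simpa using hk _ e)).2

theorem Indep₂.congr {v w v' w' : V} (h : Indep₂ F v w) (hv : Proportional F v' v)
    (hw : Proportional F w' w) : Indep₂ F v' w' := by
  obtain ⟨c, hc, rfl⟩ := hv
  obtain ⟨d, hd, rfl⟩ := hw
  intro s t e
  have := h (s * c) (t * d) (by rw [← e]; module)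
  exact ⟨(mul_eq_zero.1 this.1).resolve_right hc, (mul_eq_zero.1 this.2).resolve_right hd⟩

theorem Indep₃.map_projMap {g : V → W} (hg : IsProjMap F g) (hk : ∀ v, g v = 0 → v = 0) {x y z : V}
    (h : Indep₃ F x y z) : Indep₃ F (g x) (g y) (g z) := by
  have hxy : Indep₂ F x y := fun s t e => by
    have := h s t 0 (by rw [← e]; module)
    exact ⟨this.1, this.2.1⟩
  refine (hxy.map_projMap hg hk).indep₃ fun s t e => ?_
  obtain ⟨a, b, hab⟩ := hg.exists_preimage x y s t
  rw [← e] at hab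
  obtain ⟨c, hc, e'⟩ := hg.exists_kernel _ _ hab
  exact hc (h a b c (hk _ e')).2.2

/-- A global injective linear mapping of projective spaces (of dimension at least two) is
separated by the differences of a suitable choice of vectors. -/
theorem exists_difference_lift {g : V → W} (hg : IsProjMap F g) (hk : ∀ v, g v = 0 → v = 0)
    {x y z : V} (hi : Indep₃ F x y z) :
    ∃ f : V → W, (∀ v, Proportional F (f v) (g v)) ∧
      ∀ v w, Proportional F (f v - f w) (g (v - w)) := by
  have hx : g x ≠ 0 := fun h => one_ne_zero (hi 1 0 0 (by simp [hk x h])).1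
  -- The factor `F` creates room: the image of `g` is placed in `W × 0`, and `(0, 1)` is a point off
  -- it whose translates can be formed.
  have hG : (projectiveGeometry F (W × F)).IsProjective := by
    refine isProjective_projectiveGeometry (a := (g x, 0)) (b := (0, 1)) fun s t e => ?_
    simp only [Prod.smul_mk, smul_zero, smul_eq_mul, mul_zero, mul_one, Prod.mk_add_mk, add_zero,
      zero_add, Prod.mk_eq_zero] at e
    exact ⟨(smul_eq_zero.1 e.1).resolve_right hx, e.2⟩
  have hg' : IsProjMap F (fun v => ((g v, 0) : W × F)) := by
    refine ⟨by rw [hg.map_zero]; rfl, fun c v hc => (hg.map_smul c v hc).map (LinearMap.inl F W F),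
      fun v w => ?_, fun v w h => ?_, fun v w a b => ?_⟩
    · obtain ⟨a, b, e⟩ := hg.map_add v w
      exact ⟨a, b, by rw [e]; simp⟩
    · obtain ⟨c, hc, e⟩ := hg.exists_kernel v w (h.map (LinearMap.fst F W F))
      exact ⟨c, hc, by rw [e]; rfl⟩
    · obtain ⟨s, t, e⟩ := hg.exists_preimage v w a b
      refine ⟨s, t, ?_⟩
      simpa using e.map (LinearMap.inl F W F)
  have hψ := isVecLinear_toPoint.comp_projMap hg' (V := V) (G := projectiveGeometry F (W × F))
  have hψk : ∀ v, toPoint F ((g v, 0) : W × F) = none → v = 0 := fun v h =>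
    hk v (Prod.mk_eq_zero.1 (toPoint_eq_none.1 h)).1
  have h01 : ((0, 1) : W × F) ≠ 0 := by simp
  obtain ⟨pt, hpt0, hpt⟩ := exists_translates hG hψ hψk hi.exists_not_mem
    (p := Projectivization.mk F (0, 1) h01) fun v h => by
      rw [← toPoint_of_ne, eq_comm, toPoint_eq_toPoint h01] at h
      obtain ⟨c, -, e⟩ := h
      simp at e
  rw [← Option.some_inj, ← toPoint_of_ne] at hpt0
  have hdir : ∀ v w, v ≠ w → ∀ a, toPoint F a = some (pt w) → ∃ s t : F, s ≠ 0 ∧ t ≠ 0 ∧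
      toPoint F (s • a + t • ((g (v - w), 0) : W × F)) = some (pt v) := by
    intro v w hvw a ha
    obtain ⟨hne, hv, hw, l, hl, hvl, hwl, δ, hδl, hδ⟩ := hpt v w hvw
    obtain ⟨s, t, e⟩ := (isVecLinear_toPoint.mem_line _ _ _ _ ha hδ
      (fun e => hw _ (e ▸ hδ)) l hl hwl hδl _).1 hvl
    refine ⟨s, t, ?_, ?_, e⟩
    · rintro rfl
      rw [zero_smul, zero_add] at e
      by_cases ht : t = 0
      · rw [ht, zero_smul, toPoint_eq_none.2 rfl] at e
        exact absurd e (by simp)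
      · rw [isVecLinear_toPoint.map_smul t _ ht, show toPoint F _ = some δ from hδ,
          Option.some_inj] at e
        exact hv _ (hδ.trans (congrArg some e))
    · rintro rfl
      rw [zero_smul, add_zero] at e
      by_cases hs : s = 0
      · rw [hs, zero_smul, toPoint_eq_none.2 rfl] at e
        exact absurd e (by simp)
      · rw [isVecLinear_toPoint.map_smul s _ hs, ha, Option.some_inj] at e
        exact hne e.symm
  -- The translate by `v` has a representative `(f v, 1)`. The direction between two translates is
  -- then the difference of their first components, which is what makes `f` additive later on.
  have hf : ∀ v, ∃ a : W, toPoint F ((a, 1) : W × F) = some (pt v) ∧ Proportional F a (g v) := by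
    intro v
    by_cases hv : v = 0
    · exact ⟨0, by rw [hv, hpt0], by rw [hv, hg.map_zero]; exact .refl 0⟩
    · obtain ⟨s, t, hs, ht, e⟩ := hdir v 0 hv _ hpt0.symm
      refine ⟨(s⁻¹ * t) • g v, ?_, _, mul_ne_zero (inv_ne_zero hs) ht, rfl⟩
      rw [← e]
      refine Eq.trans (congrArg (toPoint F) ?_) (isVecLinear_toPoint.map_smul s⁻¹ _
        (inv_ne_zero hs))
      ext
      · simp [smul_smul]
      · simp [hs]
  choose f hf1 hf2 using hf
  refine ⟨f, hf2, fun v w => ?_⟩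
  by_cases hvw : v = w
  · rw [hvw, sub_self, sub_self, hg.map_zero]
    exact .refl 0
  · obtain ⟨s, t, hs, ht, e⟩ := hdir v w hvw _ (hf1 w)
    rw [← hf1 v, eq_comm, toPoint_eq_toPoint (by simp)] at e
    obtain ⟨c, hc, e⟩ := e
    have e1 := congrArg Prod.fst e
    have e2 := congrArg Prod.snd e
    simp only [Prod.smul_mk, Prod.mk_add_mk, smul_eq_mul, mul_one, mul_zero, add_zero] at e1 e2
    refine ⟨c * t, mul_ne_zero hc ht, ?_⟩
    rw [e1, smul_add, smul_smul, ← e2, one_smul, add_sub_cancel_left, smul_smul]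

/-- The fundamental theorem of projective geometry for injective linear mappings. -/
theorem exists_semilinear_lift {g : V → W} (hg : IsProjMap F g) (hk : ∀ v, g v = 0 → v = 0)
    {x y z : V} (hi : Indep₃ F x y z) :
    ∃ (f : V →+ W) (σ : F → F), (∀ c v, f (c • v) = σ c • f v) ∧
      ∀ v, Proportional F (f v) (g v) := by
  obtain ⟨f, hfg, hd⟩ := exists_difference_lift hg hk hi
  have hf0 : f 0 = 0 := (hg.map_zero ▸ hfg 0).eq_zero
  have hind : ∀ {v w}, Indep₂ F v w → Indep₂ F (f v) (f w) := fun h =>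
    (h.map_projMap hg hk).congr (hfg _) (hfg _)
  -- `f (v + w)` differs from `f v` by a multiple of `f w`, and from `f w` by a multiple of `f v`;
  -- independence forces both factors to be one.
  have hadd₀ : ∀ v w, Indep₂ F v w → f (v + w) = f v + f w := by
    intro v w h
    have h1 := hd (v + w) v
    have h2 := hd (v + w) w
    rw [add_sub_cancel_left] at h1
    rw [add_sub_cancel_right] at h2
    obtain ⟨a, -, e₁⟩ := h1.trans (hfg w).symm
    obtain ⟨b, -, e₂⟩ := h2.trans (hfg v).symm
    have h3 := hind h (1 - b) (a - 1) (by
      linear_combination (norm := module) e₂ - e₁)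
    have ha : a = 1 := by linear_combination h3.2
    rw [ha, one_smul] at e₁
    rw [← e₁]
    abel
  have hout : ∀ v : V, v ≠ 0 → ∃ u, Indep₂ F v u := fun v hv =>
    (hi.exists_not_mem v 0).imp fun u hu => indep₂_of_not_mem hv fun c h =>
      hu c 0 (by simpa using h)
  have hadd : ∀ v w, f (v + w) = f v + f w := by
    intro v w
    by_cases hv : v = 0
    · rw [hv, zero_add, hf0, zero_add]
    by_cases hw : w = 0
    · rw [hw, add_zero, hf0, add_zero]
    by_cases h : ∀ c : F, w ≠ c • v
    · exact hadd₀ v w (indep₂_of_not_mem hv h)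
    push Not at h
    obtain ⟨c, rfl⟩ := h
    have hc : c ≠ 0 := by rintro rfl; simp at hw
    -- For dependent vectors an independent `u` is added, and the sum `v + c • v + u` is bracketed
    -- in two ways.
    obtain ⟨u, hu⟩ := hout v hv
    have h1 : f (v + (c • v + u)) = f v + f (c • v + u) := hadd₀ _ _ fun s t e => by
      have := hu (s + t * c) t (by rw [← e]; module)
      exact ⟨by linear_combination this.1 - c * this.2, this.2⟩
    have h2 : f (c • v + u) = f (c • v) + f u :=
      hadd₀ _ _ (hu.congr (.smul_left hc v) (.refl u))
    have h3 : f (v + c • v + u) = f (v + c • v) + f u := by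
      by_cases hvc : v + c • v = 0
      · rw [hvc, zero_add, hf0, zero_add]
      · have hc1 : 1 + c ≠ 0 := fun h => hvc (by
          rw [show v + c • v = (1 + c) • v by module, h, zero_smul])
        exact hadd₀ _ _ (hu.congr ⟨1 + c, hc1, by module⟩ (.refl u))
    rw [← add_assoc, h3, h2, ← add_assoc] at h1
    exact add_right_cancel h1
  have hscal : ∀ (c : F) v, ∃ s : F, f (c • v) = s • f v := by
    intro c v
    by_cases hc : c = 0
    · exact ⟨0, by rw [hc, zero_smul, zero_smul, hf0]⟩
    · obtain ⟨s, -, e⟩ := (hfg (c • v)).trans ((hg.map_smul c v hc).trans (hfg v).symm)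
      exact ⟨s, e⟩
  -- The scalar belonging to `c` is the same at `u` and `v`, as seen by evaluating at `c • (u + v)`.
  have hcmp : ∀ (c s : F) u v, Indep₂ F u v → f (c • u) = s • f u → f (c • v) = s • f v := by
    intro c s u v huv e
    obtain ⟨t, ht⟩ := hscal c v
    obtain ⟨r, hr⟩ := hscal c (u + v)
    rw [smul_add, hadd, hadd, e, ht] at hr
    have := hind huv (s - r) (t - r) (by linear_combination (norm := module) hr)
    rw [ht, show t = s by linear_combination this.2 - this.1]
  have hx : x ≠ 0 := by
    rintro rfl
    exact one_ne_zero (hi 1 0 0 (by simp)).1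
  choose σ hσ using fun c => hscal c x
  refine ⟨⟨⟨f, hf0⟩, hadd⟩, σ, fun c v => ?_, hfg⟩
  change f (c • v) = σ c • f v
  by_cases hv : v = 0
  · rw [hv, smul_zero, hf0, smul_zero]
  by_cases h : ∀ t : F, v ≠ t • x
  · exact hcmp c _ x v (indep₂_of_not_mem hx h) (hσ c)
  push Not at h
  obtain ⟨t, rfl⟩ := h
  have ht : t ≠ 0 := by rintro rfl; simp at hv
  obtain ⟨u, hu⟩ := hout x hx
  exact hcmp c _ u (t • x) (hu.symm.congr (.refl u) (.smul_left ht x)) (hcmp c _ x u hu (hσ c))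

/-- The fundamental theorem of projective geometry for linear mappings whose image contains a
plane. -/
theorem exists_semilinear_lift_of_indep {g : V → W} (hg : IsProjMap F g) {x y z : V}
    (hi : ∀ r s t : F, g (r • x + s • y + t • z) = 0 → r = 0 ∧ s = 0 ∧ t = 0) :
    ∃ (f : V →+ W) (σ : F → F), (∀ c v, f (c • v) = σ c • f v) ∧
      ∀ v, Proportional F (f v) (g v) := by
  obtain ⟨C, hC⟩ := hg.kernel.exists_isCompl
  let π : V →ₗ[F] C := C.projectionOnto hg.kernel hC.symm
  have hπ : ∀ v, Proportional F (g (π v)) (g v) := by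
    intro v
    have h1 : v - π v ∈ hg.kernel := by
      rw [← Submodule.projectionOnto_apply_eq_zero_iff hC.symm, map_sub,
        Submodule.projectionOnto_apply_left, sub_self]
    have := hg.proportional_of_add_kernel h1 (w := (π v : V))
    rw [sub_add_cancel] at this
    exact this.symm
  have hk : ∀ v : C, g v = 0 → v = 0 := by
    intro v hv
    have : (v : V) ∈ hg.kernel ⊓ C := ⟨hv, v.2⟩
    rw [hC.inf_eq_bot, Submodule.mem_bot] at this
    exact Subtype.ext this
  obtain ⟨f, σ, h1, h2⟩ := exists_semilinear_lift (x := π x) (y := π y) (z := π z)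
    (hg.comp_linear C.subtype) hk fun r s t e => by
      refine hi r s t ?_
      rw [← (hπ _).eq_zero_iff]
      have : π (r • x + s • y + t • z) = 0 := by simpa using e
      rw [this]
      exact hg.map_zero
  exact ⟨f.comp π.toAddMonoidHom, σ, fun c v => by simpa using h1 c (π v), fun v =>
    (h2 (π v)).trans (hπ v)⟩

end FundamentalTheorem

/-! ### Pencils of linear maps -/

section Pencil

variable {F V W : Type*} [Field F] [AddCommGroup V] [Module F V] [AddCommGroup W] [Module F W]

/-- Two linear mappings that agree off a proper subspace are equal. -/
theorem IsProjMap.proportional_of_off_subspace {q p : V → W} (hq : IsProjMap F q)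
    (hp : IsProjMap F p) {S : Submodule F V} (hS : S ≠ ⊤)
    (h : ∀ x, x ∉ S → Proportional F (q x) (p x)) (x : V) : Proportional F (q x) (p x) := by
  by_cases hx : x ∉ S
  · exact h x hx
  rw [not_not] at hx
  obtain ⟨u, hu⟩ : ∃ u, u ∉ S := by
    by_contra! hcon
    exact hS (Submodule.eq_top_iff'.2 hcon)
  have hadd : ∀ v (s t : F), v ∉ S → s ≠ 0 → s • v + t • x ∉ S := fun v s t hv hs hmem => by
    rw [S.add_mem_iff_left (S.smul_mem _ hx), S.smul_mem_iff hs] at hmem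
    exact hv hmem
  have hadd' : ∀ v, v ∉ S → v + x ∉ S := fun v hv => by
    simpa using hadd v 1 1 hv one_ne_zero
  -- A kernel vector `v` off `S` can be added to `x` without changing either value, and this moves
  -- `x` off `S`.
  by_cases h0 : ∃ v, v ∉ S ∧ p v = 0
  · obtain ⟨v, hv, hpv⟩ := h0
    exact (hq.proportional_of_add_kernel ((h v hv).eq_zero_iff.2 hpv)).symm.trans
      ((h _ (hadd' v hv)).trans (hp.proportional_of_add_kernel hpv))
  push Not at h0
  have hq0 : ∀ v, v ∉ S → q v ≠ 0 := fun v hv e => h0 v hv ((h v hv).eq_zero_iff.1 e)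
  have hzero : ∀ {r : V → W}, IsProjMap F r → (∀ v, v ∉ S → r v ≠ 0) →
      Proportional F (r u) (r (u + x)) → r x = 0 := by
    intro r hr hr0 e
    obtain ⟨c, hc, e⟩ := hr.exists_kernel _ _ e
    have e' : u + c • (u + x) = (1 + c) • u + c • x := by module
    rw [e'] at e
    have h1 : 1 + c = 0 := by
      by_contra h1
      exact hr0 _ (hadd u _ c hu h1) e
    rw [h1, zero_smul, zero_add] at e
    exact (hr.map_smul c x hc).eq_zero_iff.1 e
  by_cases he : Proportional F (p u) (p (u + x))
  · rw [hzero hp h0 he, hzero hq hq0 ((h u hu).trans (he.trans (h _ (hadd' u hu)).symm))]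
    exact .refl 0
  have hqx : q x ≠ 0 := fun e => he ((h u hu).symm.trans (Proportional.symm
    ((h _ (hadd' u hu)).symm.trans (by rw [add_comm]; exact hq.proportional_of_add_kernel e))))
  obtain ⟨a, b, e⟩ := hq.map_add ((-1 : F) • u) (u + x)
  rw [show (-1 : F) • u + (u + x) = x by module] at e
  obtain ⟨c, -, e₁⟩ := (hq.map_smul (-1) u (by simp)).trans (h u hu)
  obtain ⟨d, -, e₂⟩ := h _ (hadd' u hu)
  -- `q x` is a combination of the values at `u` and `u + x`, where `q` and `p` agree, so it is
  -- proportional to a value of `p` at some `(s + t) • u + t • x`. If `s + t ≠ 0`, this vector is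
  -- off `S` and has the same image under `q` as `x`, which would produce a kernel vector of `q` off
  -- `S`.
  obtain ⟨s, t, hst⟩ := hp.exists_preimage u (u + x) (a * c) (b * d)
  rw [mul_smul, mul_smul, ← e₁, ← e₂, ← e] at hst
  have e' : s • u + t • (u + x) = (s + t) • u + t • x := by module
  rw [e'] at hst
  by_cases hs : s + t = 0
  · rw [hs, zero_smul, zero_add] at hst
    have ht : t ≠ 0 := by
      rintro rfl
      rw [zero_smul, hp.map_zero] at hst
      exact hqx hst.symm.eq_zero
    exact hst.symm.trans (hp.map_smul t x ht)
  · have hw := hadd u _ t hu hs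
    obtain ⟨r, -, e⟩ := hq.exists_kernel _ _ ((h _ hw).trans hst)
    refine absurd e (hq0 _ ?_)
    simpa using hadd _ 1 r hw one_ne_zero

/-- A linear mapping whose values lie on the joins of the values of `p` and `r`, and which agrees
with `p` in a suitable point, equals `p`. -/
theorem IsProjMap.proportional_of_mem_span {q : V → W} (hq : IsProjMap F q) (p r : V →ₗ[F] W)
    (hspan : ∀ x, ∃ α β : F, q x = α • p x + β • r x) {x₀ : V} (hx₀ : r x₀ ∉ LinearMap.range p)
    (h₀ : Proportional F (q x₀) (p x₀)) (hz : ∀ x, q x = 0 → ¬ Indep₂ F (p x) (r x)) (x : V) :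
    Proportional F (q x) (p x) := by
  -- `θ` vanishes on the range of `p` but not at `r x₀`. Splitting off a multiple of `x₀` shows that
  -- it vanishes on all values of `q`. So the `r`-component of `q x` is zero whenever `θ (r x) ≠ 0`,
  -- that is, off a proper subspace.
  obtain ⟨θ, hθ₀, hθ⟩ := Submodule.exists_le_ker_of_notMem hx₀
  have hθp : ∀ x, θ (p x) = 0 := fun x => hθ ⟨x, rfl⟩
  have hθq : ∀ x, θ (q x) = 0 := by
    intro x
    let c := θ (r x) / θ (r x₀)
    obtain ⟨a, b, e⟩ := hq.map_add (x - c • x₀) (c • x₀)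
    rw [sub_add_cancel] at e
    have h1 : θ (q (x - c • x₀)) = 0 := by
      obtain ⟨α, β, e⟩ := hspan (x - c • x₀)
      rw [e]
      simp [hθp, c, hθ₀]
    have h2 : θ (q (c • x₀)) = 0 := by
      by_cases hc : c = 0
      · rw [hc, zero_smul, hq.map_zero, _root_.map_zero]
      · obtain ⟨d, -, e⟩ := (hq.map_smul c x₀ hc).trans h₀
        rw [e, _root_.map_smul, hθp, smul_zero]
    rw [e, _root_.map_add, _root_.map_smul, _root_.map_smul, h1, h2, smul_zero, smul_zero, add_zero]
  refine hq.proportional_of_off_subspace p.isProjMap (S := LinearMap.ker (θ.comp r)) ?_ ?_ x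
  · intro h
    exact hθ₀ (show x₀ ∈ LinearMap.ker (θ.comp r) from h ▸ Submodule.mem_top)
  · intro x hx
    have hx : θ (r x) ≠ 0 := hx
    obtain ⟨α, β, e⟩ := hspan x
    have hβ : β = 0 := by
      have := hθq x
      rw [e, _root_.map_add, _root_.map_smul, _root_.map_smul, hθp, smul_zero, zero_add, smul_eq_mul] at this
      exact (mul_eq_zero.1 this).resolve_right hx
    rw [hβ, zero_smul, add_zero] at e
    by_cases hα : α = 0
    · rw [hα, zero_smul] at e
      have : p x = 0 := by
        by_contra hp
        refine hz x e fun s t h => ?_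
        have ht : t = 0 := by
          have := congrArg θ h
          rw [_root_.map_add, _root_.map_smul, _root_.map_smul, hθp, smul_zero, zero_add, smul_eq_mul, _root_.map_zero] at this
          exact (mul_eq_zero.1 this).resolve_right hx
        rw [ht, zero_smul, add_zero] at h
        exact ⟨(smul_eq_zero.1 h).resolve_right hp, ht⟩
      rw [e, this]
      exact .refl 0
    · exact ⟨α, hα, e⟩

/-- If both coordinates of a kernel vector were non-zero, dropping it would make the values at `(1,
0)` and `(0, 1)` proportional. -/
theorem IsProjMap.kernel_eq_zero_of_indep {g : F × F → W} (hg : IsProjMap F g)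
    (h : Indep₂ F (g (1, 0)) (g (0, 1))) {y : F × F} (hy : g y = 0) : y = 0 := by
  obtain ⟨s, t⟩ := y
  have e₁ : ((s, t) : F × F) = s • (1, 0) + t • (0, 1) := by simp
  by_cases hs : s = 0 <;> by_cases ht : t = 0
  · rw [hs, ht]; rfl
  · rw [e₁, hs, zero_smul, zero_add, (hg.map_smul t _ ht).eq_zero_iff] at hy
    exact absurd hy h.ne_zero_right
  · rw [e₁, ht, zero_smul, add_zero, (hg.map_smul s _ hs).eq_zero_iff] at hy
    exact absurd hy h.ne_zero_left
  · have := hg.proportional_of_add_kernel hy (w := (-s) • ((1, 0) : F × F))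
    rw [show ((s, t) : F × F) + (-s) • (1, 0) = t • (0, 1) by simp] at this
    exact absurd ((hg.map_smul t _ ht).symm.trans
      (this.trans (hg.map_smul _ _ (neg_ne_zero.2 hs)))).symm h.not_proportional

/-- The span condition that prevents the pencil generated by `f₀` and `f₁` from being contained in
the image of one of its members. -/
def SpreadPencil (f₀ f₁ : V →ₗ[F] W) : Prop :=
  ∀ a b : F, (a, b) ≠ 0 → ∃ x,
    f₀ x ∉ LinearMap.range (a • f₀ + b • f₁) ∨ f₁ x ∉ LinearMap.range (a • f₀ + b • f₁)

/-- In a spread pencil every member has, together with a suitable generator, an independent pair of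
values of which the second is not in the range of the member. -/
theorem SpreadPencil.exists_indep {f₀ f₁ : V →ₗ[F] W} (h : SpreadPencil f₀ f₁) {a b : F}
    (hab : (a, b) ≠ 0) :
    ∃ r : V →ₗ[F] W, (∀ x, ∀ c d : F, ∃ α β : F,
      c • f₀ x + d • f₁ x = α • (a • f₀ + b • f₁) x + β • r x) ∧
      (∀ x, Indep₂ F ((a • f₀ + b • f₁) x) (r x) → Indep₂ F (f₀ x) (f₁ x)) ∧
      ∃ x₀, r x₀ ∉ LinearMap.range (a • f₀ + b • f₁) ∧ (a • f₀ + b • f₁) x₀ ≠ 0 := by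
  set p := a • f₀ + b • f₁ with hp
  have hpx : ∀ x, p x = a • f₀ x + b • f₁ x := fun x => rfl
  have hp0 : ∃ x, p x ≠ 0 := by
    by_contra! h0
    by_cases hb : b = 0
    · have ha : a ≠ 0 := by rintro rfl; exact hab (by rw [hb]; rfl)
      have hf₀ : ∀ x, f₀ x = 0 := fun x => by
        have := h0 x
        rw [hpx, hb, zero_smul, add_zero] at this
        exact (smul_eq_zero.1 this).resolve_left ha
      obtain ⟨x, hx | hx⟩ := h 0 1 (by simp)
      · exact hx ⟨0, by rw [map_zero, hf₀]⟩
      · exact hx ⟨x, by simp⟩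
    · obtain ⟨x, hx | hx⟩ := h 1 0 (by simp)
      · exact hx ⟨x, by simp⟩
      · refine hx ⟨-(b⁻¹ * a) • x, ?_⟩
        have h1 : b⁻¹ • (a • f₀ x + b • f₁ x) = 0 := by rw [← hpx, h0 x, smul_zero]
        rw [smul_add, smul_smul, smul_smul, inv_mul_cancel₀ hb, one_smul] at h1
        simp only [one_smul, zero_smul, add_zero, map_smul]
        linear_combination (norm := module) -h1
  -- The two requirements on `x₀` can be met together: if `p x = 0`, then adding some `x₁` with `p
  -- x₁ ≠ 0` repairs this, unless `x₁` itself already serves.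
  have shift : ∀ r : V →ₗ[F] W, (∃ x, r x ∉ LinearMap.range p) →
      ∃ x₀, r x₀ ∉ LinearMap.range p ∧ p x₀ ≠ 0 := by
    rintro r ⟨x, hx⟩
    by_cases hpx : p x = 0
    · obtain ⟨x₁, hx₁⟩ := hp0
      by_cases hr : r x₁ ∈ LinearMap.range p
      · refine ⟨x + x₁, ?_, by rwa [map_add, hpx, zero_add]⟩
        rwa [map_add, Submodule.add_mem_iff_left _ hr]
      · exact ⟨x₁, hr, hx₁⟩
    · exact ⟨x, hx, hpx⟩
  obtain ⟨x, hx | hx⟩ := h a b hab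
  · have hb : b ≠ 0 := by
      rintro rfl
      have ha : a ≠ 0 := by rintro rfl; exact hab rfl
      exact hx ⟨a⁻¹ • x, by rw [hpx]; simp [ha]⟩
    have hf₁ : ∀ x, f₁ x = b⁻¹ • p x - (b⁻¹ * a) • f₀ x := fun x => by
      rw [hpx, smul_add, smul_smul, smul_smul, inv_mul_cancel₀ hb, one_smul]; abel
    refine ⟨f₀, fun x c d => ⟨d * b⁻¹, c - d * (b⁻¹ * a), ?_⟩, fun x hi s t e => ?_,
      shift f₀ ⟨x, hx⟩⟩
    · rw [hf₁]; module
    · have := hi (t * b⁻¹) (s - t * (b⁻¹ * a)) (by rw [← e, hf₁]; module)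
      have ht : t = 0 := (mul_eq_zero.1 this.1).resolve_right (inv_ne_zero hb)
      exact ⟨by linear_combination this.2 + (b⁻¹ * a) * ht, ht⟩
  · have ha : a ≠ 0 := by
      rintro rfl
      have hb : b ≠ 0 := by rintro rfl; exact hab rfl
      exact hx ⟨b⁻¹ • x, by rw [hpx]; simp [hb]⟩
    have hf₀ : ∀ x, f₀ x = a⁻¹ • p x - (a⁻¹ * b) • f₁ x := fun x => by
      rw [hpx, smul_add, smul_smul, smul_smul, inv_mul_cancel₀ ha, one_smul]; abel
    refine ⟨f₁, fun x c d => ⟨c * a⁻¹, d - c * (a⁻¹ * b), ?_⟩, fun x hi s t e => ?_,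
      shift f₁ ⟨x, hx⟩⟩
    · rw [hf₀]; module
    · have := hi (s * a⁻¹) (t - s * (a⁻¹ * b)) (by rw [← e, hf₀]; module)
      have hs : s = 0 := (mul_eq_zero.1 this.1).resolve_right (inv_ne_zero ha)
      exact ⟨hs, by linear_combination this.2 + (a⁻¹ * b) * hs⟩

/-- A map on `V × F²` that is a linear mapping in each variable, given on the basis of `F²` by a
spread pencil of linear maps, runs through the members of this pencil. -/
theorem SpreadPencil.exists_member {f₀ f₁ : V →ₗ[F] W} (h : SpreadPencil f₀ f₁)
    {X : V → F × F → W} (hX₁ : ∀ y, IsProjMap F fun x => X x y) (hX₂ : ∀ x, IsProjMap F (X x))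
    (h₀ : ∀ x, Proportional F (X x (1, 0)) (f₀ x)) (h₁ : ∀ x, Proportional F (X x (0, 1)) (f₁ x))
    {y : F × F} (hy : y ≠ 0) :
    ∃ a b : F, (a, b) ≠ 0 ∧ ∀ x, Proportional F (X x y) (a • f₀ x + b • f₁ x) := by
  have hker : ∀ x, Indep₂ F (f₀ x) (f₁ x) → ∀ y, X x y = 0 → y = 0 := fun x hx y hxy =>
    (hX₂ x).kernel_eq_zero_of_indep (hx.congr (h₀ x) (h₁ x)) hxy
  have hspan : ∀ x y, ∃ c d : F, X x y = c • f₀ x + d • f₁ x := by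
    intro x y
    have hs : ∀ (s : F) y, ∃ c : F, X x (s • y) = c • X x y := by
      intro s y
      by_cases hs : s = 0
      · exact ⟨0, by rw [hs, zero_smul, zero_smul, (hX₂ x).map_zero]⟩
      · exact ((hX₂ x).map_smul s y hs).imp fun c hc => hc.2
    obtain ⟨a, b, e⟩ := (hX₂ x).map_add (y.1 • (1, 0)) (y.2 • (0, 1))
    obtain ⟨c, hc⟩ := hs y.1 (1, 0)
    obtain ⟨d, hd⟩ := hs y.2 (0, 1)
    obtain ⟨c', -, hc'⟩ := h₀ x
    obtain ⟨d', -, hd'⟩ := h₁ x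
    refine ⟨a * c * c', b * d * d', ?_⟩
    rw [hc, hd, hc', hd', show y.1 • ((1, 0) : F × F) + y.2 • (0, 1) = y by simp] at e
    rw [e]
    module
  have hpre : ∀ x (a b : F), ∃ y, Proportional F (X x y) (a • f₀ x + b • f₁ x) := by
    intro x a b
    obtain ⟨c, -, e⟩ := (h₀ x).symm
    obtain ⟨d, -, e'⟩ := (h₁ x).symm
    obtain ⟨s, t, e''⟩ := (hX₂ x).exists_preimage (1, 0) (0, 1) (a * c) (b * d)
    exact ⟨_, by rwa [mul_smul, mul_smul, ← e, ← e'] at e''⟩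
  -- Every member of the pencil occurs as a slice: `y` is chosen to give the right value at one
  -- vector `x₀`, and `IsProjMap.proportional_of_mem_span` spreads the agreement to all `x`.
  have member : ∀ a b : F, (a, b) ≠ 0 → ∃ y, y ≠ 0 ∧
      ∀ x, Proportional F (X x y) (a • f₀ x + b • f₁ x) := by
    intro a b hab
    obtain ⟨r, hr₁, hr₂, x₀, hx₀, hpx₀⟩ := h.exists_indep hab
    obtain ⟨y, hxy⟩ := hpre x₀ a b
    have hy : y ≠ 0 := by
      rintro rfl
      rw [(hX₂ x₀).map_zero] at hxy
      exact hpx₀ hxy.symm.eq_zero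
    refine ⟨y, hy, (hX₁ y).proportional_of_mem_span (a • f₀ + b • f₁) r (fun x => ?_) hx₀ hxy
      fun x hx hi => hy (hker x (hr₂ x hi) y hx)⟩
    obtain ⟨c, d, e⟩ := hspan x y
    obtain ⟨α, β, e'⟩ := hr₁ x c d
    exact ⟨α, β, e.trans e'⟩
  -- Conversely, let `f₀ x₀` and `f₁ x₀` be independent. Then the value at `x₀` determines the
  -- second argument up to a factor, so `y` belongs to the member that takes this value.
  obtain ⟨r, -, hr₂, x₀, hx₀, hpx₀⟩ := h.exists_indep (a := 1) (b := 0) (by simp)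
  have hi := hr₂ x₀ (indep₂_of_not_mem hpx₀ fun c e => hx₀ ⟨c • x₀, by rw [map_smul, e]⟩)
  obtain ⟨a, b, e⟩ := hspan x₀ y
  have hab : (a, b) ≠ 0 := by
    intro h
    rw [Prod.mk_eq_zero] at h
    rw [h.1, h.2, zero_smul, zero_smul, add_zero] at e
    exact hy (hker x₀ hi y e)
  obtain ⟨y', hy', hmem⟩ := member a b hab
  obtain ⟨c, hc, e'⟩ := (hX₂ x₀).exists_kernel y y' (by rw [e]; exact (hmem x₀).symm)
  have e' := hker x₀ hi _ e'
  have e' : y = (-c) • y' := by rw [neg_smul]; exact eq_neg_of_add_eq_zero_left e'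
  refine ⟨a, b, hab, fun x => Proportional.trans ?_ (hmem x)⟩
  rw [e']
  exact (hX₂ x).map_smul _ _ (neg_ne_zero.2 hc)

end Pencil

/-! ### From three-dimensional subspaces to the whole space -/

section PencilExtension

variable {F V W : Type*} [Field F] [AddCommGroup V] [Module F V] [AddCommGroup W] [Module F W]

theorem Indep₃.indep₄ {a b c z : V} (h : Indep₃ F a b c) (hz : z ∉ Submodule.span F {a, b, c}) :
    Indep₄ F a b c z := by
  intro q r s t e
  have ht : t = 0 := by
    by_contra ht
    refine hz (Submodule.mem_span_triple.2 ⟨-(t⁻¹ * q), -(t⁻¹ * r), -(t⁻¹ * s), ?_⟩)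
    have h1 : t⁻¹ • (q • a + r • b + s • c + t • z) = 0 := by rw [e, smul_zero]
    rw [smul_add, smul_smul t⁻¹ t, inv_mul_cancel₀ ht, one_smul] at h1
    linear_combination (norm := module) -h1
  subst ht
  have := h q r s (by simpa using e)
  exact ⟨this.1, this.2.1, this.2.2, rfl⟩

/-- A member has rank at most three, so its range cannot contain four independent vectors. -/
theorem SpreadPencil.of_indep₄ [FiniteDimensional F V] (hV : Module.finrank F V ≤ 3)
    {f₀ f₁ : V →ₗ[F] W} {u : Fin 4 → W} (hi : LinearIndependent F u)
    (hu : ∀ i, u i ∈ LinearMap.range f₀ ⊔ LinearMap.range f₁) : SpreadPencil f₀ f₁ := by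
  by_contra h
  unfold SpreadPencil at h
  push Not at h
  obtain ⟨a, b, -, h⟩ := h
  have h1 : Submodule.span F (Set.range u) ≤ LinearMap.range (a • f₀ + b • f₁) := by
    rw [Submodule.span_le]
    rintro _ ⟨i, rfl⟩
    refine (sup_le ?_ ?_ : LinearMap.range f₀ ⊔ LinearMap.range f₁ ≤ _) (hu i)
    · rintro _ ⟨x, rfl⟩
      exact (h x).1
    · rintro _ ⟨x, rfl⟩
      exact (h x).2
  have h2 := Submodule.finrank_mono h1
  have h3 := LinearMap.finrank_range_le (a • f₀ + b • f₁)
  rw [finrank_span_eq_card hi, Fintype.card_fin] at h2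
  omega

theorem Proportional.eq_smul_of_indep {u v : V} (h : Indep₂ F u v) {a b a' b' : F}
    (hp : Proportional F (a • u + b • v) (a' • u + b' • v)) :
    ∃ c : F, c ≠ 0 ∧ a = c * a' ∧ b = c * b' := by
  obtain ⟨c, hc, e⟩ := hp
  have := h (a - c * a') (b - c * b') (by linear_combination (norm := module) e)
  exact ⟨c, hc, sub_eq_zero.1 this.1, sub_eq_zero.1 this.2⟩

/-- A map on `V × F²` that is a linear mapping in each variable and given by the linear maps `f₀`
and `f₁` on the basis of `F²`. -/
structure PencilMap (f₀ f₁ : V →ₗ[F] W) (X : V → F × F → W) : Prop where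
  left : ∀ y, IsProjMap F fun x => X x y
  right : ∀ x, IsProjMap F (X x)
  fst : ∀ x, Proportional F (X x (1, 0)) (f₀ x)
  snd : ∀ x, Proportional F (X x (0, 1)) (f₁ x)

namespace PencilMap

variable {f₀ f₁ : V →ₗ[F] W} {X : V → F × F → W}

/-- On a span of three vectors `SpreadPencil.of_indep₄` applies. The members found on different
spans are matched afterwards by `transfer`. -/
theorem exists_member_on_span (hX : PencilMap f₀ f₁ X) (x y z : V) {u₁ u₂ u₃ u₄ : W}
    (hi : Indep₄ F u₁ u₂ u₃ u₄)
    (hu : ∀ u ∈ ({u₁, u₂, u₃, u₄} : Set W), ∃ w ∈ Submodule.span F {x, y, z}, u = f₀ w ∨ u = f₁ w)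
    {t : F × F} (ht : t ≠ 0) :
    ∃ a b : F, (a, b) ≠ 0 ∧ ∀ w ∈ Submodule.span F {x, y, z},
      Proportional F (X w t) (a • f₀ w + b • f₁ w) := by
  classical
  set G := Submodule.span F {x, y, z} with hG
  have e : ({x, y, z} : Set V) = (({x, y, z} : Finset V) : Set V) := by simp
  have hfin : FiniteDimensional F G := by
    rw [hG, e]
    exact FiniteDimensional.span_finset F _
  have h3 : Module.finrank F G ≤ 3 := by
    rw [hG, e]
    exact (finrank_span_finset_le_card _).trans Finset.card_le_three
  have hs : SpreadPencil (f₀.comp G.subtype) (f₁.comp G.subtype) := by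
    refine SpreadPencil.of_indep₄ h3 (indep₄_iff.1 hi) fun i => ?_
    obtain ⟨w, hw, h | h⟩ := hu (![u₁, u₂, u₃, u₄] i) (by fin_cases i <;> simp)
    · rw [h]
      exact Submodule.mem_sup_left ⟨⟨w, hw⟩, rfl⟩
    · rw [h]
      exact Submodule.mem_sup_right ⟨⟨w, hw⟩, rfl⟩
  obtain ⟨a, b, hab, h⟩ := hs.exists_member (X := fun w => X w)
    (fun y => (hX.left y).comp_linear G.subtype) (fun w => hX.right w) (fun w => hX.fst w)
    (fun w => hX.snd w) ht
  exact ⟨a, b, hab, fun w hw => h ⟨w, hw⟩⟩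

/-- Two members that describe a pencil map at a vector with independent values are the same. -/
theorem transfer {t : F × F} {a b a' b' : F} {v x : V} (hv : Indep₂ F (f₀ v) (f₁ v))
    (h : Proportional F (X v t) (a • f₀ v + b • f₁ v))
    (h' : Proportional F (X v t) (a' • f₀ v + b' • f₁ v))
    (hx : Proportional F (X x t) (a' • f₀ x + b' • f₁ x)) :
    Proportional F (X x t) (a • f₀ x + b • f₁ x) := by
  obtain ⟨c, hc, rfl, rfl⟩ := Proportional.eq_smul_of_indep hv (h'.symm.trans h)
  exact hx.trans ⟨c, hc, by module⟩

/-- The span of `w`, `w'` and an arbitrary `x` contains the four independent values. The members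
obtained in this way all agree at `w`, hence are the same. -/
theorem exists_member_of_skew (hX : PencilMap f₀ f₁ X) {w w' : V}
    (hi : Indep₄ F (f₀ w) (f₀ w') (f₁ w) (f₁ w')) {t : F × F} (ht : t ≠ 0) :
    ∃ a b : F, (a, b) ≠ 0 ∧ ∀ x, Proportional F (X x t) (a • f₀ x + b • f₁ x) := by
  have key := fun x => hX.exists_member_on_span w w' x hi (by
    have h1 : w ∈ Submodule.span F {w, w', x} := Submodule.subset_span (by simp)
    have h2 : w' ∈ Submodule.span F {w, w', x} := Submodule.subset_span (by simp)
    rintro u (rfl | rfl | rfl | rfl)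
    exacts [⟨w, h1, Or.inl rfl⟩, ⟨w', h2, Or.inl rfl⟩, ⟨w, h1, Or.inr rfl⟩,
      ⟨w', h2, Or.inr rfl⟩]) ht
  obtain ⟨a, b, hab, h⟩ := key w
  refine ⟨a, b, hab, fun x => ?_⟩
  obtain ⟨a', b', -, h'⟩ := key x
  have hv : Indep₂ F (f₀ w) (f₁ w) := fun s r e => by
    have := hi s 0 r 0 (by rw [← e]; module)
    exact ⟨this.1, this.2.2.1⟩
  exact transfer hv (h w (Submodule.subset_span (by simp))) (h' w (Submodule.subset_span (by simp)))
    (h' x (Submodule.subset_span (by simp)))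

/-- The member found on the span of `n₁`, `n₂`, `z` is carried to `x` through a span of `x`, one of
`n₁`, `n₂`, and one of `z`, `z + n₂`. This succeeds as soon as `f₀ x` or `f₁ x` completes three
known values to four independent ones. -/
theorem exists_member_of_axis (hX : PencilMap f₀ f₁ X) {n₁ n₂ z : V} {k : F}
    (hn₂ : f₀ n₂ = k • f₁ n₂)
    (hi : Indep₄ F (f₁ n₁) (f₁ n₂) (f₁ z) (f₀ z)) {t : F × F} (ht : t ≠ 0) :
    ∃ a b : F, (a, b) ≠ 0 ∧ ∀ x, Proportional F (X x t) (a • f₀ x + b • f₁ x) := by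
  obtain ⟨a, b, hab, h⟩ := hX.exists_member_on_span n₁ n₂ z hi (by
    have h1 : n₁ ∈ Submodule.span F {n₁, n₂, z} := Submodule.subset_span (by simp)
    have h2 : n₂ ∈ Submodule.span F {n₁, n₂, z} := Submodule.subset_span (by simp)
    have h3 : z ∈ Submodule.span F {n₁, n₂, z} := Submodule.subset_span (by simp)
    rintro u (rfl | rfl | rfl | rfl)
    exacts [⟨n₁, h1, Or.inr rfl⟩, ⟨n₂, h2, Or.inr rfl⟩, ⟨z, h3, Or.inr rfl⟩,
      ⟨z, h3, Or.inl rfl⟩]) ht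
  refine ⟨a, b, hab, ?_⟩
  -- The multiples of `c` are the intersection of the three spans tried below. Hence only those `x`
  -- escape whose two values are both multiples of `c`, and these form a proper subspace because it
  -- does not contain `z`.
  let c := f₀ z - k • f₁ z
  let S := (Submodule.span F {c}).comap f₀ ⊓ (Submodule.span F {c}).comap f₁
  have hS : S ≠ ⊤ := by
    intro hS
    have hz : f₁ z ∈ Submodule.span F {c} := (show z ∈ S from hS ▸ Submodule.mem_top).2
    obtain ⟨s, hs⟩ := Submodule.mem_span_singleton.1 hz
    have := hi 0 0 (1 + s * k) (-s) (by
      linear_combination (norm := (simp only [c]; module)) -hs)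
    have hs0 : s = 0 := neg_eq_zero.1 this.2.2.2
    simpa [hs0] using this.2.2.1
  refine (hX.left t).proportional_of_off_subspace (a • f₀ + b • f₁).isProjMap hS fun x hx => ?_
  have hz : Indep₂ F (f₀ z) (f₁ z) := fun s r e => by
    have := hi 0 0 r s (by rw [← e]; module)
    exact ⟨this.2.2.2, this.2.2.1⟩
  have hz' : Indep₂ F (f₀ (z + n₂)) (f₁ (z + n₂)) := fun s r e => by
    rw [map_add, map_add, hn₂] at e
    have := hi 0 (s * k + r) r s (by rw [← e]; module)
    exact ⟨this.2.2.2, this.2.2.1⟩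
  have step : ∀ n z', z' ∈ Submodule.span F {n₁, n₂, z} →
      Indep₂ F (f₀ z') (f₁ z') → Indep₃ F (f₁ n) (f₁ z') (f₀ z') → ∀ v, (v = f₀ x ∨ v = f₁ x) →
      v ∉ Submodule.span F {f₁ n, f₁ z', f₀ z'} →
      Proportional F (X x t) (a • f₀ x + b • f₁ x) := by
    intro n z' hz'm hz' hi' v hv hvn
    obtain ⟨a', b', -, h'⟩ := hX.exists_member_on_span n z' x (hi'.indep₄ hvn) (by
      have h1 : n ∈ Submodule.span F {n, z', x} := Submodule.subset_span (by simp)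
      have h2 : z' ∈ Submodule.span F {n, z', x} := Submodule.subset_span (by simp)
      have h3 : x ∈ Submodule.span F {n, z', x} := Submodule.subset_span (by simp)
      rintro u (rfl | rfl | rfl | rfl)
      exacts [⟨n, h1, Or.inr rfl⟩, ⟨z', h2, Or.inr rfl⟩, ⟨z', h2, Or.inl rfl⟩, ⟨x, h3, hv⟩]) ht
    exact transfer hz' (h z' hz'm) (h' z' (Submodule.subset_span (by simp)))
      (h' x (Submodule.subset_span (by simp)))
  obtain ⟨v, hv, hvc⟩ : ∃ v, (v = f₀ x ∨ v = f₁ x) ∧ v ∉ Submodule.span F {c} := by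
    by_contra! hcon
    exact hx ⟨hcon _ (Or.inl rfl), hcon _ (Or.inr rfl)⟩
  have hzm : z ∈ Submodule.span F {n₁, n₂, z} := Submodule.subset_span (by simp)
  by_cases h1 : v ∈ Submodule.span F {f₁ n₁, f₁ z, f₀ z}
  swap
  · refine step n₁ z hzm hz (fun q r s e => ?_) v hv h1
    have := hi q 0 r s (by rw [← e]; module)
    exact ⟨this.1, this.2.2⟩
  by_cases h2 : v ∈ Submodule.span F {f₁ n₂, f₁ z, f₀ z}
  swap
  · refine step n₂ z hzm hz (fun q r s e => ?_) v hv h2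
    have := hi 0 q r s (by rw [← e]; module)
    exact this.2
  by_cases h3 : v ∈ Submodule.span F {f₁ n₁, f₁ (z + n₂), f₀ (z + n₂)}
  swap
  · refine step n₁ (z + n₂)
      (Submodule.add_mem _ hzm (Submodule.subset_span (by simp))) hz' (fun q r s e => ?_) v hv h3
    rw [map_add, map_add, hn₂] at e
    have := hi q (r + s * k) r s (by rw [← e]; module)
    exact ⟨this.1, this.2.2⟩
  exfalso
  obtain ⟨q₁, r₁, s₁, e₁⟩ := Submodule.mem_span_triple.1 h1
  obtain ⟨q₂, r₂, s₂, e₂⟩ := Submodule.mem_span_triple.1 h2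
  obtain ⟨q₃, r₃, s₃, e₃⟩ := Submodule.mem_span_triple.1 h3
  rw [map_add, map_add, hn₂] at e₃
  have i₁ := hi q₁ (-q₂) (r₁ - r₂) (s₁ - s₂) (by linear_combination (norm := module) e₁ - e₂)
  have i₂ := hi (q₁ - q₃) (-(r₃ + s₃ * k)) (r₁ - r₃) (s₁ - s₃)
    (by linear_combination (norm := module) e₁ - e₃)
  refine hvc (Submodule.mem_span_singleton.2 ⟨s₁, ?_⟩)
  have hr : r₁ = -(s₁ * k) := by
    linear_combination i₂.2.2.1 - i₂.2.1 + k * i₂.2.2.2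
  rw [← e₁, i₁.1, hr]
  simp only [c]
  module

end PencilMap

end PencilExtension

/-! ### Triviality of the companion map -/

section Semilinear

variable {F V W : Type*} [Field F] [AddCommGroup V] [Module F V] [AddCommGroup W] [Module F W]

/-- Two injective maps of a plane, one linear and the other one semilinear, that together span more
than a plane, either map some line to skew lines, or agree on a line up to a factor. -/
theorem exists_skew_or_axis (hV : Module.finrank F V = 3) {f₀ : V →ₗ[F] W} {f₁ : V →+ W} {σ : F → F}
    (hσ : ∀ c v, f₁ (c • v) = σ c • f₁ v) (hf₁ : IsProjMap F f₁) (hk₀ : ∀ v, f₀ v = 0 → v = 0)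
    (hk₁ : ∀ v, f₁ v = 0 → v = 0) (hx : ∃ x, f₀ x ∉ Submodule.span F (Set.range f₁)) :
    (∃ w w', Indep₄ F (f₀ w) (f₀ w') (f₁ w) (f₁ w')) ∨
      ((∀ c, σ c = c) ∧ ∃ (n₁ n₂ z : V) (k : F), f₀ n₁ = k • f₁ n₁ ∧ f₀ n₂ = k • f₁ n₂ ∧
        Indep₄ F (f₁ n₁) (f₁ n₂) (f₁ z) (f₀ z)) := by
  have : FiniteDimensional F V := Module.finite_of_finrank_pos (by omega)
  set Y := Submodule.span F (Set.range f₁) with hY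
  have hfY : ∀ v, f₁ v ∈ Y := fun v => Submodule.subset_span ⟨v, rfl⟩
  -- The vectors that `f₀` maps into the span of the image of `f₁` lie in the kernel of `θ`. This
  -- kernel is a line of the plane, and any vector off it has an `f₀`-value outside that span.
  obtain ⟨θ, hθ, hθY⟩ := Submodule.exists_le_ker_of_lt_top (Y.comap f₀) (lt_top_iff_ne_top.2 (by
    obtain ⟨x, hx⟩ := hx
    intro h
    exact hx (show x ∈ Y.comap f₀ from h ▸ Submodule.mem_top)))
  replace hθY : ∀ u, f₀ u ∈ Y → θ u = 0 := fun u hu => hθY hu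
  obtain ⟨z, hz⟩ : ∃ z, θ z ≠ 0 := by
    by_contra! h
    exact hθ (LinearMap.ext h)
  have hker : Module.finrank F (LinearMap.ker θ) = 2 := by
    have h1 := LinearMap.finrank_range_add_finrank_ker θ
    have h2 : Module.finrank F (LinearMap.range θ) = 1 := by
      rw [LinearMap.range_eq_top.2 (θ.surjective hθ), finrank_top, Module.finrank_self]
    omega
  obtain ⟨n₁, n₂, hn, hkern⟩ := exists_basis_of_finrank_two hker
  have hθ₁ : θ n₁ = 0 := by
    have : n₁ ∈ LinearMap.ker θ := hkern ▸ Submodule.subset_span (by simp)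
    exact this
  have hθ₂ : θ n₂ = 0 := by
    have : n₂ ∈ LinearMap.ker θ := hkern ▸ Submodule.subset_span (by simp)
    exact this
  -- If the line joining `u` to `z` and the one joining `u` to `z + n` both fail to have skew
  -- images, then `f₀ u` lies in the span of `f₁ u`, `f₁ z` and in that of `f₁ u`, `f₁ (z + n)`.
  -- These meet in the multiples of `f₁ u` only.
  have skew : ∀ u n, Indep₂ F u n → θ u = 0 → θ n = 0 → (∀ c : F, f₀ u ≠ c • f₁ u) →
      ∃ w w', Indep₄ F (f₀ w) (f₀ w') (f₁ w) (f₁ w') := by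
    intro u n hun hu hn hne
    have hi : Indep₃ F (f₁ u) (f₁ n) (f₁ z) := by
      refine Indep₃.map_projMap hf₁ hk₁ (hun.indep₃ ?_)
      rintro s t rfl
      exact hz (by simp [hu, hn])
    have key : ∀ z', θ z' ≠ 0 → Indep₂ F (f₁ u) (f₁ z') →
        (∀ a b : F, f₀ u ≠ a • f₁ u + b • f₁ z') → Indep₄ F (f₀ u) (f₀ z') (f₁ u) (f₁ z') := by
      intro z' hz' hi' hne' q r s t e
      have hr : r = 0 := by
        have := hθY (q • u + r • z') (by
          have h1 : f₀ (q • u + r • z') = -(s • f₁ u + t • f₁ z') := by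
            rw [map_add, map_smul, map_smul]
            linear_combination (norm := module) e
          rw [h1]
          exact Y.neg_mem (Y.add_mem (Y.smul_mem _ (hfY _)) (Y.smul_mem _ (hfY _))))
        rw [map_add, map_smul, map_smul, hu, smul_zero, zero_add, smul_eq_mul] at this
        exact (mul_eq_zero.1 this).resolve_right hz'
      subst hr
      have hq : q = 0 := by
        by_contra hq
        refine hne' (-(q⁻¹ * s)) (-(q⁻¹ * t)) ?_
        have h1 : q⁻¹ • (q • f₀ u + (0 : F) • f₀ z' + s • f₁ u + t • f₁ z') = 0 := by
          rw [e, smul_zero]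
        simp only [smul_add, smul_smul, inv_mul_cancel₀ hq] at h1
        linear_combination (norm := module) h1
      subst hq
      have := hi' s t (by rw [← e]; module)
      exact ⟨rfl, rfl, this⟩
    by_cases h1 : ∀ a b : F, f₀ u ≠ a • f₁ u + b • f₁ z
    · exact ⟨u, z, key z hz (fun s t e => by
        have := hi s 0 t (by rw [← e]; module)
        exact ⟨this.1, this.2.2⟩) h1⟩
    by_cases h2 : ∀ a b : F, f₀ u ≠ a • f₁ u + b • f₁ (z + n)
    · exact ⟨u, z + n, key (z + n) (by rwa [map_add, hn, add_zero]) (fun s t e => by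
        rw [map_add] at e
        have := hi s t t (by rw [← e]; module)
        exact ⟨this.1, this.2.2⟩) h2⟩
    push Not at h1 h2
    obtain ⟨a, b, e₁⟩ := h1
    obtain ⟨a', b', e₂⟩ := h2
    rw [map_add] at e₂
    have := hi (a - a') (-b') (b - b') (by linear_combination (norm := module) e₂ - e₁)
    refine absurd ?_ (hne a')
    rw [e₂, neg_eq_zero.1 this.2.1, zero_smul, add_zero]
  by_cases h1 : ∀ c : F, f₀ n₁ ≠ c • f₁ n₁
  · exact Or.inl (skew n₁ n₂ hn hθ₁ hθ₂ h1)
  by_cases h2 : ∃ s : F, ∀ c : F, f₀ (s • n₁ + n₂) ≠ c • f₁ (s • n₁ + n₂)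
  · obtain ⟨s, hs⟩ := h2
    refine Or.inl (skew (s • n₁ + n₂) n₁ (fun a b e => ?_) (by simp [hθ₁, hθ₂]) hθ₁ hs)
    have := hn (a * s + b) a (by rw [← e]; module)
    exact ⟨this.2, by linear_combination this.1 - s * this.2⟩
  push Not at h1 h2
  obtain ⟨k₁, hk₁'⟩ := h1
  choose k hk using h2
  have hfn : Indep₂ F (f₁ n₁) (f₁ n₂) := hn.map_projMap hf₁ hk₁
  have h0 : f₀ n₂ = k 0 • f₁ n₂ := by simpa using hk 0
  -- Now `f₀` and `f₁` are proportional at each point of the line. Comparison at `c • n₁ + n₂`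
  -- relates the factors to `σ`, and `c = 1` shows that the factor is constant.
  have hrel : ∀ c, c * k₁ = k 0 * σ c := by
    intro c
    have e := hk c
    rw [map_add, map_add, map_smul, hσ, hk₁', h0] at e
    have := hfn (c * k₁ - k c * σ c) (k 0 - k c) (by linear_combination (norm := module) e)
    linear_combination this.1 - σ c * this.2
  have hσ1 : σ 1 = 1 := by
    have e := hσ 1 n₁
    rw [one_smul] at e
    have := hfn (σ 1 - 1) 0 (by linear_combination (norm := module) -e)
    exact sub_eq_zero.1 this.1
  have hk10 : k₁ = k 0 := by
    have := hrel 1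
    rwa [one_mul, hσ1, mul_one] at this
  have hk0 : k 0 ≠ 0 := fun h => hn.ne_zero_right (hk₀ _ (by rw [h0, h, zero_smul]))
  refine Or.inr ⟨fun c => ?_, n₁, n₂, z, k 0, by rw [hk₁', hk10], h0, ?_⟩
  · have := hrel c
    rw [hk10, mul_comm] at this
    exact (mul_left_cancel₀ hk0 this).symm
  · have hi : Indep₃ F (f₁ n₁) (f₁ n₂) (f₁ z) := by
      refine Indep₃.map_projMap hf₁ hk₁ (hn.indep₃ ?_)
      rintro s t rfl
      exact hz (by simp [hθ₁, hθ₂])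
    refine hi.indep₄ fun hmem => hz (hθY z (Submodule.span_mono ?_ hmem))
    rintro _ (rfl | rfl | rfl)
    exacts [⟨_, rfl⟩, ⟨_, rfl⟩, ⟨_, rfl⟩]

/-- In the presence of a line with skew images the companion automorphism is the identity. -/
theorem companion_eq_of_skew {f₀ : V →ₗ[F] W} {f₁ : V →+ W} {σ : F → F}
    (hσ : ∀ c v, f₁ (c • v) = σ c • f₁ v) {X : V → F × F → W}
    (hX₁ : ∀ y, IsProjMap F fun x => X x y) (hX₂ : ∀ x, IsProjMap F (X x))
    (h₀ : ∀ x, Proportional F (X x (1, 0)) (f₀ x)) (h₁ : ∀ x, Proportional F (X x (0, 1)) (f₁ x))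
    {x x' : V} (hi : Indep₄ F (f₀ x) (f₀ x') (f₁ x) (f₁ x')) (c : F) : σ c = c := by
  -- The slice at `(1, 1)` is a third transversal: both coefficients are non-zero because `(1, 1)`
  -- is proportional to neither basis vector.
  have key : ∀ v, Indep₂ F (f₀ v) (f₁ v) → ∃ a b : F, a ≠ 0 ∧ b ≠ 0 ∧
      X v (1, 1) = a • f₀ v + b • f₁ v := by
    intro v hv
    have hker : ∀ y, X v y = 0 → y = 0 := fun y hy =>
      (hX₂ v).kernel_eq_zero_of_indep (hv.congr (h₀ v) (h₁ v)) hy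
    have hne : ∀ y : F × F, y.1 = 0 ∨ y.2 = 0 → ¬ Proportional F (X v (1, 1)) (X v y) := by
      rintro y hy h
      obtain ⟨s, hs, e⟩ := (hX₂ v).exists_kernel _ _ h
      have e := hker _ e
      rcases hy with hy | hy
      · simpa [hy] using congrArg Prod.fst e
      · simpa [hy] using congrArg Prod.snd e
    obtain ⟨a, b, e⟩ := (hX₂ v).map_add (1, 0) (0, 1)
    rw [show ((1, 0) : F × F) + (0, 1) = (1, 1) by simp] at e
    obtain ⟨d, hd, e₁⟩ := h₀ v
    obtain ⟨d', hd', e₂⟩ := h₁ v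
    have hX0 : X v (1, 1) ≠ 0 := fun h => by simpa using hker _ h
    refine ⟨a * d, b * d', mul_ne_zero ?_ hd, mul_ne_zero ?_ hd', by rw [e, e₁, e₂]; module⟩
    · rintro rfl
      rw [zero_smul, zero_add] at e
      refine hne (0, 1) (Or.inl rfl) ⟨b, ?_, e⟩
      rintro rfl
      exact hX0 (by rw [e, zero_smul])
    · rintro rfl
      rw [zero_smul, add_zero] at e
      refine hne (1, 0) (Or.inr rfl) ⟨a, ?_, e⟩
      rintro rfl
      exact hX0 (by rw [e, zero_smul])
  obtain ⟨a, b, ha, hb, e⟩ := key x fun s t e => by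
    have := hi s 0 t 0 (by rw [← e]; module)
    exact ⟨this.1, this.2.2.1⟩
  obtain ⟨a', b', ha', hb', e'⟩ := key x' fun s t e => by
    have := hi 0 s 0 t (by rw [← e]; module)
    exact ⟨this.2.1, this.2.2.2⟩
  -- The value at `c • x + x'` is expressed once through `f₀` and `f₁` at this vector and once
  -- through the values at `x` and `x'`. For `c = 1` this equates the ratios `a : b` and `a' : b'`;
  -- for general `c` it then yields `σ c = c`.
  have comb : ∀ c : F, ∃ s s' a₂ b₂ : F, a₂ ≠ 0 ∧ s * a = a₂ * c ∧ s' * a' = a₂ ∧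
      s * b = b₂ * σ c ∧ s' * b' = b₂ := by
    intro c
    obtain ⟨a₂, b₂, ha₂, -, e₂⟩ := key (c • x + x') fun s t e => by
      rw [map_add, map_add, map_smul, hσ] at e
      have := hi (s * c) s (t * σ c) t (by rw [← e]; module)
      exact ⟨this.2.1, this.2.2.2⟩
    obtain ⟨s, s', e₃⟩ := (hX₁ (1, 1)).map_add (c • x) x'
    obtain ⟨r, hr⟩ : ∃ r : F, X (c • x) (1, 1) = r • X x (1, 1) := by
      by_cases hc : c = 0
      · refine ⟨0, ?_⟩
        rw [hc, zero_smul, zero_smul]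
        exact (hX₁ (1, 1)).map_zero
      · exact ((hX₁ (1, 1)).map_smul c x hc).imp fun _ h => h.2
    rw [e₂, hr, e, e', map_add, map_add, map_smul, hσ] at e₃
    have := hi (s * r * a - a₂ * c) (s' * a' - a₂) (s * r * b - b₂ * σ c) (s' * b' - b₂)
      (by linear_combination (norm := module) -e₃)
    exact ⟨s * r, s', a₂, b₂, ha₂, sub_eq_zero.1 this.1, sub_eq_zero.1 this.2.1,
      sub_eq_zero.1 this.2.2.1, sub_eq_zero.1 this.2.2.2⟩
  have hσ1 : σ 1 = 1 := by
    have e := hσ 1 x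
    rw [one_smul] at e
    have := hi 0 0 (σ 1 - 1) 0 (by linear_combination (norm := module) -e)
    exact sub_eq_zero.1 this.2.2.1
  obtain ⟨s, s', a₂, b₂, ha₂, i₁, i₂, i₃, i₄⟩ := comb 1
  rw [mul_one] at i₁
  rw [hσ1, mul_one] at i₃
  have hs : s ≠ 0 := by rintro rfl; exact ha₂ (by rw [← i₁, zero_mul])
  have hs' : s' ≠ 0 := by rintro rfl; exact ha₂ (by rw [← i₂, zero_mul])
  have hab : a * b' = a' * b := by
    refine mul_left_cancel₀ (mul_ne_zero hs hs') ?_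
    linear_combination s' * b' * i₁ + a₂ * i₄ - s * b * i₂ - a₂ * i₃
  obtain ⟨t, t', a₃, b₃, ha₃, j₁, j₂, j₃, j₄⟩ := comb c
  have ht' : t' ≠ 0 := by rintro rfl; exact ha₃ (by rw [← j₂, zero_mul])
  refine mul_left_cancel₀ (mul_ne_zero ht' (mul_ne_zero ha' hb')) ?_
  linear_combination -a' * j₃ + b' * j₁ - t * hab + (a' * σ c) * j₄ - b' * c * j₂

/-- A map on `V × F²` that is a linear mapping in each variable, and whose restriction to the basis
of `F²` maps a plane to two planes that span more than a plane, is a pencil map. -/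
theorem exists_pencilMap {f₀ : V →ₗ[F] W} {X : V → F × F → W}
    (hX₁ : ∀ y, IsProjMap F fun x => X x y) (hX₂ : ∀ x, IsProjMap F (X x))
    (h₀ : ∀ x, Proportional F (X x (1, 0)) (f₀ x)) {E : Submodule F V}
    (hE : Module.finrank F E = 3) (hE₀ : ∀ w ∈ E, X w (1, 0) = 0 → w = 0)
    (hE₁ : ∀ w ∈ E, X w (0, 1) = 0 → w = 0)
    (hspan : 3 < Module.finrank F (Submodule.span F
      {u | ∃ w ∈ E, u = X w (1, 0) ∨ u = X w (0, 1)})) :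
    ∃ f₁ : V →ₗ[F] W, PencilMap f₀ f₁ X ∧ ∀ t : F × F, t ≠ 0 →
      ∃ a b : F, (a, b) ≠ 0 ∧ ∀ x, Proportional F (X x t) (a • f₀ x + b • f₁ x) := by
  have : FiniteDimensional F E := Module.finite_of_finrank_pos (by omega)
  let e := Module.finBasisOfFinrankEq F E hE
  have hi : ∀ r s t : F, r • (e 0 : V) + s • (e 1 : V) + t • (e 2 : V) = 0 →
      r = 0 ∧ s = 0 ∧ t = 0 := by
    intro r s t h
    have := Fintype.linearIndependent_iff.1 e.linearIndependent ![r, s, t] (by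
      ext
      simpa [Fin.sum_univ_three] using h)
    exact ⟨this 0, this 1, this 2⟩
  obtain ⟨f₁, σ, hσ, hf₁⟩ := exists_semilinear_lift_of_indep (hX₁ (0, 1)) (x := e 0) (y := e 1)
    (z := e 2) fun r s t h => hi r s t (hE₁ _ (E.add_mem (E.add_mem (E.smul_mem _ (e 0).2)
      (E.smul_mem _ (e 1).2)) (E.smul_mem _ (e 2).2)) h)
  have h₁ : ∀ x, Proportional F (X x (0, 1)) (f₁ x) := fun x => (hf₁ x).symm
  have hf₁E : IsProjMap F (f₁.comp E.subtype.toAddMonoidHom) :=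
    ((hX₁ (0, 1)).congr hf₁).comp_linear E.subtype
  -- Otherwise all values on `E` would lie in the span of the three vectors `f₁ (e i)`, contrary to
  -- the dimension hypothesis.
  have hout : ∃ x : E, (f₀.comp E.subtype) x ∉
      Submodule.span F (Set.range (f₁.comp E.subtype.toAddMonoidHom)) := by
    by_contra! hcon
    have h1 : Submodule.span F {u | ∃ w ∈ E, u = X w (1, 0) ∨ u = X w (0, 1)} ≤
        Submodule.span F (Set.range fun i => f₁ (e i)) := by
      have h2 : ∀ w : E, f₁ w ∈ Submodule.span F (Set.range fun i => f₁ (e i)) := by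
        intro w
        have hw := e.sum_repr w
        rw [← hw]
        simp only [Submodule.coe_sum, Submodule.coe_smul, map_sum, hσ]
        exact Submodule.sum_mem _ fun i _ => Submodule.smul_mem _ _ (Submodule.subset_span ⟨i, rfl⟩)
      rw [Submodule.span_le]
      rintro u ⟨w, hw, rfl | rfl⟩
      · obtain ⟨c, -, hc⟩ := h₀ w
        rw [hc]
        refine Submodule.smul_mem _ _ (Submodule.span_le.2 ?_ (hcon ⟨w, hw⟩))
        rintro _ ⟨w, rfl⟩
        exact h2 w
      · obtain ⟨c, -, hc⟩ := h₁ w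
        rw [hc]
        exact Submodule.smul_mem _ _ (h2 ⟨w, hw⟩)
    have : FiniteDimensional F (Submodule.span F (Set.range fun i => f₁ (e i))) :=
      FiniteDimensional.span_of_finite F (Set.finite_range _)
    have h3 := Submodule.finrank_mono h1
    have h4 := finrank_range_le_card (R := F) (fun i => f₁ (e i))
    rw [Fintype.card_fin] at h4
    exact absurd (hspan.trans_le (h3.trans h4)) (lt_irrefl _)
  have hdich := exists_skew_or_axis hE (f₀ := f₀.comp E.subtype)
    (f₁ := f₁.comp E.subtype.toAddMonoidHom) (σ := σ) (fun c v => hσ c v) hf₁E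
    (fun v hv => Subtype.ext (hE₀ v v.2 ((h₀ v).eq_zero_iff.2 hv)))
    (fun v hv => Subtype.ext (hE₁ v v.2 ((h₁ v).eq_zero_iff.2 hv))) hout
  have hσid : ∀ c, σ c = c := by
    rcases hdich with ⟨w, w', h⟩ | ⟨h, -⟩
    · exact companion_eq_of_skew hσ hX₁ hX₂ h₀ h₁ h
    · exact h
  let f₁' : V →ₗ[F] W := 
    { toFun := f₁
      map_add' := f₁.map_add
      map_smul' := fun c v => by
        rw [hσ, hσid]
        rfl }
  have hX : PencilMap f₀ f₁' X := ⟨hX₁, hX₂, h₀, h₁⟩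
  refine ⟨f₁', hX, fun t ht => ?_⟩
  rcases hdich with ⟨w, w', h⟩ | ⟨-, n₁, n₂, z, k, -, hn₂, h⟩
  · exact hX.exists_member_of_skew h ht
  · exact hX.exists_member_of_axis hn₂ h ht

end Semilinear

/-! ### Agreement of linear mappings on lines through a point -/

section Agreement

variable {F V W : Type*} [Field F] [AddCommGroup V] [Module F V] [AddCommGroup W] [Module F W]

/-- A linear mapping that agrees with a linear map on a subspace `U` and on a line that meets `U`
in a point outside the kernel, agrees with it on the span. -/
theorem IsProjMap.proportional_add_of_line {q : V → W} (hq : IsProjMap F q) (p : V →ₗ[F] W)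
    {U : Submodule F V} (hU : ∀ y ∈ U, Proportional F (q y) (p y)) {e u : V} (he : e ∈ U)
    (hpe : p e ≠ 0) (hu : ∀ s t : F, Proportional F (q (s • e + t • u)) (p (s • e + t • u)))
    {y : V} (hy : y ∈ U) : Proportional F (q (y + u)) (p (y + u)) := by
  -- In this case `y - s • e` lies in both kernels, so `y + u` may be replaced by a vector on the
  -- line of `e` and `u`. The case after it similarly moves `y + u` into `U`.
  by_cases h1 : ∃ s : F, p y = s • p e
  · obtain ⟨s, hs⟩ := h1
    have h0 : p (y - s • e) = 0 := by rw [_root_.map_sub, _root_.map_smul, hs, sub_self]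
    have h2 := hq.proportional_of_add_kernel (w := s • e + (1 : F) • u)
      ((hU _ (U.sub_mem hy (U.smul_mem s he))).eq_zero_iff.2 h0)
    have h3 := h2.trans (hu s 1)
    have e1 : y - s • e + (s • e + (1 : F) • u) = y + u := by module
    rwa [e1, ← zero_add (p _), ← h0, ← _root_.map_add, e1] at h3
  by_cases h2 : ∃ s : F, p u = s • p e
  · obtain ⟨s, hs⟩ := h2
    have h0 : p ((-s) • e + (1 : F) • u) = 0 := by
      rw [_root_.map_add, _root_.map_smul, _root_.map_smul, hs]
      module
    have h2 := hq.proportional_of_add_kernel (w := y + s • e) ((hu (-s) 1).eq_zero_iff.2 h0)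
    have h3 := h2.trans (hU _ (U.add_mem hy (U.smul_mem s he)))
    have e1 : (-s) • e + (1 : F) • u + (y + s • e) = y + u := by module
    rwa [e1, ← zero_add (p (y + s • e)), ← h0, ← _root_.map_add, e1] at h3
  push Not at h1 h2
  have hpu : Indep₂ F (p e) (p u) := indep₂_of_not_mem hpe h2
  have hqu : Proportional F (q u) (p u) := by simpa using hu 0 1
  have hque : Proportional F (q (u + e)) (p (u + e)) := by
    have := hu 1 1
    rwa [one_smul, one_smul, add_comm] at this
  by_cases h3 : ∃ a b : F, p u = a • p y + b • p e
  · obtain ⟨a, b, hab⟩ := h3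
    suffices hk : q (u - (a • y + b • e)) = 0 by
      have h0 : p (u - (a • y + b • e)) = 0 := by
        simp only [_root_.map_sub, _root_.map_add, _root_.map_smul, hab, sub_self]
      have h4 := (hq.proportional_of_add_kernel (w := (1 + a) • y + b • e) hk).trans
        (hU _ (U.add_mem (U.smul_mem _ hy) (U.smul_mem _ he)))
      have e1 : u - (a • y + b • e) + ((1 + a) • y + b • e) = y + u := by module
      rwa [e1, ← zero_add (p _), ← h0, ← _root_.map_add, e1] at h4
    have hm : ∀ b, a • y + b • e ∈ U := fun b => U.add_mem (U.smul_mem _ hy) (U.smul_mem _ he)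
    obtain ⟨c, hc, e₁⟩ := hq.exists_kernel u (a • y + b • e) (hqu.trans (by
      have := (hU _ (hm b)).symm
      rwa [_root_.map_add, _root_.map_smul, _root_.map_smul, ← hab] at this))
    obtain ⟨c', hc', e₂⟩ := hq.exists_kernel (u + e) (a • y + (b + 1) • e) (hque.trans (by
      have := (hU _ (hm (b + 1))).symm
      rwa [_root_.map_add, _root_.map_smul, _root_.map_smul, add_smul, one_smul, ← add_assoc,
        ← hab, ← _root_.map_add] at this))
    by_cases hc1 : c = -1
    · rw [← e₁, hc1]
      congr 1
      module
    by_cases hc2 : c' = -1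
    · rw [← e₂, hc2]
      congr 1
      module
    -- If neither factor is `-1`, eliminating `y` from the two kernel vectors leaves one on the line
    -- of `e` and `u`, where `q` agrees with `p`, which is injective there.
    have e₃ : q ((-(c * (1 + c'))) • e + (c' - c) • u) = 0 := by
      have h5 := hq.kernel.sub_mem (hq.kernel.smul_mem c' (show _ ∈ hq.kernel from e₁))
        (hq.kernel.smul_mem c (show _ ∈ hq.kernel from e₂))
      rw [← hq.mem_kernel]
      convert h5 using 1
      module
    rw [(hu _ _).eq_zero_iff, _root_.map_add, _root_.map_smul, _root_.map_smul] at e₃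
    refine absurd (neg_eq_zero.1 (hpu _ _ e₃).1) (mul_ne_zero hc fun h => hc2 ?_)
    linear_combination h
  · push Not at h3
    have hi : Indep₃ F (p y) (p e) (p u) := by
      have h4 : Indep₂ F (p e) (p y) := indep₂_of_not_mem hpe h1
      exact h4.symm.indep₃ h3
    obtain ⟨d, hd, i₁⟩ := hU y hy
    obtain ⟨d', hd', i₂⟩ := hqu
    obtain ⟨d₁, hd₁, j₁⟩ := hU _ (U.sub_mem hy he)
    obtain ⟨d₂, hd₂, j₂⟩ := hque
    -- Generic case: `y + u = (y - e) + (u + e)` places the value on two lines along which the end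
    -- points are known, and independence fixes it as their intersection.
    obtain ⟨a, b, k₁⟩ := hq.map_add y u
    obtain ⟨a', b', k₂⟩ := hq.map_add (y - e) (u + e)
    rw [show y - e + (u + e) = y + u by module, j₁, j₂, _root_.map_sub, _root_.map_add] at k₂
    rw [i₁, i₂] at k₁
    have h5 := hi (a * d - a' * d₁) (a' * d₁ - b' * d₂) (b * d' - b' * d₂)
      (by linear_combination (norm := module) k₂ - k₁)
    have h6 : q (y + u) = (a * d) • p (y + u) := by
      rw [k₁, _root_.map_add, show a * d = b * d' by linear_combination h5.1 + h5.2.1 - h5.2.2]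
      rw [show a • d • p y = (a * d) • p y by module,
        show a * d = b * d' by linear_combination h5.1 + h5.2.1 - h5.2.2]
      module
    refine ⟨a * d, fun h0 => ?_, h6⟩
    rw [h0, zero_smul] at h6
    have h7 := hq.proportional_of_add_kernel h6 (w := (-1 : F) • u)
    rw [show y + u + (-1 : F) • u = y by module] at h7
    obtain ⟨c, -, h8⟩ := (hU y hy).symm.trans (h7.trans
      ((hq.map_smul (-1) u (neg_ne_zero.2 one_ne_zero)).trans ⟨d', hd', i₂⟩))
    exact h3 c⁻¹ 0 (by
      by_cases hc : c = 0
      · exact absurd (by rw [h8, hc, zero_smul, zero_smul]) (h1 0)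
      · rw [h8, smul_smul, inv_mul_cancel₀ hc]; module)

/-- A linear mapping that agrees with a linear map on the lines that join the first point of a basis
to the other ones, agrees with it everywhere, provided the first point is not in the kernel. -/
theorem IsProjMap.proportional_of_basis {q : V → W} (hq : IsProjMap F q) (p : V →ₗ[F] W)
    {ι : Type*} [Fintype ι] (b : Module.Basis ι F V) (o : ι) (ho : p (b o) ≠ 0)
    (h : ∀ i (s t : F), Proportional F (q (s • b o + t • b i)) (p (s • b o + t • b i))) (y : V) :
    Proportional F (q y) (p y) := by
  classical
  have key : ∀ S : Finset ι, ∀ y ∈ Submodule.span F (insert (b o) (b '' S)),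
      Proportional F (q y) (p y) := by
    intro S
    induction S using Finset.induction_on with
    | empty =>
      intro y hy
      rw [Finset.coe_empty, Set.image_empty, insert_empty_eq, Submodule.mem_span_singleton] at hy
      obtain ⟨s, rfl⟩ := hy
      simpa using h o s 0
    | insert i S _ ih =>
      intro y hy
      rw [Finset.coe_insert, Set.image_insert_eq, Set.insert_comm, Submodule.mem_span_insert] at hy
      obtain ⟨t, y, hy, rfl⟩ := hy
      by_cases ht : t = 0
      · rw [ht, zero_smul, zero_add]
        exact ih y hy
      · rw [add_comm]
        refine hq.proportional_add_of_line p ih (Submodule.subset_span (Set.mem_insert _ _)) ho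
          (fun s r => ?_) hy
        rw [smul_smul]
        exact h i s _
  refine key Finset.univ y ?_
  have := Submodule.span_mono (R := F) (Set.subset_insert (b o) (Set.range b))
  rw [b.span_eq] at this
  rw [Finset.coe_univ, Set.image_univ]
  exact this Submodule.mem_top

end Agreement

/-! ### Closures and dimension in terms of vectors -/

section Closure

namespace PointLineGeometry

variable {P : Type*} {G : PointLineGeometry P}

theorem subset_closure (s : Set P) : s ⊆ G.closure s := fun _ hx _ ht => ht.2 hx

theorem isSubspace_closure (s : Set P) : G.IsSubspace (G.closure s) :=
  fun g hg x hx y hy hxy _ hz t ht =>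
    ht.1 g hg x ⟨hx.1 t ht, hx.2⟩ y ⟨hy.1 t ht, hy.2⟩ hxy hz

theorem closure_minimal {s t : Set P} (ht : G.IsSubspace t) (h : s ⊆ t) : G.closure s ⊆ t :=
  fun _ hx => hx t ⟨ht, h⟩

end PointLineGeometry

end Closure

section Lift

variable {F V W Q : Type*} [Field F] [AddCommGroup V] [Module F V] [AddCommGroup W] [Module F W]
  {G : PointLineGeometry Q}

namespace IsVecLinear

/-- The vectors without image form a subspace. -/
def kernel {q : V → Option Q} (hq : IsVecLinear F G q) : Submodule F V where
  carrier := {v | q v = none}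
  zero_mem' := hq.map_zero
  add_mem' {v w} hv hw := (hq.map_add_of_none v w hv).trans hw
  smul_mem' c v hv := by
    by_cases hc : c = 0
    · simpa [hc] using hq.map_zero
    · exact (hq.map_smul c v hc).trans hv

theorem comb_mem (hG : G.IsProjective) {q : V → Option Q} (hq : IsVecLinear F G q) {v w : V}
    {t : Set Q} (ht : G.IsSubspace t) (hv : ∀ p, q v = some p → p ∈ t)
    (hw : ∀ p, q w = some p → p ∈ t) (p : Q) (hp : q (v + w) = some p) : p ∈ t := by
  rcases hv' : q v with _ | a
  · exact hw p (by rw [← hq.map_add_of_none v w hv', hp])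
  rcases hw' : q w with _ | b
  · exact hv p (by rw [← hq.map_add_of_none w v hw', add_comm, hp])
  by_cases hab : a = b
  · subst hab
    obtain ⟨c, hc, e⟩ := hq.exists_none v w (hv'.trans hw'.symm)
    have h1 := hq.map_add_of_none _ ((1 - c) • w) e
    rw [show v + c • w + (1 - c) • w = v + w by module, hp] at h1
    by_cases hc1 : 1 - c = 0
    · rw [hc1, zero_smul, hq.map_zero] at h1
      simp at h1
    · rw [hq.map_smul _ _ hc1] at h1
      exact hw p h1.symm
  · obtain ⟨g, hg, ha, hb⟩ := hG.exists_line a b hab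
    refine ht g hg a ⟨hv a hv', ha⟩ b ⟨hw b hw', hb⟩ hab ?_
    exact (hq.mem_line v w a b hv' hw' hab g hg ha hb p).2 ⟨1, 1, by simpa using hp⟩

/-- The value at a combination lies on the join of the values, so a subspace that contains the
values on a generating set contains all values on its span. -/
theorem mem_of_mem_span (hG : G.IsProjective) {q : V → Option Q} (hq : IsVecLinear F G q)
    {s : Set V} {t : Set Q} (ht : G.IsSubspace t) (hs : ∀ v ∈ s, ∀ p, q v = some p → p ∈ t)
    {v : V} (hv : v ∈ Submodule.span F s) {p : Q} (hp : q v = some p) : p ∈ t := by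
  induction hv using Submodule.span_induction generalizing p with
  | mem v hv => exact hs v hv p hp
  | zero => simp [hq.map_zero] at hp
  | add v w _ _ ihv ihw => exact hq.comb_mem hG ht (fun p h => ihv h) (fun p h => ihw h) p hp
  | smul c v _ ih =>
    by_cases hc : c = 0
    · simp [hc, hq.map_zero] at hp
    · exact ih (by rwa [hq.map_smul c v hc] at hp)

theorem isSubspace_range {q : V → Option Q} (hq : IsVecLinear F G q) :
    G.IsSubspace {p | ∃ v, q v = some p} := by
  rintro g hg a ⟨⟨v, hv⟩, ha⟩ b ⟨⟨w, hw⟩, hb⟩ hab p hp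
  obtain ⟨s, t, e⟩ := (hq.mem_line v w a b hv hw hab g hg ha hb p).1 hp
  exact ⟨_, e⟩

/-- If the values on a spanning set lift to coordinates, then all values lift. -/
theorem exists_lift (hG : G.IsProjective) {q : V → Option Q} (hq : IsVecLinear F G q)
    {ψ : W → Option Q} (hψ : IsVecLinear F G ψ) {s : Set V} (hs : ∀ v ∈ s, ∃ u, ψ u = q v) {v : V}
    (hv : v ∈ Submodule.span F s) : ∃ u, ψ u = q v := by
  rcases h : q v with _ | p
  · exact ⟨0, hψ.map_zero⟩
  · exact hq.mem_of_mem_span hG (hψ.isSubspace_range) (fun v hv p hp => by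
      obtain ⟨u, hu⟩ := hs v hv
      exact ⟨u, hu.trans hp⟩) hv h

/-- A maximal independent subset of `S` has values that generate the same closure. This turns the
geometric hypotheses on dimension into lower bounds for ranks. -/
theorem dimSucc_le (hG : G.IsProjective) [FiniteDimensional F V] {ψ : V → Option Q}
    (hψ : IsVecLinear F G ψ) (S : Set V) :
    G.dimSucc {p | ∃ v ∈ S, ψ v = some p} ≤ Module.finrank F (Submodule.span F S) := by
  obtain ⟨b, hbS, hspan, hb⟩ := exists_linearIndependent F S
  have hcl : G.closure {p | ∃ v ∈ b, ψ v = some p} = G.closure {p | ∃ v ∈ S, ψ v = some p} := by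
    refine Set.Subset.antisymm (G.closure_minimal (G.isSubspace_closure _) ?_)
      (G.closure_minimal (G.isSubspace_closure _) ?_)
    · rintro p ⟨v, hv, hp⟩
      exact G.subset_closure _ ⟨v, hbS hv, hp⟩
    · rintro p ⟨v, hv, hp⟩
      exact hψ.mem_of_mem_span hG (G.isSubspace_closure _)
        (fun w hw p hp => G.subset_closure {p | ∃ v ∈ b, ψ v = some p} ⟨w, hw, hp⟩)
        (show v ∈ Submodule.span F b by rw [hspan]; exact Submodule.subset_span hv) hp
  refine (iInf₂_le {p | ∃ v ∈ b, ψ v = some p} hcl).trans ?_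
  have hfin : b.Finite := hb.setFinite
  have h1 : (some '' {p | ∃ v ∈ b, ψ v = some p}).encard ≤ b.encard := by
    refine (Set.encard_le_encard ?_).trans (Set.encard_image_le ψ b)
    rintro _ ⟨p, ⟨v, hv, hp⟩, rfl⟩
    exact ⟨v, hv, hp⟩
  rw [(Option.some_injective Q).encard_image] at h1
  refine h1.trans (le_of_eq ?_)
  have := hfin.fintype
  rw [← hspan, finrank_span_set_eq_card hb, ← Set.encard_coe_eq_coe_finsetCard, Set.coe_toFinset]

end IsVecLinear

theorem isSubspace_pgPoints (W : Submodule F V) : (projectiveGeometry F V).IsSubspace (pgPoints W) := by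
  rintro g ⟨U, hU, rfl⟩ x ⟨hx, hx'⟩ y ⟨hy, hy'⟩ hxy p hp
  rw [eq_span_pair hU (indep₂_rep hxy) (rep_mem.2 hx') (rep_mem.2 hy')] at hp
  refine le_trans (show p.submodule ≤ _ from hp) (Submodule.span_le.2 ?_)
  rintro _ (rfl | rfl)
  exacts [rep_mem.2 hx, rep_mem.2 hy]

/-- The dimension of a set of points bounds the number of independent vectors representing them. -/
theorem card_le_dimSucc {ι : Type*} [Fintype ι] {v : ι → V} (hv : LinearIndependent F v)
    {T : Set (ℙ F V)} (hT : ∀ i, ∃ p ∈ T, toPoint F (v i) = some p) :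
    (Fintype.card ι : ℕ∞) ≤ (projectiveGeometry F V).dimSucc T := by
  refine le_iInf₂ fun t ht => ?_
  by_cases hfin : t.Finite
  swap
  · rw [Set.Infinite.encard_eq hfin]
    exact le_top
  -- Any generating set `t` of the closure spans a linear subspace whose points contain `T`, hence
  -- one that contains all the vectors `v i`.
  set W := Submodule.span F (Projectivization.rep '' t) with hW
  have hTW : T ⊆ pgPoints W := by
    refine ((projectiveGeometry F V).subset_closure T).trans ?_
    rw [← ht]
    refine PointLineGeometry.closure_minimal (isSubspace_pgPoints W) fun p hp => ?_
    exact rep_mem.1 (Submodule.subset_span ⟨p, hp, rfl⟩)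
  have hvW : Submodule.span F (Set.range v) ≤ W := by
    rw [Submodule.span_le]
    rintro _ ⟨i, rfl⟩
    obtain ⟨p, hp, e⟩ := hT i
    exact (mem_pgPoints_of_toPoint e W).1 (hTW hp)
  have hfin' : (Projectivization.rep '' t).Finite := hfin.image _
  have : FiniteDimensional F W := FiniteDimensional.span_of_finite F hfin'
  have h1 := Submodule.finrank_mono hvW
  rw [finrank_span_eq_card hv] at h1
  have h2 := hfin'.fintype
  have h3 : Module.finrank F W ≤ _ := finrank_span_le_card (R := F) (Projectivization.rep '' t)
  calc (Fintype.card ι : ℕ∞) ≤ (Set.toFinset (Projectivization.rep '' t)).card :=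
        Nat.cast_le.2 (h1.trans h3)
    _ = (Projectivization.rep '' t).encard := by
        rw [← Set.encard_coe_eq_coe_finsetCard, Set.coe_toFinset]
    _ ≤ t.encard := Set.encard_image_le _ _

end Lift

/-! ### Collineations induced by maps of vectors -/

section Collineation

variable {F V : Type*} [Field F] [AddCommGroup V] [Module F V]

theorem image_line_of_isVecLinear {α : ℙ F V → ℙ F V} {g : V → V}
    (hg : IsVecLinear F (projectiveGeometry F V) fun v => toPoint F (g v)) (hk : ∀ v, g v = 0 → v = 0)
    (hα : ∀ v, toPoint F (g v) = (toPoint F v).map α) {l : Set (ℙ F V)}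
    (hl : l ∈ (projectiveGeometry F V).lines) : α '' l ∈ (projectiveGeometry F V).lines := by
  obtain ⟨U, hU, rfl⟩ := hl
  obtain ⟨v, w, hvw, rfl⟩ := exists_basis_of_finrank_two hU
  have hp : ∀ p : ℙ F V, p ∈ pgPoints (Submodule.span F {v, w}) ↔
      ∃ s t : F, toPoint F (s • v + t • w) = some p := fun p => by
    constructor
    · intro h
      obtain ⟨s, t, e⟩ := Submodule.mem_span_pair.1 (rep_mem.2 h)
      exact ⟨s, t, by rw [e, toPoint_rep]⟩
    · rintro ⟨s, t, e⟩
      exact (mem_pgPoints_of_toPoint e _).2 (Submodule.mem_span_pair.2 ⟨s, t, rfl⟩)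
  have hgv : g v ≠ 0 := fun h => hvw.ne_zero_left (hk _ h)
  have hgw : g w ≠ 0 := fun h => hvw.ne_zero_right (hk _ h)
  have hi : Indep₂ F (g v) (g w) := indep₂_of_not_proportional hgv hgw fun h => by
    rw [← toPoint_eq_toPoint hgv] at h
    obtain ⟨c, -, e⟩ := hg.exists_none v w h
    have := hk _ (toPoint_eq_none.1 e)
    exact one_ne_zero (hvw 1 c (by rwa [one_smul])).1
  have hne : Projectivization.mk F _ hgv ≠ Projectivization.mk F _ hgw := fun h => by
    rw [← Option.some_inj, ← toPoint_of_ne, ← toPoint_of_ne, toPoint_eq_toPoint hgv] at h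
    exact hi.not_proportional h
  refine ⟨Submodule.span F {g v, g w}, finrank_span_pair hi, Set.ext fun p => ?_⟩
  rw [hg.mem_line v w _ _ (toPoint_of_ne hgv) (toPoint_of_ne hgw) hne _
    ⟨_, finrank_span_pair hi, rfl⟩
    ((mem_pgPoints_of_toPoint (toPoint_of_ne hgv) _).2 (Submodule.subset_span (by simp)))
    ((mem_pgPoints_of_toPoint (toPoint_of_ne hgw) _).2 (Submodule.subset_span (by simp)))]
  constructor
  · rintro ⟨x, hx, rfl⟩
    obtain ⟨s, t, e⟩ := (hp x).1 hx
    exact ⟨s, t, by rw [hα, e, Option.map_some]⟩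
  · rintro ⟨s, t, e⟩
    rw [hα, Option.map_eq_some_iff] at e
    obtain ⟨x, hx, rfl⟩ := e
    exact ⟨x, (hp x).2 ⟨s, t, hx⟩, rfl⟩

/-- Two mutually inverse maps of vectors that are linear mappings induce a collineation. -/
theorem exists_collineation {g h : V → V} (hg : IsProjMap F g) (hh : IsProjMap F h)
    (hgh : ∀ v, Proportional F (g (h v)) v) (hhg : ∀ v, Proportional F (h (g v)) v) :
    ∃ α : Equiv.Perm (ℙ F V), (projectiveGeometry F V).IsCollineation α ∧
      ∀ v, toPoint F (g v) = (toPoint F v).map α := by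
  have ker : ∀ {g h : V → V}, IsProjMap F h → (∀ v, Proportional F (h (g v)) v) →
      ∀ v, g v = 0 → v = 0 := fun {g h} hh hhg v hv => by
    have := hhg v
    rw [hv, hh.map_zero] at this
    exact this.symm.eq_zero
  have hgk := ker hh hhg
  have hhk := ker hg hgh
  have vl : ∀ {g : V → V}, IsProjMap F g →
      IsVecLinear F (projectiveGeometry F V) fun v => toPoint F (g v) := fun hg =>
    isVecLinear_toPoint.comp_projMap hg
  let A : ∀ g : V → V, (∀ v, g v = 0 → v = 0) → ℙ F V → ℙ F V := fun g hk p =>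
    Projectivization.mk F (g p.rep) fun e => p.rep_nonzero (hk _ e)
  have hA : ∀ (g : V → V) (hg : IsProjMap F g) (hk : ∀ v, g v = 0 → v = 0) (v : V),
      toPoint F (g v) = (toPoint F v).map (A g hk) := by
    intro g hg hk v
    by_cases hv : v = 0
    · rw [hv, hg.map_zero, toPoint_eq_none.2 rfl]; rfl
    rw [toPoint_of_ne hv, Option.map_some, ← toPoint_of_ne]
    refine (vl hg).eq_of_proportional ?_
    rw [← toPoint_eq_toPoint hv, toPoint_rep, toPoint_of_ne hv]
  have inv : ∀ (g h : V → V) (hg : IsProjMap F g) (hh : IsProjMap F h) (hgk : ∀ v, g v = 0 → v = 0)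
      (hhk : ∀ v, h v = 0 → v = 0), (∀ v, Proportional F (h (g v)) v) → ∀ p,
      A h hhk (A g hgk p) = p := by
    intro g h hg hh hgk hhk hhg p
    have h1 := hA h hh hhk (g p.rep)
    rw [hA g hg hgk, toPoint_rep, Option.map_some, Option.map_some,
      isVecLinear_toPoint.eq_of_proportional (hhg _), toPoint_rep, Option.some_inj] at h1
    exact h1.symm
  refine ⟨⟨A g hgk, A h hhk, inv g h hg hh hgk hhk hhg, inv h g hh hg hhk hgk hgh⟩,
    fun l => ⟨fun hl => image_line_of_isVecLinear (vl hg) hgk (hA g hg hgk) hl, fun hl => ?_⟩,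
    hA g hg hgk⟩
  have := image_line_of_isVecLinear (vl hh) hhk (hA h hh hhk) hl
  rw [← Set.image_comp] at this
  rwa [show A h hhk ∘ (⟨A g hgk, A h hhk, inv g h hg hh hgk hhk hhg,
    inv h g hh hg hhk hgk hgh⟩ : Equiv.Perm (ℙ F V)) = id from
      funext fun p => inv g h hg hh hgk hhk hhg p, Set.image_id] at this

end Collineation

/-! ### Choice of coordinates in the target -/

section Product

variable {F V W : Type*} [Field F] [AddCommGroup V] [Module F V] [AddCommGroup W] [Module F W]

theorem IsProjMap.mem_of_mem_span {g : V → W} (hg : IsProjMap F g) {s : Set V} {S : Submodule F W}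
    (hs : ∀ v ∈ s, g v ∈ S) {v : V} (hv : v ∈ Submodule.span F s) : g v ∈ S := by
  induction hv using Submodule.span_induction with
  | mem v hv => exact hs v hv
  | zero => rw [hg.map_zero]; exact S.zero_mem
  | add v w _ _ ihv ihw =>
    obtain ⟨a, b, e⟩ := hg.map_add v w
    rw [e]
    exact S.add_mem (S.smul_mem _ ihv) (S.smul_mem _ ihw)
  | smul c v _ ih =>
    by_cases hc : c = 0
    · rw [hc, zero_smul, hg.map_zero]; exact S.zero_mem
    · obtain ⟨d, -, e⟩ := hg.map_smul c v hc
      rw [e]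
      exact S.smul_mem _ ih

/-- A linear mapping that maps a basis to independent vectors has trivial kernel. -/
theorem IsProjMap.eq_zero_of_linearIndependent {g : V → W} (hg : IsProjMap F g) {ι : Type*}
    (b : Module.Basis ι F V) (hi : LinearIndependent F fun i => g (b i)) {y : V} (hy : g y = 0) :
    y = 0 := by
  by_contra hne
  obtain ⟨j, hj⟩ : ∃ j, b.repr y j ≠ 0 := by
    by_contra! h
    exact hne (b.repr.map_eq_zero_iff.1 (Finsupp.ext h))
  -- Subtracting a multiple of the kernel vector removes the `j`-th coordinate of `b j`. Up to a
  -- factor this does not change the value, which thus lies in the span of the other values.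
  have hmem : b j - (b.repr y j)⁻¹ • y ∈ Submodule.span F (b '' {j}ᶜ) := by
    rw [b.mem_span_image]
    intro i hi
    rintro rfl
    simp [hj] at hi
  have h1 := hg.mem_of_mem_span (S := Submodule.span F ((fun i => g (b i)) '' {j}ᶜ))
    (by rintro _ ⟨i, hi, rfl⟩; exact Submodule.subset_span ⟨i, hi, rfl⟩) hmem
  have h2 := hg.proportional_of_add_kernel
    (hg.kernel.smul_mem (b.repr y j)⁻¹ (show y ∈ hg.kernel from hy))
    (w := b j - (b.repr y j)⁻¹ • y)
  rw [add_sub_cancel] at h2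
  obtain ⟨c, -, e⟩ := h2
  exact hi.notMem_span_image (s := {j}ᶜ) (x := j) (by simp) (by
    rw [e]
    exact Submodule.smul_mem _ _ h1)

/-- Two coordinate systems with the same points differ by a collineation. -/
theorem exists_coordinate_change {Q : Type*} {G : PointLineGeometry Q} (hG : G.IsProjective)
    {q p : V → Option Q} (hq : IsVecLinear F G q) (hp : IsVecLinear F G p)
    (hqk : ∀ v, q v = none → v = 0) (hpk : ∀ v, p v = none → v = 0) (h : ∀ v, ∃ w, q w = p v)
    (h' : ∀ v, ∃ w, p w = q v) :
    ∃ (g : V → V) (α : Equiv.Perm (ℙ F V)), IsProjMap F g ∧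
      (projectiveGeometry F V).IsCollineation α ∧ (∀ v, toPoint F (g v) = (toPoint F v).map α) ∧
      ∀ v, q (g v) = p v := by
  choose g hg using h
  choose k hk using h'
  have hg' : IsProjMap F g := hq.isProjMap_of_comp hG hqk (by simpa only [hg] using hp)
  have hk' : IsProjMap F k := hp.isProjMap_of_comp hG hpk (by simpa only [hk] using hq)
  obtain ⟨α, hα, h⟩ := exists_collineation hg' hk'
    (fun v => hq.proportional_of_eq hqk (by rw [hg, hk]))
    (fun v => hp.proportional_of_eq hpk (by rw [hk, hg]))
  exact ⟨g, α, hg', hα, h, hg⟩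

/-- Coordinates of the target of a linear mapping such that the mapping is given by a linear map of
vectors, and such that finitely many given points are in the range of the coordinates. -/
theorem exists_linear_coordinates {F V : Type u} {Q : Type*} [Field F] [AddCommGroup V] [Module F V]
    [FiniteDimensional F V] {G : PointLineGeometry Q} (hG : G.IsProjective) {q : V → Option Q}
    (hq : IsVecLinear F G q) {E : Submodule F V} (hE : Module.finrank F E = 3)
    (hqE : ∀ w ∈ E, w ≠ 0 → q w ≠ none) (T : Finset Q) :
    ∃ (V' : Type u) (_ : AddCommGroup V') (_ : Module F V') (_ : FiniteDimensional F V')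
      (ψ : V' → Option Q) (f : V →ₗ[F] V'), IsVecLinear F G ψ ∧ (∀ v, ψ v = none → v = 0) ∧
      (∀ x, ψ (f x) = q x) ∧ ∀ p ∈ T, ∃ v, ψ v = some p := by
  -- A complement of the kernel together with `q` itself is the first coordinate system, in which
  -- the given mapping is the projection onto `C`. The image of `E` in `C` supplies the three
  -- independent vectors needed to enlarge it.
  obtain ⟨C, hC⟩ := hq.kernel.exists_isCompl
  let π : V →ₗ[F] C := C.projectionOnto hq.kernel hC.symm
  have hπ : ∀ x, x - (π x : V) ∈ hq.kernel := by
    intro x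
    rw [← Submodule.projectionOnto_apply_eq_zero_iff hC.symm, map_sub, sub_eq_zero]
    exact (Submodule.projectionOnto_apply_left hC.symm _).symm
  have hqπ : ∀ x, q (π x : V) = q x := fun x => by
    have := hq.map_add_of_none _ (π x : V) (hπ x)
    rw [sub_add_cancel] at this
    exact this.symm
  have hk : ∀ v : C, q v = none → v = 0 := by
    intro v hv
    have := hC.disjoint.le_bot (⟨hv, v.2⟩ : (v : V) ∈ hq.kernel ⊓ C)
    simpa using this
  have : FiniteDimensional F E := Module.finite_of_finrank_pos (by omega)
  let e := Module.finBasisOfFinrankEq F E hE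
  have hinj : ∀ w : E, π w = 0 → w = 0 := by
    intro w hw
    by_contra hne
    refine hqE w w.2 (by simpa using hne) ?_
    rw [← hqπ, hw]
    exact hq.map_zero
  have hi : Indep₃ F (π (e 0)) (π (e 1)) (π (e 2)) := by
    intro r s t h
    have h1 := hinj (r • e 0 + s • e 1 + t • e 2) (by simpa using h)
    have := Fintype.linearIndependent_iff.1 e.linearIndependent ![r, s, t]
      (by simpa [Fin.sum_univ_three] using h1)
    exact ⟨this 0, this 1, this 2⟩
  obtain ⟨V', _, _, _, ι, ψ, hψ, hψk, -, hι, hT⟩ :=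
    exists_coordinates hG (hq.comp_linear C.subtype) hk hi T
  exact ⟨V', _, _, inferInstance, ψ, ι.comp π, hψ, hψk, fun x => (hι _).trans (hqπ x), hT⟩

end Product

/-! ### Mappings of a product as bilinear maps -/

section Product

variable {F V₁ : Type u} {V₂ Q ι : Type*} [Field F] [AddCommGroup V₁] [Module F V₁]
  [AddCommGroup V₂] [Module F V₂] {G : PointLineGeometry Q}

/-- A linear mapping of a product lifts to vectors in such a way that it is given by linear maps
for every vector of a basis of the second factor, and on every line of the second factor that joins
the first basis point to another one it is a pencil of linear maps. -/
theorem exists_pencil_coordinates [Fintype ι] [FiniteDimensional F V₁] (hG : G.IsProjective)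
    (b : Module.Basis ι F V₂) {o i₀ : ι} (hi₀ : i₀ ≠ o) {q : V₁ → V₂ → Option Q}
    (hq₁ : ∀ y, IsVecLinear F G fun x => q x y) (hq₂ : ∀ x, IsVecLinear F G (q x))
    {E : Submodule F V₁} (hE : Module.finrank F E = 3)
    (hEo : ∀ w ∈ E, w ≠ 0 → q w (b o) ≠ none)
    (hEi : ∀ i ≠ o, ∀ w ∈ E, w ≠ 0 → q w (b i) ≠ none)
    (hspan : ∀ i ≠ o, 3 < G.dimSucc {p | ∃ w ∈ E, q w (b o) = some p ∨ q w (b i) = some p}) :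
    ∃ (V' : Type u) (_ : AddCommGroup V') (_ : Module F V') (_ : FiniteDimensional F V')
      (ψ : V' → Option Q) (X : V₁ → V₂ → V') (f : ι → V₁ →ₗ[F] V'),
      IsVecLinear F G ψ ∧ (∀ v, ψ v = none → v = 0) ∧ (∀ x y, ψ (X x y) = q x y) ∧
      (∀ y, IsProjMap F fun x => X x y) ∧ (∀ x, IsProjMap F (X x)) ∧
      (∀ i x, Proportional F (X x (b i)) (f i x)) ∧
      ∀ i ≠ o, ∀ t : F × F, t ≠ 0 → ∃ c d : F, (c, d) ≠ 0 ∧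
        ∀ x, Proportional F (X x (t.1 • b o + t.2 • b i)) (c • f o x + d • f i x) := by
  classical
  let e := Module.finBasis F V₁
  -- It suffices to cover the finitely many values at pairs of basis vectors; all other values
  -- follow by lifting in one variable at a time.
  obtain ⟨V', _, _, _, ψ, f₀, hψ, hk, hf₀, hT⟩ := exists_linear_coordinates hG (hq₁ (b o)) hE hEo
    (Finset.univ.image fun k : Fin _ × ι => q (e k.1) (b k.2)).eraseNone
  have hlift₁ : ∀ x j, ∃ u, ψ u = q x (b j) := by
    intro x j
    refine (hq₁ (b j)).exists_lift hG hψ (s := Set.range e) ?_ (e.mem_span x)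
    rintro _ ⟨a, rfl⟩
    rcases h : q (e a) (b j) with _ | p
    · exact ⟨0, hψ.map_zero⟩
    · refine hT p (Finset.mem_eraseNone.2 ?_)
      rw [← h]
      exact Finset.mem_image.2 ⟨(a, j), Finset.mem_univ _, rfl⟩
  have hlift : ∀ x y, ∃ u, ψ u = q x y := fun x y =>
    (hq₂ x).exists_lift hG hψ (s := Set.range b) (by rintro _ ⟨j, rfl⟩; exact hlift₁ x j)
      (b.mem_span y)
  choose X hX using hlift
  have hX₁ : ∀ y, IsProjMap F fun x => X x y := fun y =>
    hψ.isProjMap_of_comp hG hk (by simpa only [hX] using hq₁ y)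
  have hX₂ : ∀ x, IsProjMap F (X x) := fun x =>
    hψ.isProjMap_of_comp hG hk (by simpa only [hX] using hq₂ x)
  have hXo : ∀ x, Proportional F (X x (b o)) (f₀ x) := fun x =>
    hψ.proportional_of_eq hk (by rw [hX, hf₀])
  have hX0 : ∀ x y, X x y = 0 → q x y = none := fun x y h => by rw [← hX, h, hψ.map_zero]
  let L : ι → F × F →ₗ[F] V₂ := fun i =>
    (LinearMap.toSpanSingleton F V₂ (b o)).coprod (LinearMap.toSpanSingleton F V₂ (b i))
  have hL : ∀ i t, L i t = t.1 • b o + t.2 • b i := fun i t => rfl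
  have hL1 : ∀ i, L i (1, 0) = b o := fun i => by simp [hL]
  have hL2 : ∀ i, L i (0, 1) = b i := fun i => by simp [hL]
  have main : ∀ i, i ≠ o → ∃ f₁ : V₁ →ₗ[F] V', PencilMap f₀ f₁ (fun x t => X x (L i t)) ∧
      ∀ t : F × F, t ≠ 0 → ∃ c d : F, (c, d) ≠ 0 ∧
        ∀ x, Proportional F (X x (L i t)) (c • f₀ x + d • f₁ x) := by
    intro i hi
    refine exists_pencilMap (X := fun x t => X x (L i t)) (fun t => hX₁ _)
      (fun x => (hX₂ x).comp_linear (L i)) (fun x => by simpa only [hL1] using hXo x) hE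
      (fun w hw h => ?_) (fun w hw h => ?_) ?_
    · by_contra hne
      exact hEo w hw hne (hX0 _ _ (by rwa [hL1] at h))
    · by_contra hne
      exact hEi i hi w hw hne (hX0 _ _ (by rwa [hL2] at h))
    · have h1 := hψ.dimSucc_le hG {u | ∃ w ∈ E, u = X w (L i (1, 0)) ∨ u = X w (L i (0, 1))}
      have h2 : {p | ∃ v ∈ {u | ∃ w ∈ E, u = X w (L i (1, 0)) ∨ u = X w (L i (0, 1))},
          ψ v = some p} = {p | ∃ w ∈ E, q w (b o) = some p ∨ q w (b i) = some p} := by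
        ext p
        constructor
        · rintro ⟨_, ⟨w, hw, rfl | rfl⟩, h⟩
          · exact ⟨w, hw, Or.inl (by rwa [hX, hL1] at h)⟩
          · exact ⟨w, hw, Or.inr (by rwa [hX, hL2] at h)⟩
        · rintro ⟨w, hw, h | h⟩
          · exact ⟨_, ⟨w, hw, Or.inl rfl⟩, by rwa [hX, hL1]⟩
          · exact ⟨_, ⟨w, hw, Or.inr rfl⟩, by rwa [hX, hL2]⟩
      rw [h2] at h1
      exact_mod_cast (hspan i hi).trans_le h1
  choose f hf hf' using main
  refine ⟨V', _, _, inferInstance, ψ, X, fun i => if hi : i = o then f₀ else f i hi, hψ, hk, hX,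
    hX₁, hX₂, fun i x => ?_, fun i hi t ht => ?_⟩
  · by_cases hi : i = o
    · subst hi
      simpa using hXo x
    · have := (hf i hi).snd x
      rw [hL2] at this
      simpa [hi] using this
  · simpa [hi, hL] using hf' i hi t ht

/-- Under the conditions on a basis of the second factor and a point of the first one, a linear
mapping of a product is, up to a collineation of the second factor, given by a bilinear map. -/
theorem exists_bilinear_coordinates [Fintype ι] [FiniteDimensional F V₁] (hG : G.IsProjective)
    (b : Module.Basis ι F V₂) {o i₀ : ι} (hi₀ : i₀ ≠ o) {q : V₁ → V₂ → Option Q}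
    (hq₁ : ∀ y, IsVecLinear F G fun x => q x y) (hq₂ : ∀ x, IsVecLinear F G (q x))
    {E : Submodule F V₁} (hE : Module.finrank F E = 3)
    (hEo : ∀ w ∈ E, w ≠ 0 → q w (b o) ≠ none)
    (hEi : ∀ i ≠ o, ∀ w ∈ E, w ≠ 0 → q w (b i) ≠ none)
    (hspan : ∀ i ≠ o, 3 < G.dimSucc {p | ∃ w ∈ E, q w (b o) = some p ∨ q w (b i) = some p})
    {A : V₁} (hA : (Fintype.card ι : ℕ∞) ≤ G.dimSucc {p | ∃ y, q A y = some p}) :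
    ∃ (V' : Type u) (_ : AddCommGroup V') (_ : Module F V') (ψ : V' → Option Q)
      (B : V₁ →ₗ[F] V₂ →ₗ[F] V') (g : V₂ → V₂) (α : Equiv.Perm (ℙ F V₂)),
      IsVecLinear F G ψ ∧ (projectiveGeometry F V₂).IsCollineation α ∧
      (∀ v, toPoint F (g v) = (toPoint F v).map α) ∧ ∀ x y, q x (g y) = ψ (B x y) := by
  classical
  obtain ⟨V', _, _, _, ψ, X, f, hψ, hk, hX, hX₁, hX₂, hf, hpencil⟩ :=
    exists_pencil_coordinates hG b hi₀ hq₁ hq₂ hE hEo hEi hspan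
  let B : V₁ →ₗ[F] V₂ →ₗ[F] V' := (b.constr F).toLinearMap.comp (LinearMap.pi f)
  have hB : ∀ x i, B x (b i) = f i x := fun x i => b.constr_basis F (fun j => f j x) i
  have hBb : ∀ x i (s t : F), B x (s • b o + t • b i) = s • f o x + t • f i x := fun x i s t => by
    rw [map_add, map_smul, map_smul, hB, hB]
  have hXA : ∀ y, X A y ∈ Submodule.span F (Set.range fun i => f i A) := fun y => by
    refine (hX₂ A).mem_of_mem_span (s := Set.range b) ?_ (b.mem_span y)
    rintro _ ⟨i, rfl⟩
    obtain ⟨c, -, h⟩ := hf i A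
    rw [h]
    exact Submodule.smul_mem _ _ (Submodule.subset_span ⟨i, rfl⟩)
  -- The values at `A` lie in the span of the vectors `f i A`, one for each basis vector, while
  -- hypothesis (ii) demands at least that dimension.
  have hind : LinearIndependent F fun i => f i A := by
    rw [linearIndependent_iff_card_le_finrank_span]
    have h1 := hψ.dimSucc_le hG (Set.range (X A))
    have h2 : {p | ∃ v ∈ Set.range (X A), ψ v = some p} = {p | ∃ y, q A y = some p} := by
      ext p
      simp only [Set.mem_range, exists_exists_eq_and, hX]
    rw [h2] at h1
    refine (Nat.cast_le.1 (hA.trans h1)).trans (Submodule.finrank_mono ?_)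
    rw [Submodule.span_le]
    rintro _ ⟨y, rfl⟩
    exact hXA y
  have hBA : ∀ y, B A y = 0 → y = 0 := fun y hy =>
    (LinearMap.isProjMap (B A)).eq_zero_of_linearIndependent b (by simpa only [hB] using hind) hy
  have hXAk : ∀ y, X A y = 0 → y = 0 := by
    refine fun y hy => (hX₂ A).eq_zero_of_linearIndependent b ?_ hy
    choose c hc hfc using hf
    have := hind.units_smul fun i => Units.mk0 (c i A) (hc i A)
    convert this using 2 with i
    exact hfc i A
  have hqA : ∀ y, q A y = none → y = 0 := fun y hy => hXAk y (hk _ (by rw [hX, hy]))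
  have hψB : IsVecLinear F G fun y => ψ (B A y) := hψ.comp_linear (B A)
  -- The slice at `A` and `B A` parametrize the same points of the target, both without kernel; `g`
  -- translates between them.
  obtain ⟨g, α, hg, hα, hgα, hgA⟩ := exists_coordinate_change hG (hq₂ A) hψB hqA
    (fun y hy => hBA y (hk _ hy))
    (fun y => hψB.exists_lift hG (hq₂ A) (s := Set.range b) (by
      rintro _ ⟨i, rfl⟩
      exact ⟨b i, by rw [hB, ← hX]; exact hψ.eq_of_proportional (hf i A)⟩) (b.mem_span y))
    (fun y => by
      have h1 : X A y ∈ LinearMap.range (B A) := by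
        refine (Submodule.span_le.2 ?_ : _ ≤ LinearMap.range (B A)) (hXA y)
        rintro _ ⟨i, rfl⟩
        exact ⟨b i, hB A i⟩
      obtain ⟨w, hw⟩ := h1
      exact ⟨w, by rw [hw, hX]⟩)
  have hXgA : ∀ y, Proportional F (X A (g y)) (B A y) := fun y =>
    hψ.proportional_of_eq hk (by rw [hX, hgA])
  have hXg : ∀ x, IsProjMap F fun y => X x (g y) := fun x =>
    hψ.isProjMap_of_comp hG hk (by simpa only [hX] using (hq₂ x).comp_projMap hg)
  have hoi : ∀ i, i ≠ o → Indep₂ F (f o A) (f i A) := by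
    intro i hi s t e
    have := hBA (s • b o + t • b i) (by rw [hBb, e])
    have h2 := congrArg (fun v => b.repr v o) this
    have h3 := congrArg (fun v => b.repr v i) this
    simp [hi, Ne.symm hi] at h2 h3
    exact ⟨h2, h3⟩
  -- The slice at a point of the line joining `b o` to `b i` is a member of the pencil. Its
  -- coefficients are read off at `A`, where `g` was chosen to make them `s` and `t` up to a common
  -- factor.
  have line : ∀ i, i ≠ o → ∀ (s t : F) (x : V₁),
      Proportional F (X x (g (s • b o + t • b i))) (B x (s • b o + t • b i)) := by
    intro i hi s t
    by_cases hst : (s, t) = (0, 0)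
    · rw [Prod.mk.injEq] at hst
      intro x
      rw [hst.1, hst.2, zero_smul, zero_smul, add_zero, map_zero, hg.map_zero, (hX₂ x).map_zero]
      exact .refl 0
    obtain ⟨c, hc, e₁⟩ := (hf o A).symm
    obtain ⟨d, hd, e₂⟩ := (hf i A).symm
    obtain ⟨s', t', h1⟩ := (hX₂ A).exists_preimage (b o) (b i) (s * c) (t * d)
    have h2 : Proportional F (X A (s' • b o + t' • b i)) (X A (g (s • b o + t • b i))) := by
      refine h1.trans (.trans ?_ (hXgA _).symm)
      rw [hBb, e₁, e₂, smul_smul, smul_smul]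
      exact .refl _
    have h3 : Proportional F (g (s • b o + t • b i)) (s' • b o + t' • b i) :=
      (hq₂ A).proportional_of_eq hqA (by
        rw [← hX, ← hX]
        exact hψ.eq_of_proportional h2.symm)
    have h4 : (s', t') ≠ (0, 0) := by
      intro h
      rw [Prod.mk.injEq] at h
      rw [h.1, h.2, zero_smul, zero_smul, add_zero, (hX₂ A).map_zero] at h2
      have h5 := (hXgA (s • b o + t • b i)).symm.trans h2.symm
      have h6 := hoi i hi s t (by rw [← hBb]; exact h5.eq_zero)
      exact hst (by rw [h6.1, h6.2])
    obtain ⟨c', d', -, h5⟩ := hpencil i hi (s', t') h4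
    have h6 : ∀ x, Proportional F (X x (g (s • b o + t • b i))) (c' • f o x + d' • f i x) :=
      fun x => by
        obtain ⟨r, hr, e⟩ := h3
        rw [e]
        exact ((hX₂ x).map_smul r _ hr).trans (h5 x)
    have h7 := (h6 A).symm.trans (hXgA _)
    rw [hBb] at h7
    obtain ⟨r, hr, rfl, rfl⟩ := Proportional.eq_smul_of_indep (hoi i hi) h7
    intro x
    rw [hBb]
    exact (h6 x).trans ⟨r, hr, by module⟩
  have hall : ∀ x, f o x ≠ 0 → ∀ y, Proportional F (X x (g y)) (B x y) := by
    refine fun x hx => (hXg x).proportional_of_basis (B x) b o (by rwa [hB]) fun i s t => ?_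
    -- For `i = o` only a multiple of `b o` is involved; it lies on the line joining `b o` to any
    -- other basis point, for instance `b i₀`.
    by_cases hi : i = o
    · subst hi
      rw [← add_smul]
      simpa using line i₀ hi₀ (s + t) 0 x
    · exact line i hi s t x
  refine ⟨V', _, _, ψ, B, g, α, hψ, hα, hgα, fun x y => ?_⟩
  rw [← hX]
  refine hψ.eq_of_proportional ?_
  -- The exceptional `x` with `f o x = 0` form a proper subspace, since it does not contain `A`.
  -- They are handled by varying the first argument for fixed `y`.
  refine IsProjMap.proportional_of_off_subspace (hX₁ (g y)) (B.flip y).isProjMap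
    (S := LinearMap.ker (f o)) (fun h => hind.ne_zero o ?_) (fun x hx => hall x hx y) x
  have : A ∈ LinearMap.ker (f o) := h ▸ Submodule.mem_top
  exact this

end Product

/-! ### Joins of points -/

section Join

namespace PointLineGeometry

variable {P : Type*} {G : PointLineGeometry P}

theorem join_empty_left (t : Set P) : G.join ∅ t = t := by
  ext; simp [join]

theorem join_empty_right (s : Set P) : G.join s ∅ = s := by
  ext; simp [join]

theorem join_self (a : P) : G.join {a} {a} = {a} := by
  ext z
  constructor
  · rintro ((h | h) | ⟨x, rfl, y, rfl, h, -⟩)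
    exacts [h, h, absurd rfl h]
  · exact fun h => Or.inl (Or.inl h)

theorem IsProjective.join_eq (hG : G.IsProjective) {a b : P} (hab : a ≠ b) {g : Set P}
    (hg : g ∈ G.lines) (ha : a ∈ g) (hb : b ∈ g) : G.join {a} {b} = g := by
  ext z
  constructor
  · rintro ((rfl | rfl) | ⟨x, rfl, y, rfl, -, g', hg', hx, hy, hz⟩)
    · exact ha
    · exact hb
    · rwa [hG.line_eq hg hg' hab ha hb hx hy]
  · exact fun h => Or.inr ⟨a, rfl, b, rfl, hab, g, hg, ha, hb, h⟩

end PointLineGeometry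

end Join

/-! ### Restriction to the factors of a product -/

section Slices

variable {P₁ P₂ Q : Type*} {G₁ : PointLineGeometry P₁} {G₂ : PointLineGeometry P₂}
  {G : PointLineGeometry Q} {χ : P₁ × P₂ →. Q}

theorem PFun.image_singleton_eq {α β : Type*} (f : α →. β) (a : α) :
    f.image {a} = {b | b ∈ f a} := by
  ext b
  simp [PFun.mem_image]

namespace PointLineGeometry

theorem join_prod_left {x y : P₁} (r : P₂) :
    (G₁.prod G₂).join {(x, r)} {(y, r)} = (fun p => (p, r)) '' G₁.join {x} {y} := by
  ext ⟨z, w⟩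
  constructor
  · rintro ((h | h) | ⟨_, rfl, _, rfl, hne, g, hg, hx, hy, hz⟩)
    · obtain ⟨rfl, rfl⟩ := Prod.mk.inj h
      exact ⟨z, Or.inl (Or.inl rfl), rfl⟩
    · obtain ⟨rfl, rfl⟩ := Prod.mk.inj h
      exact ⟨z, Or.inl (Or.inr rfl), rfl⟩
    · rcases hg with ⟨x₁, g₂, -, rfl⟩ | ⟨g₁, hg₁, x₂, rfl⟩
      · exact absurd (Prod.ext (hx.1.trans hy.1.symm) rfl) hne
      · obtain rfl : w = r := hz.2.trans hx.2.symm
        exact ⟨z, Or.inr ⟨x, rfl, y, rfl, fun h => hne (by rw [h]), g₁, hg₁, hx.1, hy.1, hz.1⟩, rfl⟩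
  · rintro ⟨_, (rfl | rfl) | ⟨_, rfl, _, rfl, hne, g, hg, hx, hy, hz⟩, h⟩
    · obtain ⟨rfl, rfl⟩ := Prod.mk.inj h
      exact Or.inl (Or.inl rfl)
    · obtain ⟨rfl, rfl⟩ := Prod.mk.inj h
      exact Or.inl (Or.inr rfl)
    · obtain ⟨rfl, rfl⟩ := Prod.mk.inj h
      exact Or.inr ⟨_, rfl, _, rfl, fun h => hne (Prod.mk.inj h).1, _, Or.inr ⟨g, hg, r, rfl⟩,
        ⟨hx, rfl⟩, ⟨hy, rfl⟩, ⟨hz, rfl⟩⟩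

theorem join_prod_right {x y : P₂} (r : P₁) :
    (G₁.prod G₂).join {(r, x)} {(r, y)} = (fun p => (r, p)) '' G₂.join {x} {y} := by
  ext ⟨w, z⟩
  constructor
  · rintro ((h | h) | ⟨_, rfl, _, rfl, hne, g, hg, hx, hy, hz⟩)
    · obtain ⟨rfl, rfl⟩ := Prod.mk.inj h
      exact ⟨z, Or.inl (Or.inl rfl), rfl⟩
    · obtain ⟨rfl, rfl⟩ := Prod.mk.inj h
      exact ⟨z, Or.inl (Or.inr rfl), rfl⟩
    · rcases hg with ⟨x₁, g₂, hg₂, rfl⟩ | ⟨g₁, -, x₂, rfl⟩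
      · obtain rfl : w = r := hz.1.trans hx.1.symm
        exact ⟨z, Or.inr ⟨x, rfl, y, rfl, fun h => hne (by rw [h]), g₂, hg₂, hx.2, hy.2, hz.2⟩, rfl⟩
      · exact absurd (congrArg (Prod.mk r) ((show x = x₂ from hx.2).trans (show y = x₂ from hy.2).symm)) hne
  · rintro ⟨_, (rfl | rfl) | ⟨_, rfl, _, rfl, hne, g, hg, hx, hy, hz⟩, h⟩
    · obtain ⟨rfl, rfl⟩ := Prod.mk.inj h
      exact Or.inl (Or.inl rfl)
    · obtain ⟨rfl, rfl⟩ := Prod.mk.inj h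
      exact Or.inl (Or.inr rfl)
    · obtain ⟨rfl, rfl⟩ := Prod.mk.inj h
      exact Or.inr ⟨_, rfl, _, rfl, fun h => hne (Prod.mk.inj h).2, _, Or.inl ⟨r, g, hg, rfl⟩,
        ⟨rfl, hx⟩, ⟨rfl, hy⟩, ⟨rfl, hz⟩⟩

theorem image_comp_eq {α β : Type*} (f : α → β) (χ : β →. Q) (s : Set α) :
    PFun.image (fun a => χ (f a)) s = χ.image (f '' s) := by
  ext b
  constructor
  · rintro ⟨a, ha, h⟩
    exact ⟨f a, ⟨a, ha, rfl⟩, h⟩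
  · rintro ⟨_, ⟨a, ha, rfl⟩, h⟩
    exact ⟨a, ha, h⟩

/-- The restriction of a linear mapping along a map that is compatible with joins is linear. -/
theorem IsLinearMapping.comp_join {P R : Type*} {H : PointLineGeometry P} {K : PointLineGeometry R}
    {η : P →. Q} (hη : H.IsLinearMapping G η) {f : R → P} (hf : Function.Injective f)
    (hcol : ∀ x y, K.Collinear x y → H.Collinear (f x) (f y))
    (hjoin : ∀ x y, H.join {f x} {f y} = f '' K.join {x} {y}) :
    K.IsLinearMapping G fun x => η (f x) where
  image_join x y h := by
    have := hη.image_join _ _ (hcol x y h)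
    rw [hjoin] at this
    simpa only [image_comp_eq, Set.image_singleton] using this
  exists_exceptional x y he hne h := by
    simp only [image_comp_eq, Set.image_singleton] at he ⊢
    obtain ⟨a, ha, hn⟩ := hη.exists_exceptional _ _ he (hf.ne hne) (hcol x y h)
    rw [hjoin] at ha
    obtain ⟨a, ha, rfl⟩ := ha
    exact ⟨a, ha, hn⟩

theorem IsLinearMapping.slice_left (hχ : (G₁.prod G₂).IsLinearMapping G χ) (r : P₂) :
    G₁.IsLinearMapping G fun p => χ (p, r) :=
  hχ.comp_join (f := fun p => (p, r)) (fun _ _ h => (Prod.mk.inj h).1)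
    (fun _ _ ⟨g, hg, hx, hy⟩ => ⟨g ×ˢ {r}, Or.inr ⟨g, hg, r, rfl⟩, ⟨hx, rfl⟩, ⟨hy, rfl⟩⟩)
    fun _ _ => join_prod_left r

theorem IsLinearMapping.slice_right (hχ : (G₁.prod G₂).IsLinearMapping G χ) (r : P₁) :
    G₂.IsLinearMapping G fun p => χ (r, p) :=
  hχ.comp_join (f := fun p => (r, p)) (fun _ _ h => (Prod.mk.inj h).2)
    (fun _ _ ⟨g, hg, hx, hy⟩ => ⟨{r} ×ˢ g, Or.inl ⟨r, g, hg, rfl⟩, ⟨rfl, hx⟩, ⟨rfl, hy⟩⟩)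
    fun _ _ => join_prod_right r

end PointLineGeometry

end Slices

/-! ### Passage between points and vectors -/

section VecValue

variable {F V Q : Type*} [Field F] [AddCommGroup V] [Module F V] {G : PointLineGeometry Q}

/-- The value of a partial map of the points of a projective space, as a partial map of vectors. -/
noncomputable def vecValue (η : ℙ F V →. Q) (v : V) : Option Q :=
  open Classical in (toPoint F v).bind fun p => (η p).toOption

theorem vecValue_eq_some {η : ℙ F V →. Q} {v : V} {x : ℙ F V} (hx : toPoint F v = some x) {a : Q} :
    vecValue η v = some a ↔ a ∈ η x := by
  classical
  rw [vecValue, hx, Option.bind_some, ← Option.mem_def, Part.mem_toOption]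

theorem vecValue_zero (η : ℙ F V →. Q) : vecValue η 0 = none := by
  rw [vecValue, toPoint_eq_none.2 rfl]
  rfl

theorem image_singleton_of_toPoint {η : ℙ F V →. Q} {v : V} {x : ℙ F V} (hx : toPoint F v = some x) :
    η.image {x} = {a | vecValue η v = some a} := by
  ext a
  rw [PFun.image_singleton_eq, Set.mem_ofPred_eq, Set.mem_ofPred_eq, vecValue_eq_some hx]

theorem mem_join_iff {v w : V} {x y : ℙ F V} (hx : toPoint F v = some x) (hy : toPoint F w = some y)
    (hxy : x ≠ y) {z : ℙ F V} :
    z ∈ (projectiveGeometry F V).join {x} {y} ↔ ∃ s t : F, toPoint F (s • v + t • w) = some z := by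
  have hG := isProjective_projectiveGeometry (indep₂_rep hxy)
  obtain ⟨g, hg, hxg, hyg⟩ := hG.exists_line x y hxy
  rw [hG.join_eq hxy hg hxg hyg]
  exact isVecLinear_toPoint.mem_line v w x y hx hy hxy g hg hxg hyg z

theorem collinear_projectiveGeometry {x y : ℙ F V} (hxy : x ≠ y) :
    (projectiveGeometry F V).Collinear x y :=
  (isProjective_projectiveGeometry (indep₂_rep hxy)).exists_line x y hxy

theorem setOf_some_eq_none : {a : Q | (none : Option Q) = some a} = ∅ := by
  ext; simp

theorem setOf_some_eq_some (b : Q) : {a : Q | some b = some a} = {b} := by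
  ext; simp [eq_comm]

/-- A linear mapping of a projective space gives a linear mapping of vectors. -/
theorem isVecLinear_vecValue (hG : G.IsProjective) {η : ℙ F V →. Q}
    (hη : (projectiveGeometry F V).IsLinearMapping G η) : IsVecLinear F G (vecValue η) := by
  have hs : ∀ {v w : V}, Proportional F v w → vecValue η v = vecValue η w := by
    intro v w h
    rw [vecValue, vecValue, isVecLinear_toPoint.eq_of_proportional h]
  have hsmul : ∀ (c : F) v, vecValue η v = none → vecValue η (c • v) = none := by
    intro c v h
    by_cases hc : c = 0
    · rw [hc, zero_smul, vecValue_zero]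
    · rw [hs (.smul_left hc v), h]
  have pts : ∀ {v w : V}, v ≠ 0 → w ≠ 0 → ¬ Proportional F v w →
      ∃ x y, toPoint F v = some x ∧ toPoint F w = some y ∧ x ≠ y := by
    intro v w hv hw h
    refine ⟨_, _, toPoint_of_ne hv, toPoint_of_ne hw, fun e => h ?_⟩
    rwa [← toPoint_eq_toPoint hv, toPoint_of_ne hv, toPoint_of_ne hw, Option.some_inj]
  have himg : ∀ {v w : V} {x y : ℙ F V}, toPoint F v = some x → toPoint F w = some y → x ≠ y →
      G.join {a | vecValue η v = some a} {a | vecValue η w = some a} =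
        {a | ∃ s t : F, vecValue η (s • v + t • w) = some a} := by
    intro v w x y hx hy hxy
    rw [← image_singleton_of_toPoint hx, ← image_singleton_of_toPoint hy,
      ← hη.image_join x y (collinear_projectiveGeometry hxy)]
    ext a
    constructor
    · rintro ⟨z, hz, ha⟩
      obtain ⟨s, t, e⟩ := (mem_join_iff hx hy hxy).1 hz
      exact ⟨s, t, (vecValue_eq_some e).2 ha⟩
    · rintro ⟨s, t, e⟩
      by_cases h0 : s • v + t • w = 0
      · rw [h0, vecValue_zero] at e
        simp at e
      exact ⟨_, (mem_join_iff hx hy hxy).2 ⟨s, t, toPoint_of_ne h0⟩,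
        (vecValue_eq_some (toPoint_of_ne h0)).1 e⟩
  -- (L1) alone leaves open that `v + w` has no value. Applied again to `-v` and `v + w`, it shows
  -- that `w` has no value in this case either.
  have hadd : ∀ v w, vecValue η v = none →
      vecValue η (v + w) = none ∨ vecValue η (v + w) = vecValue η w := by
    intro v w h
    by_cases hv : v = 0
    · rw [hv, zero_add]
      exact Or.inr rfl
    by_cases hw : w = 0
    · rw [hw, add_zero]
      exact Or.inl h
    by_cases hvw : Proportional F v w
    · obtain ⟨c, hc, e⟩ := hvw.symm
      rw [e, show v + c • v = (1 + c) • v by module]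
      exact Or.inl (hsmul _ _ h)
    obtain ⟨x, y, hx, hy, hxy⟩ := pts hv hw hvw
    have := himg hx hy hxy
    rw [h, setOf_some_eq_none, PointLineGeometry.join_empty_left] at this
    rcases h' : vecValue η (v + w) with _ | a
    · exact Or.inl rfl
    · have h1 : a ∈ {a | ∃ s t : F, vecValue η (s • v + t • w) = some a} :=
        ⟨1, 1, by simpa using h'⟩
      rw [← this] at h1
      exact Or.inr h1.symm
  refine ⟨vecValue_zero η, fun c v hc => hs (.smul_left hc v), fun v w h => ?_, fun v w h => ?_,
    fun v w a b ha hb hab g hg hag hbg p => ?_⟩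
  · rcases hadd v w h with h1 | h1
    · rcases hadd ((-1 : F) • v) (v + w) (hsmul _ _ h) with h2 | h2
      · rw [show (-1 : F) • v + (v + w) = w by module] at h2
        rw [h1, h2]
      · rw [show (-1 : F) • v + (v + w) = w by module] at h2
        rw [h2]
    · exact h1
  · by_cases hn : vecValue η v = none
    · refine ⟨1, one_ne_zero, ?_⟩
      rw [one_smul]
      rcases hadd v w hn with h1 | h1
      exacts [h1, h1.trans (h.symm.trans hn)]
    have hv : v ≠ 0 := by rintro rfl; exact hn (vecValue_zero η)
    have hw : w ≠ 0 := by rintro rfl; exact hn (h.trans (vecValue_zero η))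
    by_cases hvw : Proportional F v w
    · obtain ⟨c, hc, e⟩ := hvw
      exact ⟨-c, neg_ne_zero.2 hc, by rw [e, show c • w + -c • w = 0 by module, vecValue_zero]⟩
    obtain ⟨x, y, hx, hy, hxy⟩ := pts hv hw hvw
    obtain ⟨z, hz, e⟩ := hη.exists_exceptional x y
      (by rw [image_singleton_of_toPoint hx, image_singleton_of_toPoint hy, h]) hxy
      (collinear_projectiveGeometry hxy)
    obtain ⟨s, t, hst⟩ := (mem_join_iff hx hy hxy).1 hz
    rw [image_singleton_of_toPoint hst] at e
    have e' : vecValue η (s • v + t • w) = none :=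
      Option.eq_none_iff_forall_ne_some.2 fun a ha => Set.eq_empty_iff_forall_notMem.1 e a ha
    have hst0 : s • v + t • w ≠ 0 := fun h0 => by
      rw [toPoint_eq_none.2 h0] at hst
      simp at hst
    have hs0 : s ≠ 0 := by
      rintro rfl
      rw [zero_smul, zero_add] at e' hst0
      have ht0 : t ≠ 0 := by rintro rfl; simp at hst0
      exact hn (by rw [h, ← hs (.smul_left ht0 w), e'])
    have ht0 : t ≠ 0 := by
      rintro rfl
      rw [zero_smul, add_zero] at e'
      exact hn (by rw [← hs (.smul_left hs0 v), e'])
    refine ⟨s⁻¹ * t, mul_ne_zero (inv_ne_zero hs0) ht0, ?_⟩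
    rw [← e']
    exact hs ⟨s⁻¹, inv_ne_zero hs0, by rw [smul_add, smul_smul, smul_smul, inv_mul_cancel₀ hs0,
      one_smul]⟩
  · have hv : v ≠ 0 := by rintro rfl; simp [vecValue_zero] at ha
    have hw : w ≠ 0 := by rintro rfl; simp [vecValue_zero] at hb
    obtain ⟨x, y, hx, hy, hxy⟩ := pts hv hw fun h => hab (by
      have := hs h
      rwa [ha, hb, Option.some_inj] at this)
    have := himg hx hy hxy
    rw [ha, hb, setOf_some_eq_some, setOf_some_eq_some, hG.join_eq hab hg hag hbg] at this
    rw [this]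
    rfl

/-- The partial map of points that is given by a partial map of vectors. -/
noncomputable def pointValue (q : V → Option Q) : ℙ F V →. Q := fun p => Part.ofOption (q p.rep)

theorem mem_pointValue {q : V → Option Q} {p : ℙ F V} {a : Q} :
    a ∈ pointValue q p ↔ q p.rep = some a := by
  rw [pointValue, Part.mem_ofOption, Option.mem_def]

/-- A linear mapping of vectors induces a linear mapping of the projective space. -/
theorem IsVecLinear.isLinearMapping (hG : G.IsProjective) {q : V → Option Q}
    (hq : IsVecLinear F G q) :
    (projectiveGeometry F V).IsLinearMapping G (pointValue q) := by
  have hrep : ∀ {v : V} {x : ℙ F V}, toPoint F v = some x → q x.rep = q v := fun {v x} h => by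
    refine hq.eq_of_proportional ((toPoint_eq_toPoint x.rep_nonzero).1 ?_)
    rw [toPoint_rep, h]
  have himage : ∀ x : ℙ F V, (pointValue q).image {x} =
      {a | q x.rep = some a} := fun x => by
    rw [PFun.image_singleton_eq]
    exact Set.ext fun a => mem_pointValue
  have hsmul : ∀ (c : F) v a, q (c • v) = some a → q v = some a := by
    intro c v a h
    by_cases hc : c = 0
    · rw [hc, zero_smul, hq.map_zero] at h
      simp at h
    · rwa [hq.map_smul c v hc] at h
  refine ⟨fun x y _ => ?_, fun x y he hxy _ => ?_⟩
  · rw [himage, himage]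
    by_cases hxy : x = y
    · subst hxy
      rw [PointLineGeometry.join_self, himage]
      rcases q x.rep with _ | a
      · rw [setOf_some_eq_none, PointLineGeometry.join_empty_left]
      · rw [setOf_some_eq_some, PointLineGeometry.join_self]
    have h1 : (pointValue q).image
        ((projectiveGeometry F V).join {x} {y}) =
          {a | ∃ s t : F, q (s • x.rep + t • y.rep) = some a} := by
      ext a
      constructor
      · rintro ⟨z, hz, ha⟩
        obtain ⟨s, t, e⟩ := (mem_join_iff (toPoint_rep x) (toPoint_rep y) hxy).1 hz
        refine ⟨s, t, ?_⟩
        rw [← hrep e]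
        exact mem_pointValue.1 ha
      · rintro ⟨s, t, e⟩
        have h0 : s • x.rep + t • y.rep ≠ 0 := by
          intro h0
          rw [h0, hq.map_zero] at e
          simp at e
        refine ⟨_, (mem_join_iff (toPoint_rep x) (toPoint_rep y) hxy).2 ⟨s, t, toPoint_of_ne h0⟩, ?_⟩
        rw [← hrep (toPoint_of_ne h0)] at e
        exact mem_pointValue.2 e
    rw [h1]
    have hnone : ∀ v w : V, q v = none →
        {a | ∃ s t : F, q (s • v + t • w) = some a} = {a | q w = some a} := by
      intro v w h
      ext a
      constructor
      · rintro ⟨s, t, e⟩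
        rw [hq.map_add_of_none _ _ (hq.kernel.smul_mem s (show v ∈ hq.kernel from h))] at e
        exact hsmul t w a e
      · intro e
        exact ⟨0, 1, by simpa using e⟩
    have hcomm : ∀ v w : V, {a | ∃ s t : F, q (s • v + t • w) = some a} =
        {a | ∃ s t : F, q (s • w + t • v) = some a} := by
      intro v w
      ext a
      constructor <;> rintro ⟨s, t, e⟩ <;> exact ⟨t, s, by rwa [add_comm]⟩
    rcases ha : q x.rep with _ | a
    · rw [hnone _ _ ha, setOf_some_eq_none, PointLineGeometry.join_empty_left]
    rcases hb : q y.rep with _ | b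
    · rw [hcomm, hnone _ _ hb, ha, setOf_some_eq_none, PointLineGeometry.join_empty_right]
    rw [setOf_some_eq_some, setOf_some_eq_some]
    by_cases hab : a = b
    · subst hab
      -- The exceptional vector replaces `x.rep` as a generator of the line, so every point with an
      -- image has the common value.
      obtain ⟨c, hc, e⟩ := hq.exists_none _ _ (ha.trans hb.symm)
      rw [PointLineGeometry.join_self, ← setOf_some_eq_some, ← hb, ← hnone _ _ e]
      ext p
      constructor
      · rintro ⟨s, t, h⟩
        exact ⟨s, t - s * c, by rw [← h]; congr 1; module⟩
      · rintro ⟨s, t, h⟩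
        exact ⟨s, s * c + t, by rw [← h]; congr 1; module⟩
    · obtain ⟨g, hg, hag, hbg⟩ := hG.exists_line a b hab
      rw [hG.join_eq hab hg hag hbg]
      ext p
      exact (hq.mem_line _ _ a b ha hb hab g hg hag hbg p).symm
  · rw [himage, himage] at he
    have hqe : q x.rep = q y.rep := by
      ext a
      exact Set.ext_iff.1 he a
    obtain ⟨c, hc, e⟩ := hq.exists_none _ _ hqe
    have h0 : x.rep + c • y.rep ≠ 0 := fun h0 => by
      have := indep₂_rep hxy 1 c (by rw [one_smul, h0])
      exact one_ne_zero this.1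
    refine ⟨_, (mem_join_iff (toPoint_rep x) (toPoint_rep y) hxy).2 ⟨1, c, by
      rw [one_smul]; exact toPoint_of_ne h0⟩, ?_⟩
    rw [himage, hrep (toPoint_of_ne h0), e, setOf_some_eq_none]

end VecValue

/-! ### Values of a mapping of a product at pairs of vectors -/

section PairValue

variable {F V₁ V₂ Q : Type*} [Field F] [AddCommGroup V₁] [Module F V₁] [AddCommGroup V₂]
  [Module F V₂] {G : PointLineGeometry Q}

/-- The value of a partial map of pairs of points, as a partial map of pairs of vectors. -/
noncomputable def pairValue (χ : ℙ F V₁ × ℙ F V₂ →. Q) (x : V₁) (y : V₂) : Option Q :=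
  (toPoint F x).bind fun p => vecValue (fun r => χ (p, r)) y

variable {χ : ℙ F V₁ × ℙ F V₂ →. Q} {x : V₁} {y : V₂} {p : ℙ F V₁} {r : ℙ F V₂}

theorem pairValue_of_left (hp : toPoint F x = some p) :
    pairValue χ x = vecValue fun r => χ (p, r) := by
  funext y
  rw [pairValue, hp, Option.bind_some]

theorem pairValue_eq_some (hp : toPoint F x = some p) (hr : toPoint F y = some r) {a : Q} :
    pairValue χ x y = some a ↔ a ∈ χ (p, r) := by
  rw [pairValue_of_left hp]
  exact vecValue_eq_some hr

theorem pairValue_zero_left : pairValue χ 0 y = none := by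
  rw [pairValue, toPoint_eq_none.2 rfl]
  rfl

theorem pairValue_zero_right : pairValue χ x 0 = none := by
  rw [pairValue]
  rcases toPoint F x with _ | p
  exacts [rfl, vecValue_zero _]

theorem pairValue_of_right (hr : toPoint F y = some r) :
    (fun x => pairValue χ x y) = vecValue fun p => χ (p, r) := by
  funext x
  by_cases hx : x = 0
  · rw [hx, pairValue_zero_left]
    exact (vecValue_zero _).symm
  · ext a
    rw [pairValue_eq_some (toPoint_of_ne hx) hr]
    exact (vecValue_eq_some (η := fun p => χ (p, r)) (toPoint_of_ne hx)).symm

theorem isVecLinear_none : IsVecLinear F G (fun _ => none : V₁ → Option Q) where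
  map_zero := rfl
  map_smul _ _ _ := rfl
  map_add_of_none _ _ _ := rfl
  exists_none _ _ _ := ⟨1, one_ne_zero, rfl⟩
  mem_line _ _ _ _ h := by simp at h

variable (hG : G.IsProjective)
  (hχ : ((projectiveGeometry F V₁).prod (projectiveGeometry F V₂)).IsLinearMapping G χ)

include hG hχ

theorem isVecLinear_pairValue_left (y : V₂) : IsVecLinear F G fun x => pairValue χ x y := by
  by_cases hy : y = 0
  · subst hy
    simpa only [pairValue_zero_right] using isVecLinear_none
  · rw [pairValue_of_right (toPoint_of_ne hy)]
    exact isVecLinear_vecValue hG (hχ.slice_left _)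

theorem isVecLinear_pairValue_right (x : V₁) : IsVecLinear F G (pairValue χ x) := by
  by_cases hx : x = 0
  · rw [show pairValue χ x = fun _ => none from funext fun y => by rw [hx, pairValue_zero_left]]
    exact isVecLinear_none
  · rw [pairValue_of_left (toPoint_of_ne hx)]
    exact isVecLinear_vecValue hG (hχ.slice_right _)

end PairValue

/-! ### Regular embeddings and the tensor product -/

section Regular

variable {F V₁ : Type u} {V₂ V κ ι : Type*} [Field F] [AddCommGroup V₁] [Module F V₁]
  [AddCommGroup V₂] [Module F V₂] [AddCommGroup V] [Module F V] [Fintype κ] [Fintype ι]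

/-- The image of a regular linear mapping of a product is the set of points represented by pure
tensors, up to a collineation of the second factor. -/
theorem exists_tensor_coordinates (e : Module.Basis κ F V₁) (b : Module.Basis ι F V₂)
    (c : Fin 3 ↪ κ) {o i₀ : ι} (hi₀ : i₀ ≠ o) [FiniteDimensional F V]
    (hV : Module.finrank F V = Fintype.card κ * Fintype.card ι)
    {γ : ℙ F V₁ × ℙ F V₂ →. ℙ F V}
    (hγ : ((projectiveGeometry F V₁).prod (projectiveGeometry F V₂)).IsLinearMapping
      (projectiveGeometry F V) γ) (hdom : γ.Dom = Set.univ)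
    (hreg : (projectiveGeometry F V).dimSucc (γ.image Set.univ) = Module.finrank F V) :
    ∃ (Θ : V₁ ⊗[F] V₂ → Option (ℙ F V)) (g : V₂ → V₂) (α : Equiv.Perm (ℙ F V₂)),
      IsVecLinear F (projectiveGeometry F V) Θ ∧ (∀ v, Θ v = none → v = 0) ∧
      (∀ v, ∃ u, Θ u = toPoint F v) ∧ (projectiveGeometry F V₂).IsCollineation α ∧
      (∀ v, toPoint F (g v) = (toPoint F v).map α) ∧
      ∀ x y, pairValue γ x (g y) = Θ (x ⊗ₜ y) := by
  classical
  have : FiniteDimensional F V₁ := Module.Finite.of_basis e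
  have : FiniteDimensional F V₂ := Module.Finite.of_basis b
  have hG : (projectiveGeometry F V).IsProjective := by
    have h1 : Module.finrank F V ≥ 2 := by
      have h2 := Fintype.card_le_of_embedding c
      have h3 : 0 < Fintype.card ι := Fintype.card_pos_iff.2 ⟨o⟩
      rw [Fintype.card_fin] at h2
      rw [hV]
      nlinarith
    let d := Module.finBasis F V
    have hi := d.linearIndependent.comp ![⟨0, by omega⟩, ⟨1, by omega⟩] (by
      intro i j h
      fin_cases i <;> fin_cases j <;> simp_all)
    have hi2 : Indep₂ F (d ⟨0, by omega⟩) (d ⟨1, by omega⟩) := by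
      rw [indep₂_iff]
      convert hi using 1
      ext i
      fin_cases i <;> rfl
    exact isProjective_projectiveGeometry hi2
  have hne : ∀ x y, x ≠ 0 → y ≠ 0 → ∃ p, pairValue γ x y = some p := by
    intro x y hx hy
    have h : (Projectivization.mk F x hx, Projectivization.mk F y hy) ∈ γ.Dom := by
      rw [hdom]; trivial
    obtain ⟨p, hp⟩ := (PFun.mem_dom γ _).1 h
    exact ⟨p, (pairValue_eq_some (toPoint_of_ne hx) (toPoint_of_ne hy)).2 hp⟩
  have hq₁ := isVecLinear_pairValue_left hG hγ
  have hq₂ := isVecLinear_pairValue_right hG hγ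
  choose Y hY using fun k : κ × ι => hne (e k.1) (b k.2) (e.ne_zero _) (b.ne_zero _)
  let X : κ × ι → V := fun k => (Y k).rep
  have hX : ∀ k, toPoint F (X k) = some (Y k) := fun k => toPoint_rep _
  have hXq : ∀ k, pairValue γ (e k.1) (b k.2) = toPoint F (X k) := fun k => by rw [hY, hX]
  set S := Submodule.span F (Set.range X) with hS
  have hmem : ∀ x y p, pairValue γ x y = some p → p ∈ pgPoints S := by
    have h1 : ∀ x j p, pairValue γ x (b j) = some p → p ∈ pgPoints S := fun x j p =>
      (hq₁ (b j)).mem_of_mem_span hG (isSubspace_pgPoints S) (s := Set.range e) (by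
        rintro _ ⟨a, rfl⟩ p hp
        rw [hXq (a, j)] at hp
        exact (mem_pgPoints_of_toPoint hp S).2 (Submodule.subset_span ⟨_, rfl⟩)) (e.mem_span x)
    intro x y p
    refine (hq₂ x).mem_of_mem_span hG (isSubspace_pgPoints S) (s := Set.range b) ?_ (b.mem_span y)
    rintro _ ⟨j, rfl⟩ p hp
    exact h1 x j p hp
  -- The whole image lies in the span `S` of the values at basis pairs, so regularity forces these
  -- values to form a basis of `V`.
  have hSV : Module.finrank F V ≤ Module.finrank F S := by
    have h1 := isVecLinear_toPoint.dimSucc_le hG {v | ∃ p ∈ γ.image Set.univ, toPoint F v = some p}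
    have h2 : {p | ∃ v ∈ {v | ∃ p ∈ γ.image Set.univ, toPoint F v = some p}, toPoint F v = some p} =
        γ.image Set.univ := by
      ext p
      constructor
      · rintro ⟨v, ⟨p', hp', h⟩, h'⟩
        rw [h, Option.some_inj] at h'
        exact h' ▸ hp'
      · exact fun hp => ⟨p.rep, ⟨p, hp, toPoint_rep p⟩, toPoint_rep p⟩
    rw [h2, hreg] at h1
    refine (Nat.cast_le.1 h1).trans (Submodule.finrank_mono (Submodule.span_le.2 ?_))
    rintro v ⟨p, ⟨⟨x, y⟩, -, hp⟩, h⟩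
    refine (mem_pgPoints_of_toPoint h S).1 (hmem x.rep y.rep p ?_)
    exact (pairValue_eq_some (toPoint_rep x) (toPoint_rep y)).2 hp
  have hStop : S = ⊤ := Submodule.eq_top_of_finrank_eq (le_antisymm (Submodule.finrank_le S) hSV)
  have hXi : LinearIndependent F X := by
    rw [linearIndependent_iff_card_le_finrank_span, Fintype.card_prod, ← hV]
    exact hSV
  have hci : LinearIndependent F (e ∘ c) := e.linearIndependent.comp _ c.injective
  have hcE : ∀ a, e (c a) ∈ Submodule.span F (Set.range (e ∘ c)) := fun a =>
    Submodule.subset_span ⟨a, rfl⟩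
  obtain ⟨V', _, _, ψ, B, g, α, hψ, hα, hgα, hgB⟩ := exists_bilinear_coordinates hG b hi₀ hq₁ hq₂
    (E := Submodule.span F (Set.range (e ∘ c)))
    (by rw [finrank_span_eq_card hci, Fintype.card_fin])
    (fun w _ hw0 => by
      obtain ⟨p, hp⟩ := hne w (b o) hw0 (b.ne_zero o)
      simp [hp])
    (fun i _ w _ hw0 => by
      obtain ⟨p, hp⟩ := hne w (b i) hw0 (b.ne_zero i)
      simp [hp])
    (fun i hi => by
      -- Condition (i) for `γ`: three basis vectors of the first factor and two of the second give
      -- six independent values, more than the four that are needed.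
      have := card_le_dimSucc (v := fun k : Fin 3 × Bool => X (c k.1, if k.2 then o else i))
        (T := {p | ∃ w ∈ Submodule.span F (Set.range (e ∘ c)),
          pairValue γ w (b o) = some p ∨ pairValue γ w (b i) = some p})
        (hXi.comp (fun k : Fin 3 × Bool => (c k.1, if k.2 then o else i)) (by
          rintro ⟨a, s⟩ ⟨a', s'⟩ h
          rw [Prod.mk.injEq, c.injective.eq_iff] at h
          refine Prod.ext h.1 ?_
          have h2 := h.2
          cases s <;> cases s' <;> simp_all))
        (by
          rintro ⟨a, s⟩
          refine ⟨_, ⟨e (c a), hcE a, ?_⟩, hX _⟩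
          cases s
          · exact Or.inr (hY (c a, i))
          · exact Or.inl (hY (c a, o)))
      refine lt_of_lt_of_le ?_ this
      simp only [Fintype.card_prod, Fintype.card_fin, Fintype.card_bool]
      norm_num)
    (A := e (c 0)) (card_le_dimSucc (v := fun j => X (c 0, j))
      (hXi.comp (fun j => (c 0, j)) fun j j' h => (Prod.mk.inj h).2)
      fun j => ⟨_, ⟨b j, hY (c 0, j)⟩, hX _⟩)
  have hΘ : IsVecLinear F (projectiveGeometry F V) fun u => ψ (TensorProduct.lift B u) :=
    hψ.comp_linear (TensorProduct.lift B)
  have honto : ∀ v, ∃ u, ψ (TensorProduct.lift B u) = toPoint F v := by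
    intro v
    refine isVecLinear_toPoint.exists_lift hG hΘ (s := Set.range X) ?_
      (show v ∈ S by rw [hStop]; trivial)
    rintro _ ⟨⟨a, j⟩, rfl⟩
    -- The collineation is undone so that `g` brings the second factor back to the point of `b j`.
    refine ⟨e a ⊗ₜ (α.symm (Projectivization.mk F (b j) (b.ne_zero j))).rep, ?_⟩
    rw [TensorProduct.lift.tmul, ← hgB, ← hXq]
    refine (hq₂ _).eq_of_proportional (Proportional.symm ?_)
    rw [← toPoint_eq_toPoint (b.ne_zero j), hgα, toPoint_rep, Option.map_some,
      Equiv.apply_symm_apply, toPoint_of_ne]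
  refine ⟨_, g, α, hΘ, fun v hv => ?_, honto, hα, hgα, fun x y => by
    rw [hgB, TensorProduct.lift.tmul]⟩
  -- A complement of the kernel already yields all points `Y k`, so its dimension is at least that
  -- of `V`, which equals that of the tensor product. Hence the kernel is zero.
  obtain ⟨C, hC⟩ := hΘ.kernel.exists_isCompl
  have h1 := hΘ.dimSucc_le hG (C : Set (V₁ ⊗[F] V₂))
  rw [Submodule.span_eq] at h1
  have h2 := (card_le_dimSucc hXi fun k => ⟨Y k, ?_, hX k⟩).trans h1
  · have h3 := Submodule.finrank_add_eq_of_isCompl hC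
    rw [Module.finrank_tensorProduct, Module.finrank_eq_card_basis e,
      Module.finrank_eq_card_basis b] at h3
    rw [Fintype.card_prod, Nat.cast_le] at h2
    have h4 : hΘ.kernel = ⊥ := Submodule.finrank_eq_zero.1 (by omega)
    exact (Submodule.mem_bot F).1 (h4 ▸ (show v ∈ hΘ.kernel from hv))
  · obtain ⟨u, hu⟩ := honto (X k)
    have h3 : u ∈ hΘ.kernel ⊔ C := by rw [hC.sup_eq_top]; trivial
    obtain ⟨v, hv, w, hw, rfl⟩ := Submodule.mem_sup.1 h3
    refine ⟨w, hw, ?_⟩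
    rw [← hX, ← hu]
    exact (hΘ.map_add_of_none v w hv).symm

end Regular

theorem mainTheorem1 {F : Type*} [Field F] {n m : ℕ} (hn : 2 ≤ n) (hm : 1 ≤ m)
    {P' : Type*} (G' : PointLineGeometry P') (hG' : G'.IsProjective)
    (χ : PGPoint n F × PGPoint m F →. P')
    (hχ : ((PG n F).prod (PG m F)).IsLinearMapping G' χ)
    (γ : PGPoint n F × PGPoint m F →. PGPoint (n * m + n + m) F)
    (hγ : ((PG n F).prod (PG m F)).IsEmbedding (PG (n * m + n + m) F) γ)
    (hγ_regular : (PG (n * m + n + m) F).dimSucc (γ.image Set.univ) =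
      ((n * m + n + m + 1 : ℕ) : ℕ∞))
    (h_i : ∃ B : Fin (m + 1) → PGPoint m F,
      Projectivization.Independent B ∧
      Projectivization.Subspace.span (Set.range B) = ⊤ ∧
      ∃ W : Submodule F (Fin (n + 1) → F), Module.finrank F W = 3 ∧
        ∀ i : Fin (m + 1), i ≠ 0 →
          pgPoints W ×ˢ {B 0, B i} ⊆ χ.Dom ∧
          3 < G'.dimSucc (χ.image (pgPoints W ×ˢ {B 0, B i})))
    (h_ii : ∃ A : PGPoint n F,
      G'.dimSucc (χ.image ({A} ×ˢ Set.univ)) = ((m + 1 : ℕ) : ℕ∞)) :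
    ∃ (α' : Equiv.Perm (PGPoint m F)) (φ : PGPoint (n * m + n + m) F →. P'),
      (PG m F).IsCollineation α' ∧
      (PG (n * m + n + m) F).IsLinearMapping G' φ ∧
      φ.comp γ =
        χ.comp (PFun.lift fun p : PGPoint n F × PGPoint m F => (p.1, α' p.2)) := by
  obtain ⟨B₀, hB₀, -, E, hE, hEi⟩ := h_i
  obtain ⟨A, hA⟩ := h_ii
  -- The assumption `1 ≤ m` enters here: it gives a basis point other than `B₀ 0`.
  have hlast : Fin.last m ≠ 0 := fun h => by simp [Fin.ext_iff] at h; omega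
  have hBi : LinearIndependent F fun i => (B₀ i).rep := Projectivization.independent_iff.1 hB₀
  let b : Module.Basis (Fin (m + 1)) F (Fin (m + 1) → F) :=
    basisOfLinearIndependentOfCardEqFinrank hBi (by simp)
  have hb : ∀ i, toPoint F (b i) = some (B₀ i) := fun i => by
    rw [coe_basisOfLinearIndependentOfCardEqFinrank, toPoint_rep]
  have hdef : ∀ i ≠ 0, ∀ j, j = 0 ∨ j = i → ∀ w ∈ E, w ≠ 0 → pairValue χ w (b j) ≠ none := by
    intro i hi j hj w hw hw0
    have hmem : (Projectivization.mk F w hw0, B₀ j) ∈ χ.Dom := by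
      refine (hEi i hi).1 ⟨(mem_pgPoints_of_toPoint (toPoint_of_ne hw0) E).2 hw, ?_⟩
      rcases hj with rfl | rfl <;> simp
    obtain ⟨p, hp⟩ := (PFun.mem_dom χ _).1 hmem
    rw [(pairValue_eq_some (toPoint_of_ne hw0) (hb j)).2 hp]
    simp
  obtain ⟨V', _, _, ψ, B, g, α, hψ, hα, hgα, hgB⟩ := exists_bilinear_coordinates hG' b hlast
    (isVecLinear_pairValue_left hG' hχ) (isVecLinear_pairValue_right hG' hχ) hE
    (hdef _ hlast 0 (Or.inl rfl)) (fun i hi => hdef i hi i (Or.inr rfl))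
    (fun i hi => by
      convert (hEi i hi).2 using 2
      ext p
      constructor
      · rintro ⟨w, hw, h⟩
        have hw0 : w ≠ 0 := by
          rintro rfl
          simp [pairValue_zero_left] at h
        have hw' := (mem_pgPoints_of_toPoint (toPoint_of_ne hw0) E).2 hw
        rcases h with h | h
        · exact ⟨(_, B₀ 0), ⟨hw', Or.inl rfl⟩, (pairValue_eq_some (toPoint_of_ne hw0) (hb 0)).1 h⟩
        · exact ⟨(_, B₀ i), ⟨hw', Or.inr rfl⟩, (pairValue_eq_some (toPoint_of_ne hw0) (hb i)).1 h⟩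
      · rintro ⟨⟨x, y⟩, ⟨hx, rfl | rfl⟩, h⟩
        · exact ⟨x.rep, rep_mem.2 hx, Or.inl ((pairValue_eq_some (toPoint_rep x) (hb 0)).2 h)⟩
        · exact ⟨x.rep, rep_mem.2 hx, Or.inr ((pairValue_eq_some (toPoint_rep x) (hb i)).2 h)⟩)
    (A := A.rep) (by
      rw [Fintype.card_fin, ← hA]
      refine le_of_eq (congrArg _ ?_)
      ext p
      constructor
      · rintro ⟨⟨x, y⟩, ⟨rfl, -⟩, h⟩
        exact ⟨y.rep, (pairValue_eq_some (toPoint_rep _) (toPoint_rep y)).2 h⟩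
      · rintro ⟨y, h⟩
        have hy0 : y ≠ 0 := by
          rintro rfl
          simp [pairValue_zero_right] at h
        exact ⟨(A, _), ⟨rfl, trivial⟩, (pairValue_eq_some (toPoint_rep A) (toPoint_of_ne hy0)).1 h⟩)
  have hG : (PG (n * m + n + m) F).IsProjective := by
    have hij : (0 : Fin (n * m + n + m + 1)) ≠ Fin.last _ := fun h => by
      simp [Fin.ext_iff] at h; omega
    refine isProjective_projectiveGeometry (a := Pi.single 0 1) (b := Pi.single (Fin.last _) 1)
      fun s t e => ?_
    have h1 := congrFun e 0
    have h2 := congrFun e (Fin.last _)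
    simp [hij, hij.symm] at h1 h2
    exact ⟨h1, h2⟩
  obtain ⟨Θ, g', β, hΘ, hΘk, honto, hβ, hgβ, hΘg⟩ := exists_tensor_coordinates
    (Pi.basisFun F (Fin (n + 1))) (Pi.basisFun F (Fin (m + 1)))
    (Fin.castLEEmb (by omega : 3 ≤ n + 1)) hlast (by simp; ring) hγ.toIsLinearMapping hγ.global
    (hγ_regular.trans (by simp))
  -- `l` inverts the tensor coordinates of the ambient space of `γ`, and `φ` is `l` followed by the
  -- map of tensors that belongs to `χ`.
  choose l hl using honto
  have hlp : IsProjMap F l :=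
    hΘ.isProjMap_of_comp hG hΘk (by
      simp only [hl]
      exact isVecLinear_toPoint)
  have hψB := hψ.comp_linear (TensorProduct.lift B)
  refine ⟨β.symm.trans α, pointValue fun v => ψ (TensorProduct.lift B (l v)), fun s => ?_,
    (hψB.comp_projMap hlp).isLinearMapping hG', ?_⟩
  · have h1 := hβ (β.symm '' s)
    rw [Equiv.image_symm_image] at h1
    rw [Equiv.coe_trans, Set.image_comp]
    exact h1.symm.trans (hα _)
  · refine PFun.ext fun ⟨p, r⟩ a => ?_
    have h1 : ∀ z, z ∈ γ (p, r) ↔ Θ (p.rep ⊗ₜ (β.symm r).rep) = some z := fun z => by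
      rw [← hΘg, pairValue_eq_some (toPoint_rep p) (by
        rw [hgβ, toPoint_rep, Option.map_some, Equiv.apply_symm_apply])]
    have h2 : a ∈ χ (p, α (β.symm r)) ↔
        ψ (TensorProduct.lift B (p.rep ⊗ₜ (β.symm r).rep)) = some a := by
      rw [TensorProduct.lift.tmul, ← hgB, pairValue_eq_some (toPoint_rep p) (by
        rw [hgα, toPoint_rep, Option.map_some])]
    -- If `z` is the image of `(p, r)` under `γ`, then `l z.rep` is proportional to the pure tensor
    -- of `p` and `β.symm r`, because `Θ` has no kernel. On this tensor `ψ` after `lift B` gives the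
    -- value of `χ` at `(p, α (β.symm r))`.
    have h3 : ∀ z, z ∈ γ (p, r) → (a ∈ pointValue (fun v => ψ (TensorProduct.lift B (l v))) z ↔
        a ∈ χ (p, α (β.symm r))) := fun z hz => by
      rw [mem_pointValue, h2]
      refine Eq.congr_left (hψB.eq_of_proportional (hΘ.proportional_of_eq hΘk ?_))
      rw [hl, toPoint_rep, (h1 z).1 hz]
    have h4 : a ∈ χ.comp (PFun.lift fun p : PGPoint n F × PGPoint m F =>
        (p.1, (β.symm.trans α) p.2)) (p, r) ↔ a ∈ χ (p, α (β.symm r)) :=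
      Iff.of_eq (congrArg (a ∈ ·) (Part.bind_some _ χ))
    rw [h4]
    refine Part.mem_bind_iff.trans ⟨?_, ?_⟩
    · rintro ⟨z, hz, h⟩
      exact (h3 z hz).1 h
    · intro h
      have hdom : (p, r) ∈ γ.Dom := by rw [hγ.global]; trivial
      obtain ⟨z, hz⟩ := (PFun.mem_dom γ _).1 hdom
      exact ⟨z, hz, (h3 z hz).2 h⟩
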